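/- Fix $0<a<1$ and $0<a_0<a/4$. Admissible data are $f_I\in C^2([-1,1])$ and $p_I\in[-1,1]$ such that $f_I(p_I)=0$, $f_I>0$ on $[-1,p_I)$, $f_I<0$ on $(p_I,1]$, $f_I'(\pm1)=0$, $\lambda_I:=-f_I'(p_I)>0$, and $-f_I'(x)>\lambda_I/2$ for all $x\in[-1,1]$ with $|x-p_I|<a_0$. Consider the free boundary problem (P) $$f_t-f_{xx}=\big[\delta_{p(t)+\underline a}-\delta_{p(t)-\underline a}\big]f_x(p(t),t)\ \text{ in }(-1,1),\qquad f_x(\pm1,t)=0,\qquad f(x,0)=f_I(x),$$ where $p(t)$ is the unique zero of $f(\cdot,t)$ in $[-1,1]$ and $\underline a=\underline a(t)=\min\{a,|p(t)-1|,|p(t)+1|\}$. Put $\lambda(t)=-f_x(p(t),t)$. A solution $(f,p)$ of (P) on $[0,T]$ consists of a function $f$, continuous on $[-1,1]\times[0,T]$ with $f(\cdot,0)=f_I$, such that for each $t\in[0,T]$ the function $f(\cdot,t)$ has exactly one zero $p(t)$ in $[-1,1]$, with $p(t)\in(-1,1)$ and $f(\cdot,t)$ differentiable at $p(t)$, and such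 that (P) holds in the sense of Duhamel's formula: for $x\in[-1,1]$, $0<t\le T$, $$f(x,t)=\int_{-1}^1\Gamma(x,y;t)f_I(y)\,dy+\int_0^t\big[\Gamma(x,p(s)-\underline a(s);t-s)-\Gamma(x,p(s)+\underline a(s);t-s)\big]\lambda(s)\,ds,$$ where the last integrand is integrable and $\Gamma(x,y;t)=\sum_{k\in\mathbb Z}K\big(x-(2k+(-1)^{|k|}y),t\big)$, $K(x,t)=(4\pi t)^{-1/2}e^{-x^2/(4t)}$, is the Neumann heat kernel of $(-1,1)$. Moreover it is required that, at all points $(x,t)\in(-1,1)\times(0,T)$ with $x\ne p(t)\pm\underline a(t)$, $f$ is $C^2$ near $(x,t)$ and $f_t=f_{xx}$, and that, for $0<t\le T$, $f_x(1,t)=0$ if $p(t)+\underline a(t)<1$ and $f_x(-1,t)=0$ if $p(t)-\underline a(t)>-1$ (one-sided derivatives). Then there is $t_0>0$, depending only on $\|f_I\|_{L^\infty(-1,1)}$ and $\lambda_I$ (and on the fixed parameters $a,a_0$), such that for all admissible data (P) has a solution $(f,p)$ on $[0,t_0]$. Moreover, $f$ is smooth across the free boundary: there is $r>0$ such that $f$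 is $C^\infty$ on $\{(x,t):0<t\le t_0,\ |x-p(t)|\le r\}$. Furthermore $\lambda(t)\ge\lambda_I/4>0$ for all $t\in[0,t_0]$, in particular $\lambda(t_0)\ge\lambda_I/4>0$, and there is a constant $a_1>0$, depending only on the initial data (and on $a,a_0$), such that $|p(t)-p_I|\le a_1\sqrt t$ for all $t\in[0,t_0]$. -/

import Mathlib

open Set
open scoped ContDiff

namespace PriceFormation

/-- The heat kernel on the real line, `K(x,t) = (4 π t)^(-1/2) exp (-x² / (4 t))`, for `t > 0`. -/
noncomputable def heatKernel (x t : ℝ) : ℝ :=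
  1 / Real.sqrt (4 * Real.pi * t) * Real.exp (-x ^ 2 / (4 * t))

/-- The fundamental solution of the heat equation on `(-1,1)` with Neumann boundary conditions,
`Γ(x,y;t) = ∑_k K(x - (2k + (-1)^|k| y), t)`. -/
noncomputable def neumannKernel (x y t : ℝ) : ℝ :=
  ∑' k : ℤ, heatKernel (x - (2 * (k : ℝ) + (-1) ^ k.natAbs * y)) t

/-- The distance `min {a, |p - 1|, |p + 1|}` between the price `p` and the source and the sink. -/
noncomputable def sourceDist (a p : ℝ) : ℝ := min a (min |p - 1| |p + 1|)

/-- The flux `λ(t) = -f_x(p(t),t)` across the free boundary. -/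
noncomputable def flux (f : ℝ → ℝ → ℝ) (p : ℝ → ℝ) (t : ℝ) : ℝ :=
  -deriv (fun x => f x t) (p t)

/-- The initial flux `λ_I = -f_I'(p_I)`, for `f_I` given on `[-1,1]`. -/
noncomputable def initialFlux (fI : ℝ → ℝ) (pI : ℝ) : ℝ :=
  -derivWithin fI (Icc (-1) 1) pI

/-- Admissible initial data: `f_I ∈ C²([-1,1])` vanishes exactly at `p_I`, is positive to the left
and negative to the right of `p_I`, satisfies the Neumann condition, and has `λ_I > 0` and
`-f_I' > λ_I / 2` within distance `a₀` of `p_I`. -/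
structure InitialData (a₀ : ℝ) (fI : ℝ → ℝ) (pI : ℝ) : Prop where
  contDiffOn : ContDiffOn ℝ 2 fI (Icc (-1) 1)
  mem : pI ∈ Icc (-1 : ℝ) 1
  zero : fI pI = 0
  pos : ∀ x ∈ Icc (-1 : ℝ) 1, x < pI → 0 < fI x
  neg : ∀ x ∈ Icc (-1 : ℝ) 1, pI < x → fI x < 0
  neumann_left : derivWithin fI (Icc (-1) 1) (-1) = 0
  neumann_right : derivWithin fI (Icc (-1) 1) 1 = 0
  flux_pos : 0 < initialFlux fI pI
  steep : ∀ x ∈ Icc (-1 : ℝ) 1, |x - pI| < a₀ →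
    initialFlux fI pI / 2 < -derivWithin fI (Icc (-1) 1) x

/-- The integrand of the source term of Duhamel's formula for problem (P): the source and the sink,
located at `p(s) ∓ sourceDist a (p(s))`, have strength `λ(s)`. -/
noncomputable def duhamelIntegrand (a : ℝ) (f : ℝ → ℝ → ℝ) (p : ℝ → ℝ) (x t s : ℝ) : ℝ :=
  (neumannKernel x (p s - sourceDist a (p s)) (t - s)
    - neumannKernel x (p s + sourceDist a (p s)) (t - s)) * flux f p s

/-- `(f,p)` solves, on `[-1,1] × [0,T]`, the free boundary problem
`f_t - f_xx = (δ_{p(t)+d(t)} - δ_{p(t)-d(t)}) f_x(p(t),t)`, `f_x(±1,t) = 0`, `f(x,0) = f_I(x)`,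
where `p(t)` is the only zero of `f(·,t)` and `d(t) = sourceDist a (p(t))`.

The equation with its Neumann condition is expressed by Duhamel's formula. In addition `f` satisfies
the heat equation classically away from source and sink, and the Neumann condition classically at
each end point where neither the source nor the sink sits. -/
structure IsSolution (a T : ℝ) (fI : ℝ → ℝ) (f : ℝ → ℝ → ℝ) (p : ℝ → ℝ) : Prop where
  continuousOn : ContinuousOn (fun q : ℝ × ℝ => f q.1 q.2) (Icc (-1) 1 ×ˢ Icc 0 T)
  initial : ∀ x ∈ Icc (-1 : ℝ) 1, f x 0 = fI x
  mem : ∀ t ∈ Icc 0 T, p t ∈ Ioo (-1 : ℝ) 1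
  zero_iff : ∀ t ∈ Icc 0 T, ∀ x ∈ Icc (-1 : ℝ) 1, f x t = 0 ↔ x = p t
  differentiableAt : ∀ t ∈ Icc 0 T, DifferentiableAt ℝ (fun x => f x t) (p t)
  integrable : ∀ x ∈ Icc (-1 : ℝ) 1, ∀ t ∈ Ioc 0 T,
    IntervalIntegrable (duhamelIntegrand a f p x t) MeasureTheory.volume 0 t
  duhamel : ∀ x ∈ Icc (-1 : ℝ) 1, ∀ t ∈ Ioc 0 T,
    f x t = (∫ y in (-1 : ℝ)..1, neumannKernel x y t * fI y)
      + ∫ s in (0 : ℝ)..t, duhamelIntegrand a f p x t s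
  heat : ∀ x ∈ Ioo (-1 : ℝ) 1, ∀ t ∈ Ioo 0 T,
    x ≠ p t - sourceDist a (p t) → x ≠ p t + sourceDist a (p t) →
      ContDiffAt ℝ 2 (fun q : ℝ × ℝ => f q.1 q.2) (x, t) ∧
      deriv (fun s => f x s) t = iteratedDeriv 2 (fun y => f y t) x
  neumann_left : ∀ t ∈ Ioc 0 T, -1 < p t - sourceDist a (p t) →
    HasDerivWithinAt (fun x => f x t) 0 (Icc (-1) 1) (-1)
  neumann_right : ∀ t ∈ Ioc 0 T, p t + sourceDist a (p t) < 1 →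
    HasDerivWithinAt (fun x => f x t) 0 (Icc (-1) 1) 1

end PriceFormation

namespace PriceFormation
open MeasureTheory Filter Topology

/-! Put δ = a₀/8. The steepness hypothesis is incompatible with f_I'(±1) = 0 within distance a₀ of
p_I, so p_I ± a₀ lies in [-1,1]. As long as |p - p_I| ≤ δ, source and sink therefore stay at
distance at least 7δ from p. Away from the space-time origin the heat kernel is smooth, also across
t = 0. Hence for |x| ≤ 1 - 5δ the Neumann kernel is K(x-y,t)ψ(x-y) + N(x,y,t) with a cutoff ψ and a
smooth compactly supported N vanishing for t ≤ 0 (`exists_regularKernel`). Near p_I the source term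
sees only N, which is O(t) together with its derivatives.

Duhamel's formula near p_I thus reads f = w + S[p,λ], where w evolves the initial data and S has a
small smooth kernel. The pair (p,λ) is a fixed point of the map sending (p,l) to the zero of w +
S[p,l] and minus the slope there; for short times this is a contraction of C([0,T],ℝ²)
(`FixedPointData.exists_fixedPoint`).

The delicate point is that T may depend only on M = sup|f_I| and λ_I, while f_I' is not controlled
by M. The slope bound w_x ≤ -λ_I/2 + O(t) is one-sided and follows from steepness by a quadratic
majorant (`Localization.gaussAvg_deriv_le`). All other derivative bounds put the derivatives on the
heat kernel: w_x is O(t^(-1/2)) and the Lipschitz constant of w_x is O(1/t), with constants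
depending on M only (`exists_deriv_gaussAvg_bound`). So the flux is controlled in the weighted form
|l|√t ≤ B, which is integrable in time, and the factor 1/t is cancelled by the factor t gained in S
(`FixedPointData.contract`).

Given (p,l), Duhamel's formula defines f on all of [-1,1]. Smoothness off source and sink comes from
that of the kernel, the Neumann conditions from its reflection symmetry, and continuity at t = 0
from even reflection of f_I. It remains to exclude further zeros. Within δ of p_I, f is strictly
decreasing. On [-1, p_I - δ] only the source acts, f is positive initially and at the right end, and
evenness about -1 makes that end an interior point, so the minimum principle gives f > 0. To have a
smooth supersolution, the source kernel Γ is replaced by ηΓ with an increasing switch η(t-s)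
(`pos_left_of_free_boundary`). The right side follows by symmetry. -/

theorem eventually_forall_of_isCompact {X P : Type*} [TopologicalSpace X] [TopologicalSpace P]
    {C : Set P} (hC : IsCompact C) {X₀ : X}
    {p : X × P → Prop} (h : ∀ c ∈ C, ∀ᶠ q in 𝓝 (X₀, c), p q) :
    ∀ᶠ x in 𝓝 X₀, ∀ c ∈ C, p (x, c) :=
  hC.eventually_forall_of_forall_eventually fun c hc => h c hc

/-- The partial derivative of `H` in the direction `v` of the first factor. -/
noncomputable def partialDeriv {X P E : Type} [NormedAddCommGroup X] [NormedSpace ℝ X]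
    [NormedAddCommGroup P] [NormedSpace ℝ P] [NormedAddCommGroup E] [NormedSpace ℝ E]
    (H : X × P → E) (v : X) (q : X × P) : E := fderiv ℝ H q (v, 0)

theorem contDiffAt_partialDeriv {X P E : Type} [NormedAddCommGroup X] [NormedSpace ℝ X]
    [NormedAddCommGroup P] [NormedSpace ℝ P] [NormedAddCommGroup E] [NormedSpace ℝ E]
    {H : X × P → E} {q : X × P} (hH : ContDiffAt ℝ ∞ H q) (v : X) :
    ContDiffAt ℝ ∞ (partialDeriv H v) q :=
  (hH.fderiv_right (m := ∞) (by simp)).clm_apply contDiffAt_const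

/-! ### Smooth dependence of integrals on parameters -/

section ParametricIntegral

variable {Ω X P : Type} [MeasurableSpace Ω] {μ : Measure Ω}
  [NormedAddCommGroup X] [NormedSpace ℝ X]
  [NormedAddCommGroup P] [NormedSpace ℝ P] [MeasurableSpace P] [BorelSpace P]
  [SecondCountableTopology P]

theorem stronglyMeasurable_comp_of_continuousOn {P : Type} [TopologicalSpace P]
    [MeasurableSpace P] [BorelSpace P] [SecondCountableTopology P] {E : Type} [NormedAddCommGroup E]
    {g : P → E} {C : Set P} (hg : ContinuousOn g C) {π : Ω → P} (hπ : Measurable π)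
    (hπC : ∀ z, π z ∈ C) : StronglyMeasurable fun z => g (π z) := by
  have h1 : Continuous (fun c : C => g c) := continuousOn_iff_continuous_domRestrict.1 hg
  have h2 : Measurable (fun z => (⟨π z, hπC z⟩ : C)) := hπ.subtype_mk
  exact h1.stronglyMeasurable.comp_measurable h2

/-- Compactness of `C` bounds the derivative of `H` by one constant for all x near `X₀`, so a
multiple of |w| dominates. The conclusion holds on a neighbourhood rather than at `X₀` alone, so
that it can be differentiated again. -/
theorem eventually_hasFDerivAt_integral {E : Type} [NormedAddCommGroup E] [NormedSpace ℝ E]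
    {H : X × P → E} {X₀ : X} {C : Set P} (hC : IsCompact C)
    (hH : ∀ c ∈ C, ContDiffAt ℝ 1 H (X₀, c)) {w : Ω → ℝ} (hw : Integrable w μ)
    {π : Ω → P} (hπ : Measurable π) (hπC : ∀ z, π z ∈ C) :
    ∀ᶠ x in 𝓝 X₀, Integrable (fun z => w z • H (x, π z)) μ ∧
      Integrable (fun z => w z • (fderiv ℝ H (x, π z)).comp (ContinuousLinearMap.inl ℝ X P)) μ ∧
      HasFDerivAt (fun x => ∫ z, w z • H (x, π z) ∂μ)
      (∫ z, w z • (fderiv ℝ H (x, π z)).comp (ContinuousLinearMap.inl ℝ X P) ∂μ) x := by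
  have hcont : ∀ c ∈ C, ContinuousAt (fderiv ℝ H) (X₀, c) := fun c hc =>
    ((hH c hc).fderiv_right (m := 0) (by norm_num)).continuousAt
  obtain ⟨B, hB⟩ : ∃ B : ℝ, ∀ c ∈ C, ‖fderiv ℝ H (X₀, c)‖ ≤ B := by
    apply hC.exists_bound_of_continuousOn
    intro c hc
    exact (ContinuousAt.comp (f := fun c : P => (X₀, c)) (hcont c hc)
      (by fun_prop)).continuousWithinAt
  have hev : ∀ᶠ x in 𝓝 X₀, ∀ c ∈ C,
      (ContDiffAt ℝ 1 H (x, c) ∧ ‖fderiv ℝ H (x, c)‖ ≤ B + 1) := by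
    apply eventually_forall_of_isCompact hC (p := fun q => ContDiffAt ℝ 1 H q ∧
      ‖fderiv ℝ H q‖ ≤ B + 1)
    intro c hc
    refine ((hH c hc).eventually (by simp)).and ?_
    have := (hcont c hc).norm.eventually (gt_mem_nhds (lt_of_le_of_lt (hB c hc) (lt_add_one B)))
    exact this.mono fun q hq => le_of_lt hq
  filter_upwards [hev.eventually_nhds] with x hx
  have hx0 := hx.self_of_nhds
  have hmeas : ∀ y, (∀ c ∈ C, (ContDiffAt ℝ 1 H (y, c) ∧ ‖fderiv ℝ H (y, c)‖ ≤ B + 1)) →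
      AEStronglyMeasurable (fun z => w z • H (y, π z)) μ := by
    intro y hy
    refine hw.aestronglyMeasurable.smul
      (stronglyMeasurable_comp_of_continuousOn (g := fun c => H (y, c)) (C := C) ?_ hπ
        hπC).aestronglyMeasurable
    intro c hc
    exact (ContinuousAt.comp (f := fun c : P => (y, c)) (hy c hc).1.continuousAt
      (by fun_prop)).continuousWithinAt
  have hbd : ∃ B', ∀ c ∈ C, ‖H (x, c)‖ ≤ B' := by
    apply hC.exists_bound_of_continuousOn
    intro c hc
    exact (ContinuousAt.comp (f := fun c : P => (x, c)) (hx0 c hc).1.continuousAt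
      (by fun_prop)).continuousWithinAt
  obtain ⟨B', hB'⟩ := hbd
  have hint : Integrable (fun z => w z • H (x, π z)) μ := by
    refine (hw.norm.mul_const B').mono' (hmeas x hx0) (ae_of_all _ fun z => ?_)
    rw [norm_smul]
    exact mul_le_mul_of_nonneg_left (hB' _ (hπC z)) (norm_nonneg _)
  have hbound : ∀ y, (∀ c ∈ C, (ContDiffAt ℝ 1 H (y, c) ∧ ‖fderiv ℝ H (y, c)‖ ≤ B + 1)) →
      ∀ z, ‖w z • (fderiv ℝ H (y, π z)).comp (ContinuousLinearMap.inl ℝ X P)‖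
        ≤ ‖w z‖ * (B + 1) := by
    intro y hy z
    rw [norm_smul]
    refine mul_le_mul_of_nonneg_left ?_ (norm_nonneg _)
    refine (ContinuousLinearMap.opNorm_comp_le _ _).trans ?_
    have h1 := (hy _ (hπC z)).2
    have h2 : ‖ContinuousLinearMap.inl ℝ X P‖ ≤ 1 :=
      ContinuousLinearMap.norm_inl_le_one ℝ X P
    calc _ ≤ ‖fderiv ℝ H (y, π z)‖ * 1 := mul_le_mul_of_nonneg_left h2 (norm_nonneg _)
      _ ≤ B + 1 := by rw [mul_one]; exact h1
  have hmeas' : AEStronglyMeasurable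
      (fun z => w z • (fderiv ℝ H (x, π z)).comp (ContinuousLinearMap.inl ℝ X P)) μ := by
    refine hw.aestronglyMeasurable.smul
      (stronglyMeasurable_comp_of_continuousOn
        (g := fun c => (fderiv ℝ H (x, c)).comp (ContinuousLinearMap.inl ℝ X P)) (C := C) ?_ hπ
        hπC).aestronglyMeasurable
    intro c hc
    have h1 : ContinuousAt (fderiv ℝ H) (x, c) :=
      ((hx0 c hc).1.fderiv_right (m := 0) (by norm_num)).continuousAt
    have h2 : ContinuousAt (fun c => fderiv ℝ H (x, c)) c :=
      ContinuousAt.comp (f := fun c : P => (x, c)) h1 (by fun_prop)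
    exact (h2.clm_comp continuousAt_const).continuousWithinAt
  refine ⟨hint, ?_, ?_⟩
  · exact (hw.norm.mul_const (B + 1)).mono' hmeas' (ae_of_all _ (hbound x hx0))
  refine (hasFDerivAt_integral_of_dominated_of_fderiv_le (𝕜 := ℝ) (s := {y | ∀ c ∈ C,
      (ContDiffAt ℝ 1 H (y, c) ∧ ‖fderiv ℝ H (y, c)‖ ≤ B + 1)})
    (F := fun x z => w z • H (x, π z))
    (F' := fun x z => w z • (fderiv ℝ H (x, π z)).comp (ContinuousLinearMap.inl ℝ X P))
    (bound := fun z => ‖w z‖ * (B + 1)) hx (hx.mono fun y hy => hmeas y hy)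
    hint hmeas' ?_ (hw.norm.mul_const _) ?_)
  · exact ae_of_all _ fun z y hy => hbound y hy z
  · refine ae_of_all _ fun z y hy => ?_
    have h1 : HasFDerivAt H (fderiv ℝ H (y, π z)) (y, π z) :=
      ((hy _ (hπC z)).1.differentiableAt (by norm_num)).hasFDerivAt
    have h2 : HasFDerivAt (fun x : X => (x, π z)) (ContinuousLinearMap.inl ℝ X P) y :=
      hasFDerivAt_prodMk_left y (π z)
    exact (h1.comp y h2).const_smul (w z)

/-- Differentiation under the integral sign to infinite order, for parameters in a compact set. -/
theorem contDiffAt_integral {E : Type} [NormedAddCommGroup E] [NormedSpace ℝ E]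
    {H : X × P → E} {X₀ : X} {C : Set P} (hC : IsCompact C)
    (hH : ∀ c ∈ C, ContDiffAt ℝ ∞ H (X₀, c)) {w : Ω → ℝ} (hw : Integrable w μ)
    {π : Ω → P} (hπ : Measurable π) (hπC : ∀ z, π z ∈ C) :
    ContDiffAt ℝ ∞ (fun x => ∫ z, w z • H (x, π z) ∂μ) X₀ := by
  rw [contDiffAt_infty]
  intro n
  -- The derivative of the integral is an integral of the same shape with values in `X →L[ℝ] E`, so
  -- the target space must vary.
  induction n generalizing E with
  | zero =>
    have h := eventually_hasFDerivAt_integral hC (fun c hc => (hH c hc).of_le (by simp)) hw hπ hπC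
    have h1 : ∀ᶠ x in 𝓝 X₀, ContinuousAt (fun x => ∫ z, w z • H (x, π z) ∂μ) x :=
      h.mono fun x hx => hx.2.2.continuousAt
    rw [Nat.cast_zero, contDiffAt_zero]
    exact ⟨_, h1, fun x hx => ContinuousAt.continuousWithinAt hx⟩
  | succ n ih =>
    rw [Nat.cast_succ, contDiffAt_succ_iff_hasFDerivAt]
    have h := eventually_hasFDerivAt_integral hC (fun c hc => (hH c hc).of_le (by simp)) hw hπ hπC
    refine ⟨fun x => ∫ z, w z • (fderiv ℝ H (x, π z)).comp (ContinuousLinearMap.inl ℝ X P) ∂μ,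
      ⟨_, h, fun x hx => hx.2.2⟩, ?_⟩
    apply ih (H := fun q => (fderiv ℝ H q).comp (ContinuousLinearMap.inl ℝ X P))
    intro c hc
    exact ((hH c hc).fderiv_right (m := ∞) (by simp)).clm_comp contDiffAt_const

theorem eventually_fderiv_integral {H : X × P → ℝ} {X₀ : X} {C : Set P} (hC : IsCompact C)
    (hH : ∀ c ∈ C, ContDiffAt ℝ ∞ H (X₀, c)) {w : Ω → ℝ} (hw : Integrable w μ)
    {π : Ω → P} (hπ : Measurable π) (hπC : ∀ z, π z ∈ C) (v : X) :
    (fun x => fderiv ℝ (fun x => ∫ z, w z • H (x, π z) ∂μ) x v) =ᶠ[𝓝 X₀]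
      fun x => ∫ z, w z • partialDeriv H v (x, π z) ∂μ := by
  have h := eventually_hasFDerivAt_integral hC (fun c hc => (hH c hc).of_le (by simp)) hw hπ hπC
  filter_upwards [h] with x hx
  rw [hx.2.2.fderiv, ContinuousLinearMap.integral_apply hx.2.1]
  simp [partialDeriv]

theorem fderiv_fderiv_integral {H : X × P → ℝ} {X₀ : X} {C : Set P} (hC : IsCompact C)
    (hH : ∀ c ∈ C, ContDiffAt ℝ ∞ H (X₀, c)) {w : Ω → ℝ} (hw : Integrable w μ)
    {π : Ω → P} (hπ : Measurable π) (hπC : ∀ z, π z ∈ C) (v : X) :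
    fderiv ℝ (fun x => fderiv ℝ (fun x => ∫ z, w z • H (x, π z) ∂μ) x v) X₀ v =
      ∫ z, w z • partialDeriv (partialDeriv H v) v (X₀, π z) ∂μ := by
  rw [(eventually_fderiv_integral hC hH hw hπ hπC v).fderiv_eq]
  exact (eventually_fderiv_integral hC (fun c hc => contDiffAt_partialDeriv (hH c hc) v)
    hw hπ hπC v).self_of_nhds

end ParametricIntegral

/-! ### The heat kernel and its smoothness across t = 0 -/

/-- `τ ^ (-m - 1/2) * exp (-1 / (4 τ))` for `τ > 0`, extended by zero. -/
noncomputable def flatKernel (m : ℕ) (τ : ℝ) : ℝ :=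
  if τ ≤ 0 then 0 else (τ⁻¹) ^ ((m : ℝ) + 1 / 2) * Real.exp (-(1 / 4) * τ⁻¹)

theorem flatKernel_of_nonpos (m : ℕ) {τ : ℝ} (h : τ ≤ 0) : flatKernel m τ = 0 := if_pos h

theorem flatKernel_of_pos (m : ℕ) {τ : ℝ} (h : 0 < τ) :
    flatKernel m τ = (τ⁻¹) ^ ((m : ℝ) + 1 / 2) * Real.exp (-(1 / 4) * τ⁻¹) :=
  if_neg (not_le.2 h)

/-- At τ = 0 this identity turns the difference quotient of `flatKernel m` into `flatKernel (m +
1)`, which tends to zero. -/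
theorem flatKernel_succ (m : ℕ) (τ : ℝ) : flatKernel m τ = τ * flatKernel (m + 1) τ := by
  rcases le_or_gt τ 0 with h | h
  · simp [flatKernel_of_nonpos _ h]
  · rw [flatKernel_of_pos _ h, flatKernel_of_pos _ h]
    have : ((m + 1 : ℕ) : ℝ) + 1 / 2 = ((m : ℝ) + 1 / 2) + 1 := by push_cast; ring
    rw [this, Real.rpow_add_one (inv_pos.2 h).ne']
    field_simp

theorem tendsto_flatKernel_zero (m : ℕ) : Tendsto (flatKernel m) (𝓝 0) (𝓝 0) := by
  have h1 : Tendsto (fun τ : ℝ => (τ⁻¹) ^ ((m : ℝ) + 1 / 2) * Real.exp (-(1 / 4) * τ⁻¹))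
      (𝓝[>] 0) (𝓝 0) :=
    (tendsto_rpow_mul_exp_neg_mul_atTop_nhds_zero ((m : ℝ) + 1 / 2) (1 / 4) (by norm_num)).comp
      tendsto_inv_nhdsGT_zero
  have h2 : Tendsto (flatKernel m) (𝓝[≤] 0) (𝓝 0) :=
    tendsto_const_nhds.congr' (by
      filter_upwards [self_mem_nhdsWithin] with τ hτ
      exact (flatKernel_of_nonpos m hτ).symm)
  have h3 : Tendsto (flatKernel m) (𝓝[>] 0) (𝓝 0) :=
    h1.congr' (by
      filter_upwards [self_mem_nhdsWithin] with τ hτ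
      exact (flatKernel_of_pos m hτ).symm)
  have := h2.sup h3
  rwa [← nhdsWithin_union, Iic_union_Ioi, nhdsWithin_univ] at this

/-- The family is closed under differentiation, also at τ = 0; smoothness of every member then
follows by induction on the order. -/
theorem hasDerivAt_flatKernel (m : ℕ) (τ : ℝ) :
    HasDerivAt (flatKernel m)
      (-((m : ℝ) + 1 / 2) * flatKernel (m + 1) τ + 1 / 4 * flatKernel (m + 2) τ) τ := by
  rcases lt_trichotomy τ 0 with h | rfl | h
  · rw [flatKernel_of_nonpos _ h.le, flatKernel_of_nonpos _ h.le, mul_zero, mul_zero, add_zero]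
    refine (hasDerivAt_const τ (0 : ℝ)).congr_of_eventuallyEq ?_
    filter_upwards [gt_mem_nhds h] with y hy
    exact flatKernel_of_nonpos m hy.le
  · rw [flatKernel_of_nonpos _ le_rfl, flatKernel_of_nonpos _ le_rfl, mul_zero, mul_zero, add_zero,
      hasDerivAt_iff_tendsto_slope]
    refine ((tendsto_flatKernel_zero (m + 1)).mono_left nhdsWithin_le_nhds).congr' ?_
    filter_upwards [self_mem_nhdsWithin] with y hy
    have hy0 : y ≠ 0 := hy
    rw [slope_def_field, flatKernel_of_nonpos _ (le_refl (0 : ℝ)), flatKernel_succ m y]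
    field_simp
    simp
  · have hd : HasDerivAt (fun τ : ℝ => (τ⁻¹) ^ ((m : ℝ) + 1 / 2) * Real.exp (-(1 / 4) * τ⁻¹))
        ((-(τ ^ 2)⁻¹ * ((m : ℝ) + 1 / 2) * (τ⁻¹) ^ ((m : ℝ) + 1 / 2 - 1)) *
          Real.exp (-(1 / 4) * τ⁻¹) + (τ⁻¹) ^ ((m : ℝ) + 1 / 2) *
          (Real.exp (-(1 / 4) * τ⁻¹) * (-(1 / 4) * (-(τ ^ 2)⁻¹)))) τ :=
      ((hasDerivAt_inv h.ne').rpow_const (Or.inl (inv_pos.2 h).ne')).mul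
        ((hasDerivAt_inv h.ne').const_mul _).exp
    have heq : flatKernel m =ᶠ[𝓝 τ]
        fun τ : ℝ => (τ⁻¹) ^ ((m : ℝ) + 1 / 2) * Real.exp (-(1 / 4) * τ⁻¹) := by
      filter_upwards [lt_mem_nhds h] with y hy
      exact flatKernel_of_pos m hy
    refine (hd.congr_of_eventuallyEq heq).congr_deriv ?_
    rw [flatKernel_of_pos _ h, flatKernel_of_pos _ h]
    have hi := (inv_pos.2 h).ne'
    have r0 : (τ⁻¹) ^ ((m : ℝ) + 1 / 2) = (τ⁻¹) ^ ((m : ℝ) + 1 / 2 - 1) * τ⁻¹ := by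
      rw [← Real.rpow_add_one hi]; congr 1; ring
    have r1 : (τ⁻¹) ^ (((m + 1 : ℕ) : ℝ) + 1 / 2) = (τ⁻¹) ^ ((m : ℝ) + 1 / 2) * τ⁻¹ := by
      rw [← Real.rpow_add_one hi]; congr 1; push_cast; ring
    have r2 : (τ⁻¹) ^ (((m + 2 : ℕ) : ℝ) + 1 / 2) = (τ⁻¹) ^ (((m + 1 : ℕ) : ℝ) + 1 / 2) * τ⁻¹ := by
      rw [← Real.rpow_add_one hi]; congr 1; push_cast; ring
    rw [r2, r1, r0]
    generalize (τ⁻¹) ^ ((m : ℝ) + 1 / 2 - 1) = A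
    field_simp

theorem contDiff_flatKernel (m : ℕ) : ContDiff ℝ ∞ (flatKernel m) := by
  rw [contDiff_infty]
  intro n
  induction n generalizing m with
  | zero =>
    rw [Nat.cast_zero, contDiff_zero, continuous_iff_continuousAt]
    exact fun τ => (hasDerivAt_flatKernel m τ).continuousAt
  | succ n ih =>
    rw [Nat.cast_succ, contDiff_succ_iff_deriv]
    refine ⟨fun τ => (hasDerivAt_flatKernel m τ).differentiableAt, by simp, ?_⟩
    have : deriv (flatKernel m) = fun τ =>
        -((m : ℝ) + 1 / 2) * flatKernel (m + 1) τ + 1 / 4 * flatKernel (m + 2) τ :=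
      funext fun τ => (hasDerivAt_flatKernel m τ).deriv
    rw [this]
    exact (contDiff_const.mul (ih (m + 1))).add (contDiff_const.mul (ih (m + 2)))

theorem heatKernel_of_nonpos (z : ℝ) {t : ℝ} (ht : t ≤ 0) : heatKernel z t = 0 := by
  have : 4 * Real.pi * t ≤ 0 := mul_nonpos_of_nonneg_of_nonpos (by positivity) ht
  rw [heatKernel, Real.sqrt_eq_zero_of_nonpos this]
  simp

theorem heatKernel_nonneg (z t : ℝ) : 0 ≤ heatKernel z t := by
  unfold heatKernel; positivity

theorem heatKernel_neg (z t : ℝ) : heatKernel (-z) t = heatKernel z t := by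
  simp [heatKernel]

theorem heatKernel_le (z : ℝ) {t : ℝ} (ht : 0 ≤ t) : heatKernel z t ≤ (Real.sqrt t)⁻¹ := by
  rcases ht.eq_or_lt with rfl | ht
  · simp [heatKernel_of_nonpos z le_rfl]
  unfold heatKernel
  have h1 : Real.exp (-z ^ 2 / (4 * t)) ≤ 1 := by
    rw [Real.exp_le_one_iff]
    exact div_nonpos_of_nonpos_of_nonneg (by nlinarith [sq_nonneg z]) (by positivity)
  have h2 : Real.sqrt t ≤ Real.sqrt (4 * Real.pi * t) := by
    apply Real.sqrt_le_sqrt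
    nlinarith [Real.pi_gt_three]
  have h3 : 0 < Real.sqrt t := Real.sqrt_pos.2 ht
  calc _ ≤ 1 / Real.sqrt (4 * Real.pi * t) * 1 := by gcongr
    _ ≤ (Real.sqrt t)⁻¹ := by rw [mul_one, one_div]; gcongr

/-- Parabolic scaling: off z = 0 the kernel is a function of t/z² alone up to a power of z, so
smoothness across t = 0 reduces to one variable. -/
theorem heatKernel_eq_flatKernel {z : ℝ} (hz : 0 < z) (t : ℝ) :
    heatKernel z t = (Real.sqrt (4 * Real.pi))⁻¹ * z⁻¹ * flatKernel 0 (t / z ^ 2) := by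
  rcases le_or_gt t 0 with h | h
  · rw [heatKernel_of_nonpos z h, flatKernel_of_nonpos, mul_zero]
    exact div_nonpos_of_nonpos_of_nonneg h (by positivity)
  · rw [flatKernel_of_pos _ (by positivity), heatKernel, Nat.cast_zero, zero_add,
      ← Real.sqrt_eq_rpow, inv_div, Real.sqrt_div (by positivity), Real.sqrt_sq hz.le,
      Real.sqrt_mul (by positivity) t]
    have h1 : -(1 / 4) * (z ^ 2 / t) = -z ^ 2 / (4 * t) := by field_simp
    rw [h1]
    field_simp

/-- The heat kernel is smooth away from the origin of space-time. -/
theorem contDiffAt_heatKernel {q : ℝ × ℝ} (h : q.1 ≠ 0 ∨ q.2 ≠ 0) :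
    ContDiffAt ℝ ∞ (fun q : ℝ × ℝ => heatKernel q.1 q.2) q := by
  -- Positive z is handled by scaling, negative z by evenness; at z = 0 one has t ≠ 0, and the
  -- kernel is either locally zero or given by its smooth formula.
  have hpos : ∀ q : ℝ × ℝ, 0 < q.1 →
      ContDiffAt ℝ ∞ (fun q : ℝ × ℝ => heatKernel q.1 q.2) q := by
    intro q hq
    have h1 : (fun q : ℝ × ℝ => heatKernel q.1 q.2) =ᶠ[𝓝 q] fun q =>
        (Real.sqrt (4 * Real.pi))⁻¹ * q.1⁻¹ * flatKernel 0 (q.2 / q.1 ^ 2) := by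
      filter_upwards [continuous_fst.continuousAt.eventually (lt_mem_nhds hq)] with r hr
      exact heatKernel_eq_flatKernel hr r.2
    refine ContDiffAt.congr_of_eventuallyEq ?_ h1
    refine (contDiffAt_const.mul (contDiffAt_fst.inv hq.ne')).mul ?_
    exact (contDiff_flatKernel 0).contDiffAt.comp q
      (contDiffAt_snd.div (contDiffAt_fst.pow 2) (pow_ne_zero 2 hq.ne'))
  rcases lt_trichotomy q.1 0 with h1 | h1 | h1
  · have h2 := hpos (-q.1, q.2) (by simpa using h1)
    have h3 : ContDiffAt ℝ ∞ (fun q : ℝ × ℝ => (-q.1, q.2)) q :=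
      contDiffAt_fst.neg.prodMk contDiffAt_snd
    have := h2.comp q h3
    refine this.congr_of_eventuallyEq (Eventually.of_forall fun r => ?_)
    exact (heatKernel_neg r.1 r.2).symm
  · replace h := h.resolve_left (not_not.2 h1)
    rcases lt_or_gt_of_ne h with h2 | h2
    · refine (contDiffAt_const (c := (0 : ℝ))).congr_of_eventuallyEq ?_
      filter_upwards [continuous_snd.continuousAt.eventually (gt_mem_nhds h2)] with r hr
      exact heatKernel_of_nonpos _ (le_of_lt hr)
    · unfold heatKernel
      have h4 : 4 * Real.pi * q.2 ≠ 0 := by positivity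
      have h5 : Real.sqrt (4 * Real.pi * q.2) ≠ 0 := (Real.sqrt_pos.2 (by positivity)).ne'
      exact (contDiffAt_const.div ((contDiffAt_const.mul contDiffAt_snd).sqrt h4) h5).mul
        ((contDiffAt_fst.pow 2).neg.div (contDiffAt_const.mul contDiffAt_snd) (by positivity)).exp
  · exact hpos q h1

theorem hasDerivAt_heatKernel_space (z : ℝ) {t : ℝ} (ht : 0 < t) :
    HasDerivAt (fun z => heatKernel z t) (-(z / (2 * t)) * heatKernel z t) z := by
  unfold heatKernel
  have := (((hasDerivAt_pow 2 z).neg.div_const (4 * t)).exp).const_mul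
    (1 / Real.sqrt (4 * Real.pi * t))
  refine this.congr_deriv ?_
  simp only [Pi.neg_apply]
  field_simp
  push_cast
  ring

theorem hasDerivAt_heatKernel_space_two (z : ℝ) {t : ℝ} (ht : 0 < t) :
    HasDerivAt (fun z => -(z / (2 * t)) * heatKernel z t)
      ((z ^ 2 / (4 * t ^ 2) - 1 / (2 * t)) * heatKernel z t) z := by
  have := ((hasDerivAt_id z).div_const (2 * t)).neg.mul (hasDerivAt_heatKernel_space z ht)
  refine this.congr_deriv ?_
  simp only [Pi.neg_apply, id]
  field_simp
  ring

theorem hasDerivAt_heatKernel_time (z : ℝ) {t : ℝ} (ht : 0 < t) :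
    HasDerivAt (fun t => heatKernel z t)
      ((z ^ 2 / (4 * t ^ 2) - 1 / (2 * t)) * heatKernel z t) t := by
  unfold heatKernel
  have h4 : 4 * Real.pi * t ≠ 0 := by positivity
  have h5 : Real.sqrt (4 * Real.pi * t) ≠ 0 := (Real.sqrt_pos.2 (by positivity)).ne'
  have h6 := Real.sq_sqrt (show 0 ≤ 4 * Real.pi * t by positivity)
  have hA := ((hasDerivAt_id t).const_mul (4 * Real.pi)).sqrt h4
  have hB := ((hasDerivAt_const t (-z ^ 2)).div ((hasDerivAt_id t).const_mul 4)
    (by simpa using ht.ne')).exp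
  have := ((hasDerivAt_const t (1 : ℝ)).div hA h5).mul hB
  refine this.congr_deriv ?_
  simp only [id, Pi.div_apply]
  set s := Real.sqrt (4 * Real.pi * t) with hs
  field_simp
  rw [h6]
  field_simp
  ring

/-! ### The heat operator: linearity, superposition, annihilation of the heat kernel -/

section HeatOperator

/-- The heat operator `∂ₜ - ∂ₓₓ`. -/
noncomputable def heatOp (g : ℝ × ℝ → ℝ) (q : ℝ × ℝ) : ℝ :=
  fderiv ℝ g q (0, 1) - fderiv ℝ (fun r => fderiv ℝ g r (1, 0)) q (1, 0)

theorem heatOp_congr {g h : ℝ × ℝ → ℝ} {q : ℝ × ℝ} (e : g =ᶠ[𝓝 q] h) :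
    heatOp g q = heatOp h q := by
  unfold heatOp
  have h2 : (fun r => fderiv ℝ g r (1, 0)) =ᶠ[𝓝 q] fun r => fderiv ℝ h r (1, 0) :=
    e.eventuallyEq_nhds.mono fun r hr => by simp only [hr.fderiv_eq]
  rw [e.fderiv_eq, h2.fderiv_eq]

theorem fderiv_fst_eq_deriv {g : ℝ × ℝ → ℝ} {q : ℝ × ℝ} (h : DifferentiableAt ℝ g q) :
    fderiv ℝ g q (1, 0) = deriv (fun y => g (y, q.2)) q.1 := by
  have h1 : HasDerivAt (fun y : ℝ => (y, q.2)) ((1 : ℝ), (0 : ℝ)) q.1 :=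
    (hasDerivAt_id q.1).prodMk (hasDerivAt_const _ _)
  exact ((h.hasFDerivAt (x := (q.1, q.2))).comp_hasDerivAt q.1 h1).deriv.symm

theorem fderiv_snd_eq_deriv {g : ℝ × ℝ → ℝ} {q : ℝ × ℝ} (h : DifferentiableAt ℝ g q) :
    fderiv ℝ g q (0, 1) = deriv (fun s => g (q.1, s)) q.2 := by
  have h1 : HasDerivAt (fun s : ℝ => (q.1, s)) ((0 : ℝ), (1 : ℝ)) q.2 :=
    (hasDerivAt_const _ _).prodMk (hasDerivAt_id q.2)
  exact ((h.hasFDerivAt (x := (q.1, q.2))).comp_hasDerivAt q.2 h1).deriv.symm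

theorem contDiffAt_fderiv_apply {g : ℝ × ℝ → ℝ} {q : ℝ × ℝ}
    (h : ContDiffAt ℝ ∞ g q) (v : ℝ × ℝ) : ContDiffAt ℝ ∞ (fun r => fderiv ℝ g r v) q :=
  (h.fderiv_right (m := ∞) (by simp)).clm_apply contDiffAt_const

theorem eventually_differentiableAt {E : Type*} [NormedAddCommGroup E] [NormedSpace ℝ E]
    {g : E → ℝ} {q : E} (h : ContDiffAt ℝ ∞ g q) :
    ∀ᶠ r in 𝓝 q, DifferentiableAt ℝ g r :=
  ((h.of_le (m := 1) (by simp)).eventually (by simp)).mono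
    fun _ hr => hr.differentiableAt (by simp)

theorem heatOp_eq_deriv {g : ℝ × ℝ → ℝ} {x t : ℝ} (h : ContDiffAt ℝ ∞ g (x, t)) :
    heatOp g (x, t) = deriv (fun s => g (x, s)) t - iteratedDeriv 2 (fun y => g (y, t)) x := by
  have h1 := h.differentiableAt (by simp)
  have h2 := (contDiffAt_fderiv_apply h (1, 0)).differentiableAt (by simp)
  have h3 := eventually_differentiableAt h
  have h4 : ∀ᶠ y in 𝓝 x, DifferentiableAt ℝ g (y, t) := by
    have : ContinuousAt (fun y : ℝ => (y, t)) x := by fun_prop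
    exact this.eventually h3
  rw [heatOp, fderiv_snd_eq_deriv h1, fderiv_fst_eq_deriv h2, iteratedDeriv_succ, iteratedDeriv_one]
  congr 1
  apply Filter.EventuallyEq.deriv_eq
  filter_upwards [h4] with y hy
  rw [fderiv_fst_eq_deriv hy]

theorem heatOp_add {g h : ℝ × ℝ → ℝ} {q : ℝ × ℝ} (hg : ContDiffAt ℝ ∞ g q)
    (hh : ContDiffAt ℝ ∞ h q) : heatOp (fun r => g r + h r) q = heatOp g q + heatOp h q := by
  unfold heatOp
  have e : (fun r => fderiv ℝ (fun r => g r + h r) r (1, 0)) =ᶠ[𝓝 q]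
      fun r => fderiv ℝ g r (1, 0) + fderiv ℝ h r (1, 0) := by
    filter_upwards [eventually_differentiableAt hg, eventually_differentiableAt hh] with r h1 h2
    rw [fderiv_fun_add h1 h2]; rfl
  rw [e.fderiv_eq, fderiv_fun_add (hg.differentiableAt (by simp)) (hh.differentiableAt (by simp)),
    fderiv_fun_add ((contDiffAt_fderiv_apply hg _).differentiableAt (by simp))
      ((contDiffAt_fderiv_apply hh _).differentiableAt (by simp))]
  simp only [add_apply]
  ring

theorem heatOp_const_mul {g : ℝ × ℝ → ℝ} {q : ℝ × ℝ} (hg : ContDiffAt ℝ ∞ g q) (c : ℝ) :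
    heatOp (fun r => c * g r) q = c * heatOp g q := by
  unfold heatOp
  have e : (fun r => fderiv ℝ (fun r => c * g r) r (1, 0)) =ᶠ[𝓝 q]
      fun r => c * fderiv ℝ g r (1, 0) := by
    filter_upwards [eventually_differentiableAt hg] with r h1
    rw [fderiv_const_mul h1]; rfl
  rw [e.fderiv_eq, fderiv_const_mul (hg.differentiableAt (by simp)),
    fderiv_const_mul ((contDiffAt_fderiv_apply hg _).differentiableAt (by simp))]
  simp only [smul_apply, smul_eq_mul]
  ring

theorem heatOp_sub {g h : ℝ × ℝ → ℝ} {q : ℝ × ℝ} (hg : ContDiffAt ℝ ∞ g q)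
    (hh : ContDiffAt ℝ ∞ h q) : heatOp (fun r => g r - h r) q = heatOp g q - heatOp h q := by
  have := heatOp_add hg (contDiffAt_const.mul hh : ContDiffAt ℝ ∞ (fun r => (-1) * h r) q)
  rw [heatOp_const_mul hh] at this
  rw [sub_eq_add_neg, ← neg_one_mul, ← this]
  congr 1
  ext r
  ring

theorem fderiv_slice_apply {P : Type} [NormedAddCommGroup P] [NormedSpace ℝ P]
    {H : (ℝ × ℝ) × P → ℝ} {x : ℝ × ℝ} {c : P} (h : DifferentiableAt ℝ H (x, c)) (v : ℝ × ℝ) :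
    partialDeriv H v (x, c) = fderiv ℝ (fun r => H (r, c)) x v := by
  have h2 : HasFDerivAt (fun x : ℝ × ℝ => (x, c)) (ContinuousLinearMap.inl ℝ (ℝ × ℝ) P) x :=
    hasFDerivAt_prodMk_left x c
  have := (h.hasFDerivAt.comp x h2).fderiv
  change _ = fderiv ℝ (H ∘ fun x => (x, c)) x v
  rw [this]
  simp [partialDeriv]

theorem heatOp_slice {P : Type} [NormedAddCommGroup P] [NormedSpace ℝ P]
    {H : (ℝ × ℝ) × P → ℝ} {x : ℝ × ℝ} {c : P} (h : ContDiffAt ℝ ∞ H (x, c)) :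
    heatOp (fun r => H (r, c)) x =
      partialDeriv H (0, 1) (x, c) - partialDeriv (partialDeriv H (1, 0)) (1, 0) (x, c) := by
  have h1 := contDiffAt_partialDeriv h (1, 0)
  have h3 : ∀ᶠ r in 𝓝 x, DifferentiableAt ℝ H (r, c) := by
    have : ContinuousAt (fun r : ℝ × ℝ => (r, c)) x := by fun_prop
    exact this.eventually (eventually_differentiableAt h)
  rw [fderiv_slice_apply (h.differentiableAt (by simp)),
    fderiv_slice_apply (h1.differentiableAt (by simp)), heatOp]
  congr 2
  apply Filter.EventuallyEq.fderiv_eq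
  filter_upwards [h3] with r hr
  rw [fderiv_slice_apply hr]

/-- The superposition principle. It serves both the sum over images, as an integral for counting
measure, and the integrals over initial data and moving sources. -/
theorem heatOp_integral {Z P : Type} [MeasurableSpace Z] {μ : Measure Z}
    [NormedAddCommGroup P] [NormedSpace ℝ P] [MeasurableSpace P] [BorelSpace P]
    [SecondCountableTopology P] {H : (ℝ × ℝ) × P → ℝ} {X₀ : ℝ × ℝ} {C : Set P} (hC : IsCompact C)
    (hH : ∀ c ∈ C, ContDiffAt ℝ ∞ H (X₀, c)) {w : Z → ℝ} (hw : Integrable w μ)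
    {π : Z → P} (hπ : Measurable π) (hπC : ∀ z, π z ∈ C) :
    heatOp (fun x => ∫ z, w z • H (x, π z) ∂μ) X₀ =
      ∫ z, w z • heatOp (fun r => H (r, π z)) X₀ ∂μ := by
  have e1 := (eventually_fderiv_integral hC hH hw hπ hπC (0, 1)).self_of_nhds
  have e2 := fderiv_fderiv_integral hC hH hw hπ hπC (1, 0)
  have i1 := (eventually_hasFDerivAt_integral (H := partialDeriv H (0, 1)) hC
    (fun c hc => (contDiffAt_partialDeriv (hH c hc) _).of_le (by simp)) hw hπ hπC).self_of_nhds.1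
  have i2 := (eventually_hasFDerivAt_integral (H := partialDeriv (partialDeriv H (1, 0)) (1, 0)) hC
    (fun c hc => (contDiffAt_partialDeriv (contDiffAt_partialDeriv (hH c hc) _) _).of_le
      (by simp)) hw hπ hπC).self_of_nhds.1
  simp only at e1
  rw [heatOp, e1, e2, ← integral_sub i1 i2]
  refine integral_congr_ae (ae_of_all _ fun z => ?_)
  simp only
  rw [heatOp_slice (hH _ (hπC z)), smul_sub]

theorem heatOp_heatKernel (c s : ℝ) {q : ℝ × ℝ} (h : q.2 ≠ s) :
    heatOp (fun r => heatKernel (r.1 - c) (r.2 - s)) q = 0 := by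
  rcases lt_or_gt_of_ne h with h1 | h1
  · have e : (fun r : ℝ × ℝ => heatKernel (r.1 - c) (r.2 - s)) =ᶠ[𝓝 q] fun _ => (0 : ℝ) := by
      filter_upwards [continuous_snd.continuousAt.eventually (gt_mem_nhds h1)] with r hr
      exact heatKernel_of_nonpos _ (sub_nonpos.2 (le_of_lt hr))
    rw [heatOp_congr e]
    simp [heatOp]
  · have hs : ContDiffAt ℝ ∞ (fun r : ℝ × ℝ => (r.1 - c, r.2 - s)) q :=
      (contDiffAt_fst.sub contDiffAt_const).prodMk (contDiffAt_snd.sub contDiffAt_const)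
    have hc : ContDiffAt ℝ ∞ (fun r : ℝ × ℝ => heatKernel (r.1 - c) (r.2 - s)) (q.1, q.2) :=
      ContDiffAt.comp (f := fun r : ℝ × ℝ => (r.1 - c, r.2 - s)) q
        (contDiffAt_heatKernel (q := (q.1 - c, q.2 - s)) (Or.inr (sub_ne_zero.2 h))) hs
    have h0 : 0 < q.2 - s := sub_pos.2 h1
    rw [show q = (q.1, q.2) from rfl, heatOp_eq_deriv hc]
    simp only
    rw [iteratedDeriv_succ, iteratedDeriv_one,
      ((hasDerivAt_heatKernel_time (q.1 - c) h0).comp_sub_const q.2 s).deriv]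
    have e1 : deriv (fun y => heatKernel (y - c) (q.2 - s)) =
        fun y => -((y - c) / (2 * (q.2 - s))) * heatKernel (y - c) (q.2 - s) :=
      funext fun y => ((hasDerivAt_heatKernel_space (y - c) h0).comp_sub_const y c).deriv
    rw [e1, ((hasDerivAt_heatKernel_space_two (q.1 - c) h0).comp_sub_const q.1 c).deriv, sub_self]

end HeatOperator

/-! ### The Neumann kernel as a sum over images -/

section NeumannKernel

/-- The rescaled image term `h⁻³ K(2 / h + c, t)`, smooth up to `h = 0`. -/
noncomputable def imageTerm (c t h : ℝ) : ℝ :=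
  (Real.sqrt (4 * Real.pi))⁻¹ * (2 + h * c)⁻¹ ^ 3 * t * flatKernel 1 (t * h ^ 2 / (2 + h * c) ^ 2)

/-- Extracting one factor t/z² by `flatKernel_succ` improves the prefactor 1/n to n⁻³, which is
summable over the images. What remains is smooth in h = 1/n down to h = 0, so all distant images are
values of one smooth function on a compact parameter set. -/
theorem heatKernel_eq_imageTerm {c t n : ℝ} (hn : 0 < n) (hc : 0 < 2 + n⁻¹ * c) :
    heatKernel (2 * n + c) t = (n⁻¹) ^ 3 * imageTerm c t n⁻¹ := by
  have h1 : 2 * n + c = n * (2 + n⁻¹ * c) := by field_simp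
  have h2 : t / (n * (2 + n⁻¹ * c)) ^ 2 = t * n⁻¹ ^ 2 / (2 + n⁻¹ * c) ^ 2 := by
    field_simp
  rw [h1, heatKernel_eq_flatKernel (mul_pos hn hc), flatKernel_succ, h2, imageTerm]
  have := hc.ne'
  field_simp

theorem contDiffAt_imageTerm {q : ℝ × ℝ × ℝ} (h : 2 + q.2.2 * q.1 ≠ 0) :
    ContDiffAt ℝ ∞ (fun q : ℝ × ℝ × ℝ => imageTerm q.1 q.2.1 q.2.2) q := by
  unfold imageTerm
  have hd : ContDiffAt ℝ ∞ (fun q : ℝ × ℝ × ℝ => 2 + q.2.2 * q.1) q := by fun_prop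
  have hE := (contDiff_flatKernel 1).contDiffAt (x := q.2.1 * q.2.2 ^ 2 / (2 + q.2.2 * q.1) ^ 2)
  refine ((contDiffAt_const.mul ((hd.inv h).pow 3)).mul (by fun_prop)).mul ?_
  refine ContDiffAt.comp (f := fun q : ℝ × ℝ × ℝ => q.2.1 * q.2.2 ^ 2 / (2 + q.2.2 * q.1) ^ 2) q
    hE ?_
  exact ContDiffAt.div (by fun_prop) (hd.pow 2) (pow_ne_zero 2 h)

/-- Sign, parity and inverse size of the index of an image. -/
noncomputable def imageParam (k : ℤ) : ℝ × ℝ × ℝ :=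
  if 2 ≤ k.natAbs then (if 0 ≤ k then 1 else -1, (-1) ^ k.natAbs, (k.natAbs : ℝ)⁻¹) else 0

noncomputable def imageWeight (k : ℤ) : ℝ :=
  if 2 ≤ k.natAbs then ((k.natAbs : ℝ)⁻¹) ^ 3 else 0

/-- The part of the Neumann kernel due to the images `k` with `|k| ≥ 2`. -/
noncomputable def tailKernel (x y t : ℝ) : ℝ :=
  ∑' k : ℤ, if 2 ≤ k.natAbs then heatKernel (x - (2 * (k : ℝ) + (-1) ^ k.natAbs * y)) t else 0

theorem neg_one_pow_natAbs (k : ℤ) :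
    ((-1 : ℝ)) ^ k.natAbs = 1 ∨ ((-1 : ℝ)) ^ k.natAbs = -1 := neg_one_pow_eq_or ℝ _

/-- Contains the parameters of all images; the bound 1/2 on the inverse index reflects |k| ≥ 2. -/
def imageBox : Set (ℝ × ℝ × ℝ) := Icc (-1) 1 ×ˢ Icc (-1) 1 ×ˢ Icc 0 (1 / 2)

theorem isCompact_imageBox : IsCompact imageBox :=
  isCompact_Icc.prod (isCompact_Icc.prod isCompact_Icc)

theorem imageParam_mem (k : ℤ) : imageParam k ∈ imageBox := by
  unfold imageParam imageBox
  split_ifs with h1 h2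
  · refine ⟨by norm_num, ?_, by positivity, ?_⟩
    · rcases neg_one_pow_natAbs k with h | h <;> simp [h]
    · have : (2 : ℝ) ≤ k.natAbs := by exact_mod_cast h1
      rw [one_div]
      exact inv_anti₀ (by norm_num) this
  · refine ⟨by norm_num, ?_, by positivity, ?_⟩
    · rcases neg_one_pow_natAbs k with h | h <;> simp [h]
    · have : (2 : ℝ) ≤ k.natAbs := by exact_mod_cast h1
      rw [one_div]
      exact inv_anti₀ (by norm_num) this
  · exact ⟨by norm_num, by norm_num, by norm_num⟩

/-- Here |c| ≤ 3 and h ≤ 1/2, so 2 + hc ≥ 1/2. Allowing |x|, |y| up to 3/2 leaves an open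
neighbourhood of [-1,1], so that two-sided derivatives exist at the end points. -/
theorem imageBox_pos {x y : ℝ} (hx : |x| < 3 / 2) (hy : |y| < 3 / 2) {p : ℝ × ℝ × ℝ}
    (hp : p ∈ imageBox) : 0 < 2 + p.2.2 * (p.1 * (p.2.1 * y - x)) := by
  obtain ⟨⟨h1, h2⟩, ⟨h3, h4⟩, h5, h6⟩ := hp
  have a1 : |p.1| ≤ 1 := abs_le.2 ⟨h1, h2⟩
  have a2 : |p.2.1| ≤ 1 := abs_le.2 ⟨h3, h4⟩
  have a3 : |p.2.1 * y - x| ≤ 3 := by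
    refine (abs_sub _ _).trans ?_
    rw [abs_mul]
    nlinarith [abs_nonneg y, abs_nonneg p.2.1]
  have a4 : |p.1 * (p.2.1 * y - x)| ≤ 3 := by
    rw [abs_mul]
    nlinarith [abs_nonneg (p.2.1 * y - x), abs_nonneg p.1]
  nlinarith [(abs_le.1 a4).1]

theorem imageWeight_smul {x y : ℝ} (hx : |x| < 3 / 2) (hy : |y| < 3 / 2) (t : ℝ) (k : ℤ) :
    (if 2 ≤ k.natAbs then heatKernel (x - (2 * (k : ℝ) + (-1) ^ k.natAbs * y)) t else 0) =
      imageWeight k • imageTerm ((imageParam k).1 * ((imageParam k).2.1 * y - x)) t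
        (imageParam k).2.2 := by
  have hpos := imageBox_pos hx hy (imageParam_mem k)
  unfold imageWeight
  split_ifs with h1
  · have hn : (0 : ℝ) < k.natAbs := by
      have : 0 < k.natAbs := by omega
      exact_mod_cast this
    have hp : imageParam k = (if 0 ≤ k then 1 else -1, (-1) ^ k.natAbs, (k.natAbs : ℝ)⁻¹) :=
      if_pos h1
    rw [hp] at hpos ⊢
    simp only at hpos ⊢
    rw [smul_eq_mul, ← heatKernel_eq_imageTerm hn hpos]
    have hk : ((k.natAbs : ℕ) : ℝ) = |(k : ℝ)| := by
      rw [Nat.cast_natAbs]; push_cast; rfl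
    split_ifs with h2
    · have : (0 : ℝ) ≤ k := by exact_mod_cast h2
      rw [← heatKernel_neg, hk, abs_of_nonneg this]
      congr 1; ring
    · have : (k : ℝ) < 0 := by exact_mod_cast not_le.1 h2
      rw [hk, abs_of_neg this]
      congr 1; ring
  · rw [zero_smul]

theorem integrable_imageWeight : Integrable imageWeight Measure.count := by
  refine ⟨Measurable.aestronglyMeasurable (measurable_of_countable _), ?_⟩
  rw [hasFiniteIntegral_count_iff]
  have h1 : Summable fun k : ℤ => |(k : ℝ) ^ 3|⁻¹ := by
    have := Real.summable_one_div_int_pow (p := 3) |>.2 (by norm_num)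
    simpa using this.norm
  refine Summable.of_nonneg_of_le (fun _ => norm_nonneg _) (fun k => ?_) h1
  unfold imageWeight
  split_ifs with h
  · rw [Nat.cast_natAbs, Real.norm_eq_abs]
    simp [abs_pow]
  · simp

/-- The rescaled image terms as a function on the product of the space of `(x,y,t)` and the space
of image parameters. -/
noncomputable def imageFun (q : (ℝ × ℝ × ℝ) × (ℝ × ℝ × ℝ)) : ℝ :=
  imageTerm (q.2.1 * (q.2.2.1 * q.1.2.1 - q.1.1)) q.1.2.2 q.2.2.2

theorem contDiffAt_imageFun {X p : ℝ × ℝ × ℝ} (hx : |X.1| < 3 / 2) (hy : |X.2.1| < 3 / 2)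
    (hp : p ∈ imageBox) : ContDiffAt ℝ ∞ imageFun (X, p) := by
  have h := imageBox_pos hx hy hp
  unfold imageFun
  exact ContDiffAt.comp (f := fun q : (ℝ × ℝ × ℝ) × (ℝ × ℝ × ℝ) =>
    (q.2.1 * (q.2.2.1 * q.1.2.1 - q.1.1), q.1.2.2, q.2.2.2)) (X, p)
    (contDiffAt_imageTerm (q := (p.1 * (p.2.1 * X.2.1 - X.1), X.2.2, p.2.2)) h.ne')
    (by fun_prop)

theorem summable_tail {x y : ℝ} (hx : |x| < 3 / 2) (hy : |y| < 3 / 2) (t : ℝ) :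
    Summable fun k : ℤ =>
      if 2 ≤ k.natAbs then heatKernel (x - (2 * (k : ℝ) + (-1) ^ k.natAbs * y)) t else 0 := by
  have := (eventually_hasFDerivAt_integral (X₀ := (x, y, t)) (H := imageFun) isCompact_imageBox
    (fun c hc => (contDiffAt_imageFun hx hy hc).of_le (by simp)) integrable_imageWeight
    (measurable_of_countable imageParam) imageParam_mem).self_of_nhds.1.2
  rw [hasFiniteIntegral_count_iff] at this
  refine Summable.of_norm (this.congr fun k => ?_)
  rw [imageWeight_smul hx hy]
  rfl

theorem tailKernel_eq_integral {x y : ℝ} (hx : |x| < 3 / 2) (hy : |y| < 3 / 2) (t : ℝ) :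
    tailKernel x y t = ∫ k, imageWeight k • imageFun ((x, y, t), imageParam k) ∂Measure.count := by
  have := (eventually_hasFDerivAt_integral (X₀ := (x, y, t)) (H := imageFun) isCompact_imageBox
    (fun c hc => (contDiffAt_imageFun hx hy hc).of_le (by simp)) integrable_imageWeight
    (measurable_of_countable imageParam) imageParam_mem).self_of_nhds.1
  rw [integral_countable this]
  unfold tailKernel
  congr 1
  ext k
  rw [imageWeight_smul hx hy]
  simp [imageFun, Measure.real]

theorem contDiffAt_tailKernel {X : ℝ × ℝ × ℝ} (hx : |X.1| < 3 / 2) (hy : |X.2.1| < 3 / 2) :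
    ContDiffAt ℝ ∞ (fun X : ℝ × ℝ × ℝ => tailKernel X.1 X.2.1 X.2.2) X := by
  have h := contDiffAt_integral (X₀ := X) (H := imageFun) isCompact_imageBox
    (fun c hc => contDiffAt_imageFun hx hy hc) integrable_imageWeight
    (measurable_of_countable imageParam) imageParam_mem
  refine h.congr_of_eventuallyEq ?_
  have c1 : ContinuousAt (fun X : ℝ × ℝ × ℝ => |X.1|) X := by fun_prop
  have c2 : ContinuousAt (fun X : ℝ × ℝ × ℝ => |X.2.1|) X := by fun_prop
  filter_upwards [c1.eventually (gt_mem_nhds hx), c2.eventually (gt_mem_nhds hy)] with Y h1 h2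
  exact tailKernel_eq_integral h1 h2 _

theorem heatOp_tailKernel {x y t s : ℝ} (hx : |x| < 3 / 2) (hy : |y| < 3 / 2) (ht : t ≠ s) :
    heatOp (fun r => tailKernel r.1 y (r.2 - s)) (x, t) = 0 := by
  let H : (ℝ × ℝ) × (ℝ × ℝ × ℝ) → ℝ := fun q => imageFun ((q.1.1, y, q.1.2 - s), q.2)
  have hH : ∀ x' : ℝ × ℝ, |x'.1| < 3 / 2 → ∀ c ∈ imageBox, ContDiffAt ℝ ∞ H (x', c) := by
    intro x' hx' c hc
    exact ContDiffAt.comp (f := fun q : (ℝ × ℝ) × (ℝ × ℝ × ℝ) => ((q.1.1, y, q.1.2 - s), q.2))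
      (x', c) (contDiffAt_imageFun (X := (x'.1, y, x'.2 - s)) hx' hy hc) (by fun_prop)
  have c1 : ContinuousAt (fun X : ℝ × ℝ => |X.1|) (x, t) := by fun_prop
  have ev := c1.eventually (gt_mem_nhds hx)
  have e : (fun r : ℝ × ℝ => tailKernel r.1 y (r.2 - s)) =ᶠ[𝓝 (x, t)]
      fun r => ∫ k, imageWeight k • H (r, imageParam k) ∂Measure.count := by
    filter_upwards [ev] with Y h1
    exact tailKernel_eq_integral h1 hy _
  rw [heatOp_congr e, heatOp_integral isCompact_imageBox (hH (x, t) hx) integrable_imageWeight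
    (measurable_of_countable imageParam) imageParam_mem]
  have : ∀ k : ℤ, imageWeight k • heatOp (fun r => H (r, imageParam k)) (x, t) = 0 := by
    intro k
    have hs : ContDiffAt ℝ ∞ (fun r => H (r, imageParam k)) (x, t) :=
      ContDiffAt.comp (f := fun r : ℝ × ℝ => (r, imageParam k)) (x, t)
        (hH (x, t) hx _ (imageParam_mem k)) (by fun_prop)
    rw [smul_eq_mul, ← heatOp_const_mul hs]
    have e2 : (fun r : ℝ × ℝ => imageWeight k * H (r, imageParam k)) =ᶠ[𝓝 (x, t)]
        fun r => if 2 ≤ k.natAbs then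
          heatKernel (r.1 - (2 * (k : ℝ) + (-1) ^ k.natAbs * y)) (r.2 - s) else 0 := by
      filter_upwards [ev] with Y h1
      exact (imageWeight_smul h1 hy (Y.2 - s) k).symm
    rw [heatOp_congr e2]
    split_ifs
    · exact heatOp_heatKernel _ _ ht
    · simp [heatOp]
  simp only [this, integral_zero]

/-- Only the images k = 0, 1, -1 can be singular for x, y in [-1,1]; the others form the smooth
tail. -/
theorem neumannKernel_eq {x y : ℝ} (hx : |x| < 3 / 2) (hy : |y| < 3 / 2) (t : ℝ) :
    neumannKernel x y t = heatKernel (x - y) t + heatKernel (x - (2 - y)) t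
      + heatKernel (x - (-2 - y)) t + tailKernel x y t := by
  have h1 := summable_tail hx hy t
  set f : ℤ → ℝ := fun k => heatKernel (x - (2 * (k : ℝ) + (-1) ^ k.natAbs * y)) t with hf
  set g : ℤ → ℝ := fun k => if 2 ≤ k.natAbs then f k else 0 with hg
  set h : ℤ → ℝ := fun k => if 2 ≤ k.natAbs then 0 else f k with hh
  have hz : ∀ k ∉ ({0, 1, -1} : Finset ℤ), h k = 0 := by
    intro k hk
    simp only [Finset.mem_insert, Finset.mem_singleton, not_or] at hk
    rw [hh]
    simp only
    rw [if_pos (by omega)]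
  have h2 : Summable h := summable_of_ne_finset_zero hz
  have h3 : f = fun k => h k + g k := by
    ext k
    simp only [hg, hh]
    split_ifs <;> simp
  have h4 : neumannKernel x y t = ∑' k, f k := rfl
  rw [h4, h3, h2.tsum_add h1, tsum_eq_sum hz]
  have h5 : ∑' k, g k = tailKernel x y t := rfl
  rw [h5, Finset.sum_insert (by simp), Finset.sum_insert (by norm_num), Finset.sum_singleton]
  have g0 : h 0 = heatKernel (x - y) t := by simp [hh, hf]
  have g1 : h 1 = heatKernel (x - (2 - y)) t := by simp [hh, hf, sub_eq_add_neg]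
  have g2 : h (-1) = heatKernel (x - (-2 - y)) t := by simp [hh, hf, sub_eq_add_neg]
  rw [g0, g1, g2]
  ring

theorem neumannKernel_of_nonpos (x y : ℝ) {t : ℝ} (ht : t ≤ 0) : neumannKernel x y t = 0 := by
  simp [neumannKernel, heatKernel_of_nonpos _ ht]

theorem tailKernel_of_nonpos (x y : ℝ) {t : ℝ} (ht : t ≤ 0) : tailKernel x y t = 0 := by
  simp [tailKernel, heatKernel_of_nonpos _ ht]

theorem neumannKernel_nonneg (x y t : ℝ) : 0 ≤ neumannKernel x y t :=
  tsum_nonneg fun _ => heatKernel_nonneg _ _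

theorem neg_one_pow_natAbs_sub (k m : ℤ) (hm : m.natAbs % 2 = 1) :
    ((-1 : ℝ)) ^ (m - k).natAbs = -(-1) ^ k.natAbs := by
  rcases Nat.even_or_odd k.natAbs with h | h
  · have : Odd (m - k).natAbs := by rw [Nat.odd_iff]; rw [Nat.even_iff] at h; omega
    rw [h.neg_one_pow, this.neg_one_pow]
  · have : Even (m - k).natAbs := by rw [Nat.even_iff]; rw [Nat.odd_iff] at h; omega
    rw [h.neg_one_pow, this.neg_one_pow, neg_neg]

/-- Reindexing k ↦ m - k with m odd flips the parity of k, hence the sign of y, which compensates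
the reflection of x. The cases m = ±1 are the reflections about the end points and yield the Neumann
conditions. -/
theorem neumannKernel_reflect (x y t : ℝ) (m : ℤ) (hm : m.natAbs % 2 = 1) :
    neumannKernel (2 * m - x) y t = neumannKernel x y t := by
  unfold neumannKernel
  rw [← (Equiv.subLeft m).tsum_eq]
  refine tsum_congr fun k => ?_
  rw [Equiv.subLeft_apply, neg_one_pow_natAbs_sub k m hm, ← heatKernel_neg]
  congr 1
  push_cast
  ring

theorem neumannKernel_reflect_right (x y t : ℝ) :
    neumannKernel (2 - x) y t = neumannKernel x y t := by
  have := neumannKernel_reflect x y t 1 (by simp)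
  simpa using this

theorem neumannKernel_reflect_left (x y t : ℝ) :
    neumannKernel (-2 - x) y t = neumannKernel x y t := by
  have := neumannKernel_reflect x y t (-1) (by simp)
  simpa using this

theorem neumannKernel_neg_neg (x y t : ℝ) : neumannKernel (-x) (-y) t = neumannKernel x y t := by
  unfold neumannKernel
  rw [← (Equiv.neg ℤ).tsum_eq]
  refine tsum_congr fun k => ?_
  rw [Equiv.neg_apply, Int.natAbs_neg, ← heatKernel_neg]
  congr 1
  push_cast
  ring

/-- `Γ` minus its leading term `K(x - y, t)`. -/
noncomputable def remainderKernel (x y t : ℝ) : ℝ :=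
  heatKernel (x - (2 - y)) t + heatKernel (x - (-2 - y)) t + tailKernel x y t

theorem contDiffAt_heatKernel_comp {E : Type*} [NormedAddCommGroup E] [NormedSpace ℝ E]
    {g h : E → ℝ} {q : E} (hg : ContDiffAt ℝ ∞ g q) (hh : ContDiffAt ℝ ∞ h q)
    (H : g q ≠ 0 ∨ h q ≠ 0) : ContDiffAt ℝ ∞ (fun q => heatKernel (g q) (h q)) q :=
  ContDiffAt.comp (f := fun q => (g q, h q)) q (contDiffAt_heatKernel (q := (g q, h q)) H)
    (hg.prodMk hh)

theorem contDiffAt_remainderKernel {X : ℝ × ℝ × ℝ} (hx : |X.1| < 3 / 2) (hy : |X.2.1| < 3 / 2)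
    (h1 : X.1 - (2 - X.2.1) ≠ 0 ∨ X.2.2 ≠ 0) (h2 : X.1 - (-2 - X.2.1) ≠ 0 ∨ X.2.2 ≠ 0) :
    ContDiffAt ℝ ∞ (fun X : ℝ × ℝ × ℝ => remainderKernel X.1 X.2.1 X.2.2) X := by
  unfold remainderKernel
  refine (ContDiffAt.add ?_ ?_).add (contDiffAt_tailKernel hx hy)
  · exact contDiffAt_heatKernel_comp (by fun_prop) (by fun_prop) h1
  · exact contDiffAt_heatKernel_comp (by fun_prop) (by fun_prop) h2

/-- The Neumann kernel is smooth away from `t = 0` and, at `t = 0`, away from `y` and its two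
nearest images. -/
theorem contDiffAt_neumannKernel {X : ℝ × ℝ × ℝ} (hx : |X.1| < 3 / 2) (hy : |X.2.1| < 3 / 2)
    (h : (X.1 - X.2.1 ≠ 0 ∧ X.1 - (2 - X.2.1) ≠ 0 ∧ X.1 - (-2 - X.2.1) ≠ 0) ∨ X.2.2 ≠ 0) :
    ContDiffAt ℝ ∞ (fun X : ℝ × ℝ × ℝ => neumannKernel X.1 X.2.1 X.2.2) X := by
  have e : (fun X : ℝ × ℝ × ℝ => neumannKernel X.1 X.2.1 X.2.2) =ᶠ[𝓝 X]
      fun X => heatKernel (X.1 - X.2.1) X.2.2 + remainderKernel X.1 X.2.1 X.2.2 := by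
    have c1 : ContinuousAt (fun X : ℝ × ℝ × ℝ => |X.1|) X := by fun_prop
    have c2 : ContinuousAt (fun X : ℝ × ℝ × ℝ => |X.2.1|) X := by fun_prop
    filter_upwards [c1.eventually (gt_mem_nhds hx), c2.eventually (gt_mem_nhds hy)] with Y h1 h2
    rw [neumannKernel_eq h1 h2, remainderKernel]
    ring
  refine ContDiffAt.congr_of_eventuallyEq ?_ e
  refine ContDiffAt.add ?_ (contDiffAt_remainderKernel hx hy (h.imp_left fun h => h.2.1)
    (h.imp_left fun h => h.2.2))
  exact contDiffAt_heatKernel_comp (by fun_prop) (by fun_prop) (h.imp_left fun h => h.1)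

theorem heatOp_neumannKernel {x y t s : ℝ} (hx : |x| < 3 / 2) (hy : |y| < 3 / 2) (ht : t ≠ s) :
    heatOp (fun r => neumannKernel r.1 y (r.2 - s)) (x, t) = 0 := by
  have e : (fun r : ℝ × ℝ => neumannKernel r.1 y (r.2 - s)) =ᶠ[𝓝 (x, t)]
      fun r => (heatKernel (r.1 - y) (r.2 - s) + heatKernel (r.1 - (2 - y)) (r.2 - s))
        + heatKernel (r.1 - (-2 - y)) (r.2 - s) + tailKernel r.1 y (r.2 - s) := by
    have c1 : ContinuousAt (fun X : ℝ × ℝ => |X.1|) (x, t) := by fun_prop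
    filter_upwards [c1.eventually (gt_mem_nhds hx)] with Y h1
    exact neumannKernel_eq h1 hy _
  have hts : t - s ≠ 0 := sub_ne_zero.2 ht
  have hK : ∀ c, ContDiffAt ℝ ∞ (fun r : ℝ × ℝ => heatKernel (r.1 - c) (r.2 - s)) (x, t) :=
    fun c => contDiffAt_heatKernel_comp (by fun_prop) (by fun_prop) (Or.inr hts)
  have hT : ContDiffAt ℝ ∞ (fun r : ℝ × ℝ => tailKernel r.1 y (r.2 - s)) (x, t) :=
    ContDiffAt.comp (f := fun r : ℝ × ℝ => (r.1, y, r.2 - s)) (x, t)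
      (contDiffAt_tailKernel (X := (x, y, t - s)) hx hy) (by fun_prop)
  rw [heatOp_congr e, heatOp_add (((hK _).add (hK _)).add (hK _)) hT,
    heatOp_add ((hK _).add (hK _)) (hK _), heatOp_add (hK _) (hK _),
    heatOp_heatKernel (q := (x, t)) _ _ ht, heatOp_heatKernel (q := (x, t)) _ _ ht,
    heatOp_heatKernel (q := (x, t)) _ _ ht, heatOp_tailKernel hx hy ht]
  simp

/-- Each of the three nearest images contributes at most t^(-1/2), and the tail is bounded on the
compact set, where 1 ≤ t^(-1/2). -/
theorem exists_neumannKernel_le : ∃ C : ℝ, 0 < C ∧ ∀ x ∈ Icc (-1 : ℝ) 1, ∀ y ∈ Icc (-1 : ℝ) 1,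
    ∀ t ∈ Ioc (0 : ℝ) 1, neumannKernel x y t ≤ C * (Real.sqrt t)⁻¹ := by
  have hK : IsCompact (Icc (-1 : ℝ) 1 ×ˢ Icc (-1 : ℝ) 1 ×ˢ Icc (0 : ℝ) 1) :=
    isCompact_Icc.prod (isCompact_Icc.prod isCompact_Icc)
  have habs : ∀ z ∈ Icc (-1 : ℝ) 1, |z| < 3 / 2 := fun z hz => by
    rw [abs_lt]; constructor <;> linarith [hz.1, hz.2]
  obtain ⟨B, hB⟩ := hK.exists_bound_of_continuousOn
    (f := fun X : ℝ × ℝ × ℝ => tailKernel X.1 X.2.1 X.2.2) (fun X hX =>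
      (contDiffAt_tailKernel (habs _ hX.1) (habs _ hX.2.1)).continuousAt.continuousWithinAt)
  refine ⟨3 + |B|, by positivity, fun x hx y hy t ht => ?_⟩
  rw [neumannKernel_eq (habs x hx) (habs y hy)]
  have h1 := heatKernel_le (x - y) ht.1.le
  have h2 := heatKernel_le (x - (2 - y)) ht.1.le
  have h3 := heatKernel_le (x - (-2 - y)) ht.1.le
  have h4 : tailKernel x y t ≤ |B| :=
    (le_abs_self _).trans ((hB (x, y, t) ⟨hx, hy, ht.1.le, ht.2⟩).trans (le_abs_self B))
  have h5 : 1 ≤ (Real.sqrt t)⁻¹ := by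
    rw [one_le_inv₀ (Real.sqrt_pos.2 ht.1)]
    exact Real.sqrt_le_one.2 ht.2
  nlinarith [abs_nonneg B]

end NeumannKernel

/-! ### Splitting off the singular part of the kernel near the free boundary -/

section RegularKernel

/-- Multiplication by a cutoff with values in [0,1]. The pointwise bound |G| ≤ |g| preserves sup
bounds and zeros, which is needed for causality of `N` and for the localized initial data. -/
theorem exists_contDiff_hasCompactSupport_eqOn {E : Type*} [NormedAddCommGroup E] [NormedSpace ℝ E]
    [FiniteDimensional ℝ E] {g : E → ℝ} {K U : Set E} (hK : IsCompact K) (hU : IsOpen U)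
    (hKU : K ⊆ U) {n : ℕ∞} (hg : ∀ x ∈ U, ContDiffAt ℝ n g x) :
    ∃ G : E → ℝ, ContDiff ℝ n G ∧ HasCompactSupport G ∧ EqOn G g K ∧
      (∀ x, |G x| ≤ |g x|) ∧ ∀ x ∉ U, G x = 0 := by
  obtain ⟨L, hL, hKL, hLU⟩ := exists_compact_between hK hU hKU
  obtain ⟨χ, h0, h1, h01⟩ := exists_contMDiffMap_zero_one_of_isClosed (n := n)
    (modelWithCornersSelf ℝ E) (s := (interior L)ᶜ) (t := K) isOpen_interior.isClosed_compl
    hK.isClosed (disjoint_compl_left_iff_subset.2 hKL)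
  have hχ : ContDiff ℝ n χ := χ.contMDiff.contDiff
  have hsupp : tsupport (fun x => χ x * g x) ⊆ L := by
    refine closure_minimal (fun x hx => ?_) hL.isClosed
    by_contra hxL
    have : x ∈ (interior L)ᶜ := fun h => hxL (interior_subset h)
    exact hx (by simp [h0 this])
  refine ⟨fun x => χ x * g x, ?_, HasCompactSupport.of_support_subset_isCompact hL
    ((subset_tsupport _).trans hsupp), ?_, ?_, ?_⟩
  · rw [contDiff_iff_contDiffAt]
    intro x
    by_cases hx : x ∈ U
    · exact hχ.contDiffAt.mul (hg x hx)
    · have : x ∉ tsupport (fun x => χ x * g x) := fun h => hx (hLU (hsupp h))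
      exact (contDiffAt_const (c := (0 : ℝ))).congr_of_eventuallyEq
        (notMem_tsupport_iff_eventuallyEq.1 this)
  · intro x hx
    simp [h1 hx]
  · intro x
    rw [abs_mul, abs_of_nonneg (h01 x).1]
    exact mul_le_of_le_one_left (abs_nonneg _) (h01 x).2
  · intro x hx
    by_contra h
    exact hx (hLU (hsupp (subset_tsupport _ h)))

/-- A smooth even cutoff at scale `δ`. -/
noncomputable def cutoff (δ : ℝ) (hδ : 0 < δ) : ContDiffBump (0 : ℝ) :=
  ⟨δ, 2 * δ, hδ, by linarith⟩

/-- The Neumann kernel minus a localized heat kernel agrees with a smooth compactly supported kernel. -/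
theorem exists_regularKernel {δ : ℝ} (hδ : 0 < δ) (hδ' : δ < 1 / 32) :
    ∃ N : ℝ × ℝ × ℝ → ℝ, ContDiff ℝ ∞ N ∧ HasCompactSupport N ∧
      (∀ x y t, t ≤ 0 → N (x, y, t) = 0) ∧
      ∀ x y t, |x| ≤ 1 - 5 * δ → |y| ≤ 1 → t ≤ 1 →
        neumannKernel x y t = heatKernel (x - y) t * cutoff δ hδ (x - y) + N (x, y, t) := by
  set ψ := cutoff δ hδ with hψ
  let g : ℝ × ℝ × ℝ → ℝ := fun X =>
    heatKernel (X.1 - X.2.1) X.2.2 * (1 - ψ (X.1 - X.2.1)) + remainderKernel X.1 X.2.1 X.2.2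
  -- On `U` the reflected points ±2 - y stay more than 3δ away from x, and near x = y the factor 1 -
  -- ψ vanishes, so `g` is smooth there at all times.
  let U : Set (ℝ × ℝ × ℝ) := {X | |X.1| < 1 - 4 * δ ∧ |X.2.1| < 1 + δ}
  let K : Set (ℝ × ℝ × ℝ) := Icc (-(1 - 5 * δ)) (1 - 5 * δ) ×ˢ Icc (-1) 1 ×ˢ Icc (-1) 1
  have hU : IsOpen U := by
    have h1 : Continuous fun X : ℝ × ℝ × ℝ => |X.1| := by fun_prop
    have h2 : Continuous fun X : ℝ × ℝ × ℝ => |X.2.1| := by fun_prop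
    exact (isOpen_lt h1 continuous_const).inter (isOpen_lt h2 continuous_const)
  have hKU : K ⊆ U := by
    rintro X ⟨h1, h2, -⟩
    have := abs_le.2 h1
    have := abs_le.2 h2
    exact ⟨by linarith, by linarith⟩
  have hg : ∀ X ∈ U, ContDiffAt ℝ ∞ g X := by
    rintro X ⟨h1, h2⟩
    have h1' := abs_lt.1 h1
    have h2' := abs_lt.1 h2
    refine ContDiffAt.add ?_ (contDiffAt_remainderKernel (by linarith) (by linarith)
      (Or.inl (by intro h; linarith)) (Or.inl (by intro h; linarith)))
    by_cases hxy : X.1 - X.2.1 = 0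
    · have e1 : ∀ᶠ z in 𝓝 (X.1 - X.2.1), ψ z = 1 := by
        rw [hxy]; exact ψ.eventuallyEq_one
      have c1 : ContinuousAt (fun X : ℝ × ℝ × ℝ => X.1 - X.2.1) X := by fun_prop
      refine (contDiffAt_const (c := (0 : ℝ))).congr_of_eventuallyEq ?_
      filter_upwards [c1.eventually e1] with Y hY
      rw [hY]; simp
    · refine (contDiffAt_heatKernel_comp (g := fun X : ℝ × ℝ × ℝ => X.1 - X.2.1)
        (h := fun X => X.2.2) (by fun_prop) (by fun_prop) (Or.inl hxy)).mul ?_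
      have : ContDiff ℝ ∞ fun X : ℝ × ℝ × ℝ => ψ (X.1 - X.2.1) :=
        ψ.contDiff.comp (by fun_prop)
      exact contDiffAt_const.sub this.contDiffAt
  obtain ⟨N, hN, hNc, hNK, hN0, -⟩ := exists_contDiff_hasCompactSupport_eqOn (n := ⊤)
    (isCompact_Icc.prod (isCompact_Icc.prod isCompact_Icc) : IsCompact K) hU hKU hg
  have hz : ∀ x y t, t ≤ 0 → N (x, y, t) = 0 := by
    intro x y t ht
    rw [← abs_nonpos_iff]
    refine (hN0 _).trans (le_of_eq ?_)
    simp [g, remainderKernel, heatKernel_of_nonpos _ ht, tailKernel_of_nonpos _ _ ht]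
  refine ⟨N, hN, hNc, hz, fun x y t hx hy ht => ?_⟩
  rcases le_or_gt t 0 with h | h
  · rw [hz x y t h, neumannKernel_of_nonpos _ _ h, heatKernel_of_nonpos _ h]
    simp
  · rw [hNK (show (x, y, t) ∈ K from ⟨abs_le.1 hx, abs_le.1 hy, by linarith, ht⟩),
      neumannKernel_eq (by linarith) (by linarith)]
    simp only [g, remainderKernel]
    ring

/-- Smooth compactly supported kernels of `(x,y,t)` that vanish for `t ≤ 0`. -/
structure IsCausalKernel (N : ℝ × ℝ × ℝ → ℝ) : Prop where
  contDiff : ContDiff ℝ ∞ N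
  compact : HasCompactSupport N
  zero : ∀ x y t, t ≤ 0 → N (x, y, t) = 0

theorem IsCausalKernel.hasDerivAt_fst {N : ℝ × ℝ × ℝ → ℝ} (h : IsCausalKernel N) (x y t : ℝ) :
    HasDerivAt (fun x => N (x, y, t)) (fderiv ℝ N (x, y, t) (1, 0, 0)) x :=
  ((h.contDiff.differentiable (by simp)) (x, y, t)).hasFDerivAt.comp_hasDerivAt x
    ((hasDerivAt_id x).prodMk (hasDerivAt_const x (y, t)))

theorem IsCausalKernel.hasDerivAt_snd {N : ℝ × ℝ × ℝ → ℝ} (h : IsCausalKernel N) (x y t : ℝ) :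
    HasDerivAt (fun y => N (x, y, t)) (fderiv ℝ N (x, y, t) (0, 1, 0)) y :=
  ((h.contDiff.differentiable (by simp)) (x, y, t)).hasFDerivAt.comp_hasDerivAt y
    ((hasDerivAt_const y x).prodMk ((hasDerivAt_id y).prodMk (hasDerivAt_const y t)))

theorem IsCausalKernel.fderiv_fst {N : ℝ × ℝ × ℝ → ℝ} (h : IsCausalKernel N) :
    IsCausalKernel fun q => fderiv ℝ N q (1, 0, 0) where
  contDiff := (h.contDiff.fderiv_right (m := ∞) (by simp)).clm_apply contDiff_const
  compact := h.compact.fderiv_apply ℝ _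
  zero := fun x y t ht => by
    have h1 := h.hasDerivAt_fst x y t
    have h2 : (fun x => N (x, y, t)) = fun _ => 0 := funext fun x => h.zero x y t ht
    rw [h2] at h1
    exact h1.unique (hasDerivAt_const x 0)

theorem IsCausalKernel.fderiv_snd {N : ℝ × ℝ × ℝ → ℝ} (h : IsCausalKernel N) :
    IsCausalKernel fun q => fderiv ℝ N q (0, 1, 0) where
  contDiff := (h.contDiff.fderiv_right (m := ∞) (by simp)).clm_apply contDiff_const
  compact := h.compact.fderiv_apply ℝ _
  zero := fun x y t ht => by
    have h1 := h.hasDerivAt_snd x y t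
    have h2 : (fun y => N (x, y, t)) = fun _ => 0 := funext fun y => h.zero x y t ht
    rw [h2] at h1
    exact h1.unique (hasDerivAt_const y 0)

/-- A Lipschitz function that vanishes at t = 0 is O(t). This gain of a power of t is the source of
all smallness below. -/
theorem IsCausalKernel.exists_bound {N : ℝ × ℝ × ℝ → ℝ} (h : IsCausalKernel N) :
    ∃ C : ℝ, 0 ≤ C ∧ ∀ x y t, 0 ≤ t → |N (x, y, t)| ≤ C * t := by
  obtain ⟨C, hC⟩ := ContDiff.lipschitzWith_of_hasCompactSupport h.compact h.contDiff (by simp)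
  refine ⟨C, C.2, fun x y t ht => ?_⟩
  have := hC.dist_le_mul (x, y, t) (x, y, 0)
  rw [h.zero x y 0 le_rfl, Real.dist_eq, sub_zero] at this
  refine this.trans (le_of_eq ?_)
  simp [Prod.dist_eq, abs_of_nonneg ht, ht]

theorem abs_sub_le_of_hasDerivAt {g g' : ℝ → ℝ} {C : ℝ} (hg : ∀ x, HasDerivAt g (g' x) x)
    (hC : ∀ x, |g' x| ≤ C) (x y : ℝ) : |g x - g y| ≤ C * |x - y| :=
  convex_univ.norm_image_sub_le_of_norm_hasDerivWithin_le (f := g) (f' := g')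
    (fun x _ => (hg x).hasDerivWithinAt) (fun x _ => hC x) (mem_univ y) (mem_univ x)

theorem IsCausalKernel.exists_lipschitz_snd {N : ℝ × ℝ × ℝ → ℝ} (h : IsCausalKernel N) :
    ∃ C : ℝ, 0 ≤ C ∧ ∀ x y z t, 0 ≤ t → |N (x, y, t) - N (x, z, t)| ≤ C * t * |y - z| := by
  obtain ⟨C, hC, hb⟩ := h.fderiv_snd.exists_bound
  exact ⟨C, hC, fun x y z t ht => abs_sub_le_of_hasDerivAt
    (fun y => h.hasDerivAt_snd x y t) (fun y => hb x y t ht) y z⟩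

theorem IsCausalKernel.exists_lipschitz_fst {N : ℝ × ℝ × ℝ → ℝ} (h : IsCausalKernel N) :
    ∃ C : ℝ, 0 ≤ C ∧ ∀ x z y t, 0 ≤ t → |N (x, y, t) - N (z, y, t)| ≤ C * t * |x - z| := by
  obtain ⟨C, hC, hb⟩ := h.fderiv_fst.exists_bound
  exact ⟨C, hC, fun x z y t ht => abs_sub_le_of_hasDerivAt
    (fun x => h.hasDerivAt_fst x y t) (fun x => hb x y t ht) x z⟩

end RegularKernel

/-! ### Estimates for source terms with small kernels -/

section FixedPoint

/-- Since ∫₀ᵀ s^(-1/2) ds = 2√T, a flux known only through |l|√s ≤ B can still be integrated. -/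
theorem norm_integral_le_of_le_div_sqrt {T A D : ℝ} (hT : 0 < T) {φ : ℝ → ℝ}
    (h : ∀ s ∈ Ioc 0 T, |φ s| ≤ D + A * s ^ (-(1 / 2) : ℝ)) :
    |∫ s in (0 : ℝ)..T, φ s| ≤ D * T + A * (2 * Real.sqrt T) := by
  have hint : IntervalIntegrable (fun s : ℝ => s ^ (-(1 / 2) : ℝ)) volume 0 T :=
    intervalIntegral.intervalIntegrable_rpow' (by norm_num)
  have h1 := intervalIntegral.norm_integral_le_of_norm_le hT.le (f := φ)
    (g := fun s => D + A * s ^ (-(1 / 2) : ℝ)) (μ := volume)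
    (ae_of_all _ fun s hs => h s hs)
    ((intervalIntegrable_const (c := D)).add (hint.const_mul A))
  refine h1.trans (le_of_eq ?_)
  rw [intervalIntegral.integral_add intervalIntegrable_const (hint.const_mul A),
    intervalIntegral.integral_const, intervalIntegral.integral_const_mul,
    integral_rpow (Or.inl (by norm_num)), Real.sqrt_eq_rpow]
  have : (-(1 / 2) + 1 : ℝ) = 1 / 2 := by norm_num
  rw [this, Real.zero_rpow (by norm_num)]
  simp only [sub_zero, smul_eq_mul]
  ring

theorem abs_le_mul_rpow_of_mul_sqrt_le {l s B : ℝ} (hs : 0 < s) (h : |l| * Real.sqrt s ≤ B) :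
    |l| ≤ B * s ^ (-(1 / 2) : ℝ) := by
  rw [Real.rpow_neg hs.le, ← Real.sqrt_eq_rpow, ← div_eq_mul_inv, le_div_iff₀ (Real.sqrt_pos.2 hs)]
  exact h

/-- The source term generated by the path `p` with strength `l`. -/
noncomputable def sourceTerm (k : ℝ → ℝ → ℝ → ℝ) (T : ℝ) (p l : ℝ → ℝ) (x t : ℝ) : ℝ :=
  ∫ s in (0 : ℝ)..T, k x (p s) (t - s) * l s

/-- Continuous causal kernels `k(x,p,τ)` of size `C τ`, Lipschitz in `p`. -/
structure IsSmallKernel (k : ℝ → ℝ → ℝ → ℝ) (C : ℝ) : Prop where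
  nonneg : 0 ≤ C
  continuous : Continuous fun q : ℝ × ℝ × ℝ => k q.1 q.2.1 q.2.2
  zero : ∀ x p τ, τ ≤ 0 → k x p τ = 0
  bound : ∀ x p τ, 0 ≤ τ → |k x p τ| ≤ C * τ
  lipschitz : ∀ x p q τ, 0 ≤ τ → |k x p τ - k x q τ| ≤ C * τ * |p - q|

variable {k kx : ℝ → ℝ → ℝ → ℝ} {C T B : ℝ} {p l : ℝ → ℝ}

theorem IsSmallKernel.continuous_sourceTerm (hk : IsSmallKernel k C) (hp : Continuous p)
    (hl : Continuous l) : Continuous fun q : ℝ × ℝ => sourceTerm k T p l q.1 q.2 := by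
  unfold sourceTerm
  refine intervalIntegral.continuous_parametric_intervalIntegral_of_continuous'
    (f := fun (q : ℝ × ℝ) s => k q.1 (p s) (q.2 - s) * l s) ?_ 0 T
  have : Continuous fun z : (ℝ × ℝ) × ℝ => (z.1.1, p z.2, z.1.2 - z.2) := by fun_prop
  exact (hk.continuous.comp this).mul (hl.comp continuous_snd)

/-- Causality kills the times s > t, so integration may run over the fixed interval [0,T] while the
bound keeps the factor t. -/
theorem IsSmallKernel.bound_of_le (hk : IsSmallKernel k C) (x q : ℝ) {t s : ℝ} (ht : 0 ≤ t)
    (hs : 0 ≤ s) : |k x q (t - s)| ≤ C * t := by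
  rcases le_or_gt s t with h | h
  · exact (hk.bound x q _ (by linarith)).trans
      (mul_le_mul_of_nonneg_left (by linarith) hk.nonneg)
  · rw [hk.zero x q _ (by linarith), abs_zero]
    exact mul_nonneg hk.nonneg ht

theorem IsSmallKernel.lipschitz_of_le (hk : IsSmallKernel k C) (x q q' : ℝ) {t s : ℝ} (ht : 0 ≤ t)
    (hs : 0 ≤ s) : |k x q (t - s) - k x q' (t - s)| ≤ C * t * |q - q'| := by
  rcases le_or_gt s t with h | h
  · refine (hk.lipschitz x q q' _ (by linarith)).trans
      (mul_le_mul_of_nonneg_right (mul_le_mul_of_nonneg_left (by linarith) hk.nonneg)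
        (abs_nonneg _))
  · rw [hk.zero x q _ (by linarith), hk.zero x q' _ (by linarith), sub_zero, abs_zero]
    exact mul_nonneg (mul_nonneg hk.nonneg ht) (abs_nonneg _)

theorem IsSmallKernel.abs_sourceTerm_le (hk : IsSmallKernel k C) (hT : 0 < T)
    (hl : ∀ s ∈ Icc 0 T, |l s| * Real.sqrt s ≤ B) (x : ℝ) {t : ℝ} (ht : 0 ≤ t) :
    |sourceTerm k T p l x t| ≤ C * t * B * (2 * Real.sqrt T) := by
  have := norm_integral_le_of_le_div_sqrt (T := T) (A := C * t * B) (D := 0) hT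
    (φ := fun s => k x (p s) (t - s) * l s) (fun s hs => by
      rw [abs_mul, zero_add, mul_assoc]
      exact mul_le_mul (hk.bound_of_le x _ ht hs.1.le)
        (abs_le_mul_rpow_of_mul_sqrt_le hs.1 (hl s ⟨hs.1.le, hs.2⟩)) (abs_nonneg _)
        (mul_nonneg hk.nonneg ht))
  simpa [sourceTerm] using this

theorem IsSmallKernel.intervalIntegrable (hk : IsSmallKernel k C) (hp : Continuous p)
    (hl : Continuous l) (x t : ℝ) :
    IntervalIntegrable (fun s => k x (p s) (t - s) * l s) volume 0 T := by
  have : Continuous fun s : ℝ => (x, p s, t - s) := by fun_prop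
  exact ((hk.continuous.comp this).mul hl).intervalIntegrable _ _

/-- From k(p)l - k(p')l' = k(p)(l - l') + (k(p) - k(p'))l'. The unweighted distance D suffices, and
the factor t is kept because it later cancels a factor 1/t. -/
theorem IsSmallKernel.abs_sourceTerm_sub_le (hk : IsSmallKernel k C) (hT : 0 < T)
    {p' l' : ℝ → ℝ} (hp : Continuous p) (hlc : Continuous l) (hp' : Continuous p')
    (hlc' : Continuous l') (hl : ∀ s ∈ Icc 0 T, |l' s| * Real.sqrt s ≤ B)
    {D : ℝ} (hD : 0 ≤ D) (h1 : ∀ s ∈ Icc 0 T, |p s - p' s| ≤ D)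
    (h2 : ∀ s ∈ Icc 0 T, |l s - l' s| ≤ D) (x : ℝ) {t : ℝ} (ht : 0 ≤ t) :
    |sourceTerm k T p l x t - sourceTerm k T p' l' x t|
      ≤ t * (C * (T + 2 * B * Real.sqrt T)) * D := by
  have hCt := mul_nonneg hk.nonneg ht
  unfold sourceTerm
  rw [← intervalIntegral.integral_sub (hk.intervalIntegrable hp hlc x t)
    (hk.intervalIntegrable hp' hlc' x t)]
  refine (norm_integral_le_of_le_div_sqrt (T := T) (D := C * t * D) (A := C * t * D * B) hT
    fun s hs => ?_).trans (le_of_eq (by ring))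
  have hs' : s ∈ Icc 0 T := ⟨hs.1.le, hs.2⟩
  have e : k x (p s) (t - s) * l s - k x (p' s) (t - s) * l' s =
    k x (p s) (t - s) * (l s - l' s) + (k x (p s) (t - s) - k x (p' s) (t - s)) * l' s := by ring
  rw [e]
  refine (abs_add_le _ _).trans ?_
  rw [abs_mul, abs_mul, mul_assoc (C * t * D)]
  refine add_le_add ?_ ?_
  · exact mul_le_mul (hk.bound_of_le x _ ht hs.1.le) (h2 s hs') (abs_nonneg _) hCt
  · refine mul_le_mul ?_ (abs_le_mul_rpow_of_mul_sqrt_le hs.1 (hl s hs')) (abs_nonneg _)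
      (mul_nonneg hCt hD)
    exact (hk.lipschitz_of_le x _ _ ht hs.1.le).trans (mul_le_mul_of_nonneg_left (h1 s hs') hCt)

theorem IsSmallKernel.abs_sourceTerm_sub_le_space (hk : IsSmallKernel k C) (hT : 0 < T)
    (hLip : ∀ x x' q τ, 0 ≤ τ → |k x q τ - k x' q τ| ≤ C * τ * |x - x'|)
    (hp : Continuous p) (hlc : Continuous l)
    (hl : ∀ s ∈ Icc 0 T, |l s| * Real.sqrt s ≤ B) (x x' : ℝ) {t : ℝ} (ht : 0 ≤ t) :
    |sourceTerm k T p l x t - sourceTerm k T p l x' t|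
      ≤ C * t * B * (2 * Real.sqrt T) * |x - x'| := by
  unfold sourceTerm
  rw [← intervalIntegral.integral_sub (hk.intervalIntegrable hp hlc x t)
    (hk.intervalIntegrable hp hlc x' t)]
  refine (norm_integral_le_of_le_div_sqrt (T := T) (D := 0) (A := C * t * |x - x'| * B) hT
    fun s hs => ?_).trans (le_of_eq (by ring))
  rw [← sub_mul, abs_mul, zero_add, mul_assoc (C * t * |x - x'|)]
  have hCt := mul_nonneg hk.nonneg ht
  refine mul_le_mul ?_ (abs_le_mul_rpow_of_mul_sqrt_le hs.1 (hl s ⟨hs.1.le, hs.2⟩)) (abs_nonneg _)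
    (mul_nonneg hCt (abs_nonneg _))
  rcases le_or_gt s t with h | h
  · exact (hLip x x' _ _ (by linarith)).trans
      (mul_le_mul_of_nonneg_right (mul_le_mul_of_nonneg_left (by linarith [hs.1]) hk.nonneg)
        (abs_nonneg _))
  · rw [hk.zero x _ _ (by linarith), hk.zero x' _ _ (by linarith), sub_zero, abs_zero]
    exact mul_nonneg hCt (abs_nonneg _)

theorem hasDerivAt_sourceTerm (hk : IsSmallKernel k C) (hkx : IsSmallKernel kx C)
    (hd : ∀ x q τ, HasDerivAt (fun x => k x q τ) (kx x q τ) x)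
    (hp : Continuous p) (hl : Continuous l) (hT : 0 < T) (x : ℝ) {t : ℝ} (ht : 0 ≤ t) :
    HasDerivAt (fun x => sourceTerm k T p l x t) (sourceTerm kx T p l x t) x := by
  unfold sourceTerm
  refine (intervalIntegral.hasDerivAt_integral_of_dominated_loc_of_deriv_le (𝕜 := ℝ)
    (F := fun x s => k x (p s) (t - s) * l s) (F' := fun x s => kx x (p s) (t - s) * l s)
    (s := univ) (bound := fun s => C * t * |l s|) univ_mem ?_
    (hk.intervalIntegrable hp hl x t) ?_ ?_ ?_ ?_).2
  · exact Eventually.of_forall fun y =>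
      (hk.intervalIntegrable hp hl y t).aestronglyMeasurable_restrict_uIoc
  · exact (hkx.intervalIntegrable hp hl x t).aestronglyMeasurable_restrict_uIoc
  · refine ae_of_all _ fun s hs y _ => ?_
    rw [uIoc_of_le hT.le] at hs
    rw [norm_mul]
    exact mul_le_mul_of_nonneg_right (hkx.bound_of_le y _ ht hs.1.le) (norm_nonneg _)
  · exact (continuous_const.mul hl.abs).intervalIntegrable _ _
  · exact ae_of_all _ fun s _ y _ => (hd y (p s) (t - s)).mul_const _

end FixedPoint

/-! ### The contraction for the free boundary and its flux -/

section FixedPoint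

theorem mul_abs_sub_le_of_hasDerivAt {W W' : ℝ → ℝ} {J : Set ℝ} {κ : ℝ} (hJ : Convex ℝ J)
    (hd : ∀ x, HasDerivAt W (W' x) x) (hs : ∀ x ∈ J, W' x ≤ -κ) {x y : ℝ} (hx : x ∈ J)
    (hy : y ∈ J) (hxy : x ≤ y) : κ * (y - x) ≤ W x - W y := by
  have := hJ.image_sub_le_mul_sub_of_deriv_le (f := W) (C := -κ)
    (fun z _ => (hd z).continuousAt.continuousWithinAt)
    (fun z _ => (hd z).differentiableAt.differentiableWithinAt)
    (fun z hz => by rw [(hd z).deriv]; exact hs z (interior_subset hz)) x hx y hy hxy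
  linarith

/-- Converts an error in the value of a steep function into an error in the position of its zero. -/
theorem mul_abs_sub_le {W W' : ℝ → ℝ} {J : Set ℝ} {κ : ℝ} (hJ : Convex ℝ J)
    (hd : ∀ x, HasDerivAt W (W' x) x) (hs : ∀ x ∈ J, W' x ≤ -κ) {x y : ℝ} (hx : x ∈ J)
    (hy : y ∈ J) : κ * |x - y| ≤ |W x - W y| := by
  rcases le_total x y with h | h
  · have := mul_abs_sub_le_of_hasDerivAt hJ hd hs hx hy h
    rw [abs_of_nonpos (by linarith)]
    linarith [le_abs_self (W x - W y)]
  · have := mul_abs_sub_le_of_hasDerivAt hJ hd hs hy hx h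
    rw [abs_of_nonneg (by linarith)]
    linarith [neg_abs_le (W x - W y)]

/-- The data of the fixed point problem for the free boundary and its flux: `w` is the solution
without source near the initial free boundary, `k` the kernel of the source term. -/
structure FixedPointData (T δ pI κ B C H : ℝ) (w wx : ℝ → ℝ → ℝ) (k kx : ℝ → ℝ → ℝ → ℝ) :
    Prop where
  T_pos : 0 < T
  δ_pos : 0 < δ
  κ_pos : 0 < κ
  B_nonneg : 0 ≤ B
  H_nonneg : 0 ≤ H
  continuous_w : ContinuousOn (fun q : ℝ × ℝ => w q.1 q.2) (univ ×ˢ Icc 0 T)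
  continuous_wx : ContinuousOn (fun q : ℝ × ℝ => wx q.1 q.2) (univ ×ˢ Icc 0 T)
  hasDerivAt_w : ∀ t ∈ Icc 0 T, ∀ x, HasDerivAt (fun x => w x t) (wx x t) x
  small_k : IsSmallKernel k C
  small_kx : IsSmallKernel kx C
  hasDerivAt_k : ∀ x q τ, HasDerivAt (fun x => k x q τ) (kx x q τ) x
  lipschitz_kx : ∀ x x' q τ, 0 ≤ τ → |kx x q τ - kx x' q τ| ≤ C * τ * |x - x'|
  slope : ∀ t ∈ Icc 0 T, ∀ x ∈ Icc (pI - δ) (pI + δ),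
    wx x t ≤ -(κ + C * T * B * (2 * Real.sqrt T))
  right : ∀ t ∈ Icc 0 T, w (pI + δ) t ≤ -(C * T * B * (2 * Real.sqrt T))
  left : ∀ t ∈ Icc 0 T, C * T * B * (2 * Real.sqrt T) ≤ w (pI - δ) t
  flux : ∀ t ∈ Icc 0 T, ∀ x ∈ Icc (pI - δ) (pI + δ),
    |wx x t| * Real.sqrt t + C * T * B * (2 * Real.sqrt T) * Real.sqrt T ≤ B
  lipschitz_wx : ∀ t ∈ Icc 0 T, ∀ x ∈ Icc (pI - δ) (pI + δ), ∀ y ∈ Icc (pI - δ) (pI + δ),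
    t * |wx x t - wx y t| ≤ H * |x - y|
  contraction : C * (T + 2 * B * Real.sqrt T) *
    (T + (H + T * (C * T * B * (2 * Real.sqrt T))) / κ + T / κ) ≤ 1 / 2

variable {T δ pI κ B C H : ℝ} {w wx : ℝ → ℝ → ℝ} {k kx : ℝ → ℝ → ℝ → ℝ} {p l : ℝ → ℝ}

/-- The admissible pairs of free boundary and flux. -/
structure IsAdmissiblePair (T δ pI B : ℝ) (p l : ℝ → ℝ) : Prop where
  continuous_p : Continuous p
  continuous_l : Continuous l
  mem : ∀ t ∈ Icc 0 T, p t ∈ Icc (pI - δ) (pI + δ)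
  bound : ∀ t ∈ Icc 0 T, |l t| * Real.sqrt t ≤ B

/-- This bound is the expression recurring in the fields `slope`, `left`, `right` and `flux` of
`FixedPointData`: those conditions on the sourceless solution leave exactly this much room for the
source term and its derivative. -/
theorem FixedPointData.abs_sourceTerm_le (h : FixedPointData T δ pI κ B C H w wx k kx)
    {k' : ℝ → ℝ → ℝ → ℝ} (hk' : IsSmallKernel k' C)
    (hpl : IsAdmissiblePair T δ pI B p l) (x : ℝ) {t : ℝ} (ht : t ∈ Icc 0 T) :
    |sourceTerm k' T p l x t| ≤ C * T * B * (2 * Real.sqrt T) := by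
  refine (hk'.abs_sourceTerm_le h.T_pos hpl.bound x ht.1).trans ?_
  have := hk'.nonneg
  have := h.B_nonneg
  have := ht.2
  gcongr

theorem FixedPointData.hasDerivAt_add (h : FixedPointData T δ pI κ B C H w wx k kx)
    (hpl : IsAdmissiblePair T δ pI B p l) {t : ℝ} (ht : t ∈ Icc 0 T) (x : ℝ) :
    HasDerivAt (fun x => w x t + sourceTerm k T p l x t) (wx x t + sourceTerm kx T p l x t) x :=
  (h.hasDerivAt_w t ht x).add (hasDerivAt_sourceTerm h.small_k h.small_kx h.hasDerivAt_k
    hpl.continuous_p hpl.continuous_l h.T_pos x ht.1)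

theorem FixedPointData.slope_add (h : FixedPointData T δ pI κ B C H w wx k kx)
    (hpl : IsAdmissiblePair T δ pI B p l) {t : ℝ} (ht : t ∈ Icc 0 T) {x : ℝ}
    (hx : x ∈ Icc (pI - δ) (pI + δ)) : wx x t + sourceTerm kx T p l x t ≤ -κ := by
  have h1 := h.slope t ht x hx
  have h2 := (abs_le.1 (h.abs_sourceTerm_le h.small_kx hpl x ht)).2
  linarith

/-- One step of the iteration. The room left in `left` and `right` gives opposite signs at the ends
of the window, the slope bound makes the zero unique and continuous in time, and `flux` returns the
weighted bound on the new flux. -/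
theorem FixedPointData.exists_next (h : FixedPointData T δ pI κ B C H w wx k kx)
    (hpl : IsAdmissiblePair T δ pI B p l) :
    ∃ ψ : C(Icc (0 : ℝ) T, ℝ × ℝ), ∀ t : Icc (0 : ℝ) T,
      (ψ t).1 ∈ Icc (pI - δ) (pI + δ) ∧ |(ψ t).2| * Real.sqrt t ≤ B ∧
      w (ψ t).1 t + sourceTerm k T p l (ψ t).1 t = 0 ∧
      (ψ t).2 = -(wx (ψ t).1 t + sourceTerm kx T p l (ψ t).1 t) := by
  have hδ := h.δ_pos
  have hz : ∀ t : Icc (0 : ℝ) T, ∃ x ∈ Icc (pI - δ) (pI + δ),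
      w x t + sourceTerm k T p l x t = 0 := by
    intro t
    have h1 := abs_le.1 (h.abs_sourceTerm_le h.small_k hpl (pI - δ) t.2)
    have h2 := abs_le.1 (h.abs_sourceTerm_le h.small_k hpl (pI + δ) t.2)
    have h3 := h.right t t.2
    have h4 := h.left t t.2
    have hc : ContinuousOn (fun x => w x t + sourceTerm k T p l x t) (Icc (pI - δ) (pI + δ)) :=
      fun x _ => (h.hasDerivAt_add hpl t.2 x).continuousAt.continuousWithinAt
    exact intermediate_value_Icc' (by linarith) hc ⟨by linarith, by linarith⟩
  choose P hP hP0 using hz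
  have cw : Continuous fun q : ℝ × Icc (0 : ℝ) T =>
      w q.1 q.2 + sourceTerm k T p l q.1 q.2 := by
    refine Continuous.add ?_ ?_
    · exact h.continuous_w.comp_continuous (f := fun q : ℝ × Icc (0 : ℝ) T => (q.1, (q.2 : ℝ)))
        (by fun_prop) (fun q => ⟨mem_univ _, q.2.2⟩)
    · exact (h.small_k.continuous_sourceTerm hpl.continuous_p hpl.continuous_l).comp
        (by fun_prop : Continuous fun q : ℝ × Icc (0 : ℝ) T => (q.1, (q.2 : ℝ)))
  have cwx : Continuous fun q : ℝ × Icc (0 : ℝ) T =>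
      wx q.1 q.2 + sourceTerm kx T p l q.1 q.2 := by
    refine Continuous.add ?_ ?_
    · exact h.continuous_wx.comp_continuous (f := fun q : ℝ × Icc (0 : ℝ) T => (q.1, (q.2 : ℝ)))
        (by fun_prop) (fun q => ⟨mem_univ _, q.2.2⟩)
    · exact (h.small_kx.continuous_sourceTerm hpl.continuous_p hpl.continuous_l).comp
        (by fun_prop : Continuous fun q : ℝ × Icc (0 : ℝ) T => (q.1, (q.2 : ℝ)))
  have cP : Continuous P := by
    rw [continuous_iff_continuousAt]
    intro t₀
    rw [ContinuousAt, tendsto_iff_dist_tendsto_zero]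
    -- By steepness κ|P t - P t₀| is at most the value at time t at the old zero P t₀, which tends
    -- to zero.
    have hg : Tendsto (fun t : Icc (0 : ℝ) T =>
        κ⁻¹ * |w (P t₀) t + sourceTerm k T p l (P t₀) t|) (𝓝 t₀) (𝓝 0) := by
      have c1 : Continuous fun t : Icc (0 : ℝ) T =>
          κ⁻¹ * |w (P t₀) t + sourceTerm k T p l (P t₀) t| :=
        continuous_const.mul (cw.comp (by fun_prop :
          Continuous fun t : Icc (0 : ℝ) T => (P t₀, t))).abs
      have := c1.tendsto t₀
      simp only [hP0 t₀, abs_zero, mul_zero] at this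
      exact this
    refine squeeze_zero (fun _ => dist_nonneg) (fun t => ?_) hg
    have := mul_abs_sub_le (convex_Icc _ _) (h.hasDerivAt_add hpl t.2)
      (fun x hx => h.slope_add hpl t.2 hx) (hP t) (hP t₀)
    rw [hP0 t, zero_sub, abs_neg] at this
    rw [Real.dist_eq, inv_mul_eq_div, le_div_iff₀ h.κ_pos]
    linarith
  refine ⟨⟨fun t => (P t, -(wx (P t) t + sourceTerm kx T p l (P t) t)),
    cP.prodMk (cwx.comp (cP.prodMk continuous_id)).neg⟩, fun t => ⟨hP t, ?_, hP0 t, rfl⟩⟩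
  have h1 := h.flux t t.2 _ (hP t)
  have h2 := h.abs_sourceTerm_le h.small_kx hpl (P t) t.2
  have h3 : Real.sqrt t ≤ Real.sqrt T := Real.sqrt_le_sqrt t.2.2
  have h4 : |wx (P t) t + sourceTerm kx T p l (P t) t|
      ≤ |wx (P t) t| + C * T * B * (2 * Real.sqrt T) :=
    (abs_add_le _ _).trans (add_le_add_right h2 _)
  have h5 := (abs_nonneg _).trans h2
  simp only [ContinuousMap.coe_mk, abs_neg]
  calc _ ≤ (|wx (P t) t| + C * T * B * (2 * Real.sqrt T)) * Real.sqrt t :=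
        mul_le_mul_of_nonneg_right h4 (Real.sqrt_nonneg _)
    _ ≤ |wx (P t) t| * Real.sqrt t + C * T * B * (2 * Real.sqrt T) * Real.sqrt T := by
        rw [add_mul]; gcongr
    _ ≤ B := h1

/-- The two profiles differ by t·ρ·D, so by steepness the zeros differ by at most t·ρ·D/κ. The
derivative of the sourceless part may oscillate like H/t between the zeros; the factor t makes this
a bounded multiple of D. The constant ρ tends to zero with `T`, so `contraction` gives the factor
1/2. -/
theorem FixedPointData.contract (h : FixedPointData T δ pI κ B C H w wx k kx)
    (hpl : IsAdmissiblePair T δ pI B p l) {p' l' : ℝ → ℝ}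
    (hpl' : IsAdmissiblePair T δ pI B p' l') {D : ℝ} (hD : 0 ≤ D)
    (h1 : ∀ s ∈ Icc 0 T, |p s - p' s| ≤ D) (h2 : ∀ s ∈ Icc 0 T, |l s - l' s| ≤ D)
    {t : ℝ} (ht : t ∈ Icc 0 T) {x x' y y' : ℝ}
    (hx : x ∈ Icc (pI - δ) (pI + δ)) (hx' : x' ∈ Icc (pI - δ) (pI + δ))
    (hw : w x t + sourceTerm k T p l x t = 0) (hw' : w x' t + sourceTerm k T p' l' x' t = 0)
    (hy : y = -(wx x t + sourceTerm kx T p l x t))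
    (hy' : y' = -(wx x' t + sourceTerm kx T p' l' x' t)) :
    |x - x'| ≤ 1 / 2 * D ∧ |y - y'| ≤ 1 / 2 * D := by
  have hκ := h.κ_pos
  have hT := h.T_pos
  have hB := h.B_nonneg
  have hC := h.small_k.nonneg
  have hH := h.H_nonneg
  have hct := h.contraction
  set E := C * T * B * (2 * Real.sqrt T) with hE
  have hE0 : 0 ≤ E := by positivity
  set ρ := C * (T + 2 * B * Real.sqrt T) with hρ
  have hρ0 : 0 ≤ ρ := by positivity
  have hρD : 0 ≤ ρ * D := mul_nonneg hρ0 hD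
  have s1 : |sourceTerm k T p l x' t - sourceTerm k T p' l' x' t| ≤ t * ρ * D :=
    h.small_k.abs_sourceTerm_sub_le hT hpl.continuous_p hpl.continuous_l hpl'.continuous_p
      hpl'.continuous_l hpl'.bound hD h1 h2 x' ht.1
  have s2 : |sourceTerm kx T p l x' t - sourceTerm kx T p' l' x' t| ≤ t * ρ * D :=
    h.small_kx.abs_sourceTerm_sub_le hT hpl.continuous_p hpl.continuous_l hpl'.continuous_p
      hpl'.continuous_l hpl'.bound hD h1 h2 x' ht.1
  have s3 : |sourceTerm kx T p l x t - sourceTerm kx T p l x' t| ≤ E * |x - x'| := by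
    refine (h.small_kx.abs_sourceTerm_sub_le_space hT h.lipschitz_kx hpl.continuous_p
      hpl.continuous_l hpl.bound x x' ht.1).trans ?_
    rw [hE]
    have := ht.2
    gcongr
  -- Each zero belongs to its own profile, so the first profile at x' equals the difference of the
  -- two source terms there.
  have d1 : κ * |x - x'| ≤ t * (ρ * D) := by
    have := mul_abs_sub_le (convex_Icc _ _) (h.hasDerivAt_add hpl ht)
      (fun x hx => h.slope_add hpl ht hx) hx hx'
    have e : w x t + sourceTerm k T p l x t - (w x' t + sourceTerm k T p l x' t) =
        -(sourceTerm k T p l x' t - sourceTerm k T p' l' x' t) := by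
      rw [hw]; linarith
    rw [e, abs_neg] at this
    linarith
  have d2 : |x - x'| ≤ t * (ρ * D) / κ := by
    rw [le_div_iff₀ hκ]; linarith
  have d3 : |wx x t - wx x' t| ≤ H * (ρ * D) / κ := by
    -- At t = 0 the weighted Lipschitz bound is void, but there the two zeros coincide.
    rcases ht.1.eq_or_lt with h0 | h0
    · have : |x - x'| ≤ 0 := by rw [← h0] at d2; simpa using d2
      have : x = x' := by
        rw [← sub_eq_zero, ← abs_eq_zero]; exact le_antisymm this (abs_nonneg _)
      rw [this, sub_self, abs_zero]
      positivity
    · have h3 := h.lipschitz_wx t ht x hx x' hx'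
      have h4 : H * |x - x'| ≤ H * (t * (ρ * D) / κ) := mul_le_mul_of_nonneg_left d2 hH
      have h5 : t * |wx x t - wx x' t| ≤ t * (H * (ρ * D) / κ) := by
        refine (h3.trans h4).trans (le_of_eq ?_); ring
      exact le_of_mul_le_mul_left h5 h0
  have d4 : t * (ρ * D) ≤ T * (ρ * D) := mul_le_mul_of_nonneg_right ht.2 hρD
  have d5 : |x - x'| ≤ T * (ρ * D) / κ := d2.trans (by gcongr)
  have tot : T * (ρ * D) + (H + T * E) * (ρ * D) / κ + T * (ρ * D) / κ ≤ 1 / 2 * D := by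
    have := mul_le_mul_of_nonneg_right hct hD
    refine le_trans (le_of_eq ?_) this
    ring
  have p1 : 0 ≤ T * (ρ * D) := mul_nonneg hT.le hρD
  have p2 : 0 ≤ (H + T * E) * (ρ * D) / κ := by positivity
  have p3 : 0 ≤ T * (ρ * D) / κ := by positivity
  refine ⟨by linarith, ?_⟩
  have e : y - y' = -((wx x t - wx x' t) + (sourceTerm kx T p l x t - sourceTerm kx T p l x' t)
      + (sourceTerm kx T p l x' t - sourceTerm kx T p' l' x' t)) := by
    rw [hy, hy']; ring
  rw [e, abs_neg]
  have d6 : E * |x - x'| ≤ E * (T * (ρ * D) / κ) := mul_le_mul_of_nonneg_left d5 hE0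
  have d7 : (H + T * E) * (ρ * D) / κ = H * (ρ * D) / κ + E * (T * (ρ * D) / κ) := by ring
  have := abs_add_three (wx x t - wx x' t)
    (sourceTerm kx T p l x t - sourceTerm kx T p l x' t)
    (sourceTerm kx T p l x' t - sourceTerm kx T p' l' x' t)
  linarith

theorem FixedPointData.exists_fixedPoint (h : FixedPointData T δ pI κ B C H w wx k kx) :
    ∃ p l : ℝ → ℝ, IsAdmissiblePair T δ pI B p l ∧
      (∀ t ∈ Icc 0 T, w (p t) t + sourceTerm k T p l (p t) t = 0) ∧
      ∀ t ∈ Icc 0 T, l t = -(wx (p t) t + sourceTerm kx T p l (p t) t) := by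
  have hT := h.T_pos
  -- The weighted flux bound is a closed condition for the ordinary sup norm, so `S` is complete.
  let S : Set C(Icc (0 : ℝ) T, ℝ × ℝ) := {φ | ∀ t : Icc (0 : ℝ) T,
    (φ t).1 ∈ Icc (pI - δ) (pI + δ) ∧ |(φ t).2| * Real.sqrt t ≤ B}
  let P : C(Icc (0 : ℝ) T, ℝ × ℝ) → ℝ → ℝ := fun φ s => (IccExtend hT.le φ s).1
  let L : C(Icc (0 : ℝ) T, ℝ × ℝ) → ℝ → ℝ := fun φ s => (IccExtend hT.le φ s).2
  have hPe : ∀ φ (t : Icc (0 : ℝ) T), P φ t = (φ t).1 := fun φ t => by simp [P]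
  have hLe : ∀ φ (t : Icc (0 : ℝ) T), L φ t = (φ t).2 := fun φ t => by simp [L]
  have hadm : ∀ φ ∈ S, IsAdmissiblePair T δ pI B (P φ) (L φ) := fun φ hφ =>
    { continuous_p := continuous_fst.comp φ.continuous.Icc_extend'
      continuous_l := continuous_snd.comp φ.continuous.Icc_extend'
      mem := fun t ht => by rw [hPe φ ⟨t, ht⟩]; exact (hφ ⟨t, ht⟩).1
      bound := fun t ht => by rw [hLe φ ⟨t, ht⟩]; exact (hφ ⟨t, ht⟩).2 }
  have hnext : ∀ φ, φ ∈ S → ∃ ψ : C(Icc (0 : ℝ) T, ℝ × ℝ), ∀ t : Icc (0 : ℝ) T,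
      (ψ t).1 ∈ Icc (pI - δ) (pI + δ) ∧ |(ψ t).2| * Real.sqrt t ≤ B ∧
      w (ψ t).1 t + sourceTerm k T (P φ) (L φ) (ψ t).1 t = 0 ∧
      (ψ t).2 = -(wx (ψ t).1 t + sourceTerm kx T (P φ) (L φ) (ψ t).1 t) :=
    fun φ hφ => h.exists_next (hadm φ hφ)
  choose! F hF using hnext
  have hmaps : MapsTo F S S := fun φ hφ t => ⟨(hF φ hφ t).1, (hF φ hφ t).2.1⟩
  have hclosed : IsClosed S := by
    have : S = ⋂ t : Icc (0 : ℝ) T, {φ : C(Icc (0 : ℝ) T, ℝ × ℝ) |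
        (φ t).1 ∈ Icc (pI - δ) (pI + δ) ∧ |(φ t).2| * Real.sqrt t ≤ B} := by
      ext φ; simp [S]
    rw [this]
    refine isClosed_iInter fun t => ?_
    have c1 : Continuous fun φ : C(Icc (0 : ℝ) T, ℝ × ℝ) => (φ t).1 :=
      continuous_fst.comp (continuous_eval_const t)
    have c2 : Continuous fun φ : C(Icc (0 : ℝ) T, ℝ × ℝ) => (φ t).2 :=
      continuous_snd.comp (continuous_eval_const t)
    exact (isClosed_Icc.preimage c1).inter (isClosed_le (c2.abs.mul continuous_const)
      continuous_const)
  have hcontr : ContractingWith (1 / 2) (hmaps.restrict F S S) := by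
    refine ⟨by norm_num [← NNReal.coe_lt_coe], LipschitzWith.of_dist_le_mul ?_⟩
    rintro ⟨φ, hφ⟩ ⟨ψ, hψ⟩
    change dist (F φ) (F ψ) ≤ _ * dist φ ψ
    have hD : (0 : ℝ) ≤ dist φ ψ := dist_nonneg
    have hco : (((1 / 2 : NNReal)) : ℝ) = 1 / 2 := by norm_num
    rw [hco, ContinuousMap.dist_le (by positivity)]
    intro t
    have b : ∀ s : Icc (0 : ℝ) T, |(φ s).1 - (ψ s).1| ≤ dist φ ψ ∧
        |(φ s).2 - (ψ s).2| ≤ dist φ ψ := by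
      intro s
      have := ContinuousMap.dist_apply_le_dist (f := φ) (g := ψ) s
      rw [Prod.dist_eq] at this
      exact ⟨(le_max_left _ _).trans this, (le_max_right _ _).trans this⟩
    have := h.contract (hadm φ hφ) (hadm ψ hψ) hD
      (fun s hs => by rw [hPe φ ⟨s, hs⟩, hPe ψ ⟨s, hs⟩]; exact (b ⟨s, hs⟩).1)
      (fun s hs => by rw [hLe φ ⟨s, hs⟩, hLe ψ ⟨s, hs⟩]; exact (b ⟨s, hs⟩).2)
      t.2 (hF φ hφ t).1 (hF ψ hψ t).1 (hF φ hφ t).2.2.1 (hF ψ hψ t).2.2.1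
      (hF φ hφ t).2.2.2 (hF ψ hψ t).2.2.2
    rw [Prod.dist_eq]
    exact max_le this.1 this.2
  have hδ := h.δ_pos
  have h0 : ContinuousMap.const (Icc (0 : ℝ) T) (pI, (0 : ℝ)) ∈ S := by
    intro t
    simp only [ContinuousMap.const_apply, abs_zero, zero_mul]
    exact ⟨⟨by linarith, by linarith⟩, h.B_nonneg⟩
  obtain ⟨φ, hφ, hfix, -⟩ :=
    hcontr.exists_fixedPoint' hclosed.isComplete hmaps h0 (edist_ne_top _ _)
  have hfix' : F φ = φ := hfix
  refine ⟨P φ, L φ, hadm φ hφ, fun t ht => ?_, fun t ht => ?_⟩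
  · have := (hF φ hφ ⟨t, ht⟩).2.2.1
    rw [hfix'] at this
    rw [hPe φ ⟨t, ht⟩]
    exact this
  · have := (hF φ hφ ⟨t, ht⟩).2.2.2
    rw [hfix'] at this
    rw [hPe φ ⟨t, ht⟩, hLe φ ⟨t, ht⟩]
    exact this

end FixedPoint

/-! ### Gaussian averages: continuity at t = 0 and moment bounds -/

section GaussianAverage

open ProbabilityTheory

/-- The Gaussian measure with density `K(·,1)`. -/
noncomputable def stdMeasure : Measure ℝ := gaussianReal 0 2

instance : IsProbabilityMeasure stdMeasure := by unfold stdMeasure; infer_instance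

theorem integrable_sq_stdMeasure : Integrable (fun z : ℝ => z ^ 2) stdMeasure :=
  (memLp_id_gaussianReal (μ := 0) (v := 2) 2).integrable_sq

theorem integral_sq_stdMeasure : ∫ z, z ^ 2 ∂stdMeasure = 2 := by
  have h := variance_of_integral_eq_zero (X := fun x : ℝ => x) (μ := gaussianReal 0 2)
    (by fun_prop) integral_id_gaussianReal
  have h2 := variance_fun_id_gaussianReal (μ := 0) (v := 2)
  rw [h] at h2
  simpa [stdMeasure] using h2

theorem integrable_abs_stdMeasure : Integrable (fun z : ℝ => |z|) stdMeasure := by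
  refine ((integrable_const (1 : ℝ)).add integrable_sq_stdMeasure).mono' (by fun_prop)
    (ae_of_all _ fun z => ?_)
  simp only [Real.norm_eq_abs, abs_abs, Pi.add_apply]
  nlinarith [sq_nonneg (|z| - 1), sq_abs z, abs_nonneg z]

/-- From |z| ≤ (1 + z²)/2 and second moment 2. -/
theorem integral_abs_stdMeasure_le : ∫ z, |z| ∂stdMeasure ≤ 3 / 2 := by
  have h : ∫ z, |z| ∂stdMeasure ≤ ∫ z, (1 / 2 + 1 / 2 * z ^ 2) ∂stdMeasure := by
    refine integral_mono integrable_abs_stdMeasure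
      ((integrable_const _).add (integrable_sq_stdMeasure.const_mul _)) fun z => ?_
    simp only
    nlinarith [sq_nonneg (|z| - 1), sq_abs z]
  rw [integral_add (integrable_const _) (integrable_sq_stdMeasure.const_mul _),
    integral_const_mul, integral_sq_stdMeasure] at h
  simp only [integral_const, probReal_univ, smul_eq_mul] at h
  linarith

/-- K(·,t) is the Gaussian density of variance 2t, the law of √t·z for z of variance 2. In the
scaled variable the average makes sense at t = 0 and is jointly continuous there. -/
theorem integral_comp_sqrt_mul {t : ℝ} (ht : 0 < t) (h : ℝ → ℝ) :
    ∫ z, h (Real.sqrt t * z) ∂stdMeasure = ∫ z, heatKernel z t * h z := by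
  have hs : Real.sqrt t ≠ 0 := (Real.sqrt_pos.2 ht).ne'
  have hm : MeasurableEmbedding fun z : ℝ => Real.sqrt t * z :=
    (Homeomorph.mulLeft₀ _ hs).measurableEmbedding
  rw [← hm.integral_map (fun z => h z), stdMeasure, gaussianReal_map_const_mul,
    integral_gaussianReal_eq_integral_smul]
  · refine integral_congr_ae (ae_of_all _ fun z => ?_)
    have : Real.sqrt t ^ 2 = t := Real.sq_sqrt ht.le
    simp only [gaussianPDFReal, heatKernel, mul_zero, sub_zero, smul_eq_mul, NNReal.coe_mul,
      NNReal.coe_mk, NNReal.coe_ofNat, this, one_div]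
    congr 3
    · congr 1; ring
    · ring
  · simp [← NNReal.coe_ne_zero, hs]

theorem integrable_comp_sqrt_mul {t : ℝ} (ht : 0 < t) {h : ℝ → ℝ}
    (hi : Integrable (fun z => h (Real.sqrt t * z)) stdMeasure) :
    Integrable fun z => heatKernel z t * h z := by
  have hs : Real.sqrt t ≠ 0 := (Real.sqrt_pos.2 ht).ne'
  have hm : MeasurableEmbedding fun z : ℝ => Real.sqrt t * z :=
    (Homeomorph.mulLeft₀ _ hs).measurableEmbedding
  have h1 := (hm.integrable_map_iff (μ := stdMeasure) (g := h)).2 hi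
  rw [stdMeasure, gaussianReal_map_const_mul, gaussianReal_of_var_ne_zero,
    integrable_withDensity_iff_integrable_smul' (by fun_prop) (by simp [gaussianPDF])] at h1
  · refine h1.congr (ae_of_all _ fun z => ?_)
    have : Real.sqrt t ^ 2 = t := Real.sq_sqrt ht.le
    simp only [toReal_gaussianPDF, gaussianPDFReal, heatKernel, mul_zero, sub_zero, smul_eq_mul,
      NNReal.coe_mul, NNReal.coe_mk, NNReal.coe_ofNat, this, one_div]
    congr 3
    · congr 1; ring
    · ring
  · simp [← NNReal.coe_ne_zero, hs]

/-- The Gaussian average `∫ K(z,t) φ(z) F(x - z) dz` in the scaled variable `z = √t ζ`. -/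
noncomputable def gaussAvg (φ F : ℝ → ℝ) (x t : ℝ) : ℝ :=
  ∫ z, φ (Real.sqrt t * z) * F (x - Real.sqrt t * z) ∂stdMeasure

variable {φ F F' : ℝ → ℝ}

theorem integrable_of_abs_le {h : ℝ → ℝ} {B : ℝ} (hm : AEStronglyMeasurable h stdMeasure)
    (hB : ∀ z, |h z| ≤ B) : Integrable h stdMeasure :=
  Integrable.of_bound hm B (ae_of_all _ hB)

theorem continuous_gaussAvg {A B : ℝ} (hφ : Continuous φ) (hF : Continuous F)
    (hA : ∀ z, |φ z| ≤ A) (hB : ∀ z, |F z| ≤ B) :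
    Continuous fun q : ℝ × ℝ => gaussAvg φ F q.1 q.2 := by
  unfold gaussAvg
  refine continuous_of_dominated (bound := fun _ => A * B) (fun q => ?_)
    (fun q => ae_of_all _ fun z => ?_) (integrable_const _) (ae_of_all _ fun z => ?_)
  · exact Continuous.aestronglyMeasurable (by fun_prop)
  · rw [norm_mul]
    exact mul_le_mul (hA _) (hB _) (norm_nonneg _) ((abs_nonneg _).trans (hA 0))
  · fun_prop

theorem hasDerivAt_gaussAvg {A B B' : ℝ} (hφ : Continuous φ) (hF : Continuous F)
    (hF' : Continuous F') (hd : ∀ x, HasDerivAt F (F' x) x)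
    (hA : ∀ z, |φ z| ≤ A) (hB : ∀ z, |F z| ≤ B) (hB' : ∀ z, |F' z| ≤ B') (x t : ℝ) :
    HasDerivAt (fun x => gaussAvg φ F x t) (gaussAvg φ F' x t) x := by
  unfold gaussAvg
  refine (hasDerivAt_integral_of_dominated_loc_of_deriv_le (𝕜 := ℝ) (s := univ)
    (μ := stdMeasure) (F := fun x z => φ (Real.sqrt t * z) * F (x - Real.sqrt t * z))
    (F' := fun x z => φ (Real.sqrt t * z) * F' (x - Real.sqrt t * z))
    (bound := fun _ => A * B') univ_mem (Eventually.of_forall fun y => ?_) ?_ ?_ ?_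
    (integrable_const _) ?_).2
  · exact Continuous.aestronglyMeasurable (by fun_prop)
  · refine integrable_of_abs_le (B := A * B) (Continuous.aestronglyMeasurable (by fun_prop))
      fun z => ?_
    rw [abs_mul]
    exact mul_le_mul (hA _) (hB _) (abs_nonneg _) ((abs_nonneg _).trans (hA 0))
  · exact Continuous.aestronglyMeasurable (by fun_prop)
  · refine ae_of_all _ fun z y _ => ?_
    rw [norm_mul]
    exact mul_le_mul (hA _) (hB' _) (norm_nonneg _) ((abs_nonneg _).trans (hA 0))
  · exact ae_of_all _ fun z y _ =>
      ((hd (y - Real.sqrt t * z)).comp_sub_const y (Real.sqrt t * z)).const_mul _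

theorem gaussAvg_eq_integral {t : ℝ} (ht : 0 < t) (x : ℝ) :
    gaussAvg φ F x t = ∫ y, heatKernel (x - y) t * φ (x - y) * F y := by
  rw [gaussAvg, integral_comp_sqrt_mul ht (fun z => φ z * F (x - z)),
    ← integral_sub_left_eq_self _ _ x]
  simp only [sub_sub_cancel, mul_assoc]

theorem gaussAvg_zero (x : ℝ) : gaussAvg φ F x 0 = φ 0 * F x := by
  simp [gaussAvg]

/-- Total mass one and second moment 2t integrate the quadratic majorant. The bounds `A` and `B`
ensure integrability only and do not enter the estimate; this keeps it independent of sup|f_I'|. -/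
theorem gaussAvg_le {A B a b x t : ℝ} (hφ : Continuous φ) (hF : Continuous F)
    (hA : ∀ z, |φ z| ≤ A) (hB : ∀ z, |F z| ≤ B) (ht : 0 ≤ t)
    (h : ∀ z, φ z * F (x - z) ≤ a + b * z ^ 2) : gaussAvg φ F x t ≤ a + 2 * b * t := by
  have hi : Integrable (fun z => φ (Real.sqrt t * z) * F (x - Real.sqrt t * z)) stdMeasure := by
    refine integrable_of_abs_le (B := A * B) (Continuous.aestronglyMeasurable (by fun_prop))
      fun z => ?_
    rw [abs_mul]
    exact mul_le_mul (hA _) (hB _) (abs_nonneg _) ((abs_nonneg _).trans (hA 0))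
  have h1 : gaussAvg φ F x t ≤ ∫ z, (a + b * t * z ^ 2) ∂stdMeasure := by
    refine integral_mono hi ((integrable_const _).add (integrable_sq_stdMeasure.const_mul _))
      fun z => ?_
    refine (h _).trans (le_of_eq ?_)
    rw [mul_pow, Real.sq_sqrt ht]; ring
  rw [integral_add (integrable_const _) (integrable_sq_stdMeasure.const_mul _),
    integral_const_mul, integral_sq_stdMeasure] at h1
  simp only [integral_const, probReal_univ, smul_eq_mul] at h1
  linarith

theorem gaussAvg_neg (x t : ℝ) : gaussAvg φ (fun y => -F y) x t = -gaussAvg φ F x t := by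
  simp [gaussAvg, integral_neg]

theorem abs_gaussAvg_le {A L x t : ℝ}
    (hA : ∀ z, |φ z| ≤ A) (hL : ∀ z, |F (x - z)| ≤ L * |z|) :
    |gaussAvg φ F x t| ≤ 3 / 2 * A * L * Real.sqrt t := by
  have hA0 := (abs_nonneg _).trans (hA 0)
  have h1 : |gaussAvg φ F x t| ≤ ∫ z, A * L * Real.sqrt t * |z| ∂stdMeasure := by
    refine norm_integral_le_of_norm_le (μ := stdMeasure)
      (f := fun z => φ (Real.sqrt t * z) * F (x - Real.sqrt t * z))
      (integrable_abs_stdMeasure.const_mul _) (ae_of_all _ fun z => ?_)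
    rw [Real.norm_eq_abs, abs_mul]
    calc _ ≤ A * (L * |Real.sqrt t * z|) :=
          mul_le_mul (hA _) (hL _) (abs_nonneg _) hA0
      _ = A * L * Real.sqrt t * |z| := by
          rw [abs_mul, abs_of_nonneg (Real.sqrt_nonneg t)]; ring
  rw [integral_const_mul] at h1
  have hL0 : 0 ≤ L := by
    have := (abs_nonneg _).trans (hL 1)
    simpa using this
  have := mul_le_mul_of_nonneg_left integral_abs_stdMeasure_le
    (show 0 ≤ A * L * Real.sqrt t by positivity)
  linarith

end GaussianAverage

/-! ### Smoothing estimates with constants depending only on sup|F| -/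

section KernelDerivative

theorem abs_integral_mul_le {t M α β γ : ℝ} (ht : 0 < t) (hβ : 0 ≤ β)
    {F j : ℝ → ℝ} (hF : ∀ y, |F y| ≤ M)
    (hj : ∀ z, |j z| ≤ heatKernel z t * (α + β * |z| + γ * z ^ 2)) (x : ℝ) :
    |∫ y, F y * j (x - y)| ≤ M * (α + β * (Real.sqrt t * (3 / 2)) + γ * (2 * t)) := by
  have hM : 0 ≤ M := (abs_nonneg _).trans (hF 0)
  have hs : ∀ z : ℝ, |Real.sqrt t * z| = Real.sqrt t * |z| := fun z => by
    rw [abs_mul, abs_of_nonneg (Real.sqrt_nonneg t)]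
  have hs2 : ∀ z : ℝ, (Real.sqrt t * z) ^ 2 = t * z ^ 2 := fun z => by
    rw [mul_pow, Real.sq_sqrt ht.le]
  let h : ℝ → ℝ := fun z => α + β * |z| + γ * z ^ 2
  have e : (fun z => h (Real.sqrt t * z)) =
      fun z => α + β * Real.sqrt t * |z| + γ * t * z ^ 2 := by
    ext z
    simp only [h, hs, hs2]
    ring
  have i1 : Integrable (fun z : ℝ => α + β * Real.sqrt t * |z|) stdMeasure :=
    (integrable_const _).add (integrable_abs_stdMeasure.const_mul _)
  have i2 : Integrable (fun z : ℝ => γ * t * z ^ 2) stdMeasure :=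
    integrable_sq_stdMeasure.const_mul _
  have hi : Integrable (fun z => h (Real.sqrt t * z)) stdMeasure := by
    rw [e]; exact i1.add i2
  have hiK := integrable_comp_sqrt_mul ht hi
  have hb : ∫ z, heatKernel z t * h z ≤ α + β * (Real.sqrt t * (3 / 2)) + γ * (2 * t) := by
    rw [← integral_comp_sqrt_mul ht, e, integral_add i1 i2,
      integral_add (integrable_const _) (integrable_abs_stdMeasure.const_mul _),
      integral_const_mul, integral_const_mul, integral_sq_stdMeasure]
    simp only [integral_const, probReal_univ, smul_eq_mul]
    have := mul_le_mul_of_nonneg_left integral_abs_stdMeasure_le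
      (show 0 ≤ β * Real.sqrt t by positivity)
    linarith
  have h1 := norm_integral_le_of_norm_le (μ := volume) (f := fun y => F y * j (x - y))
    (g := fun y => M * (heatKernel (x - y) t * h (x - y)))
    ((hiK.comp_sub_left x).const_mul M) (ae_of_all _ fun y => by
      rw [Real.norm_eq_abs, abs_mul]
      exact mul_le_mul (hF y) (hj _) (abs_nonneg _) hM)
  refine h1.trans ?_
  rw [integral_const_mul, integral_sub_left_eq_self (fun z => heatKernel z t * h z) volume x]
  exact mul_le_mul_of_nonneg_left hb hM

theorem hasDerivAt_integral_mul_comp_sub {F k : ℝ → ℝ} (hF : Continuous F)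
    (hk : ContDiff ℝ 1 k) (hc : HasCompactSupport k) (x : ℝ) :
    HasDerivAt (fun x => ∫ y, F y * k (x - y)) (∫ y, F y * deriv k (x - y)) x :=
  HasCompactSupport.hasDerivAt_convolution_right (ContinuousLinearMap.mul ℝ ℝ)
    hF.locallyIntegrable hc hk x

/-- Both derivatives are placed on K·ψ, so only sup|F| enters: the first costs t^(-1/2), the second
1/t. The constant depends on ψ alone. Taking an arbitrary derivative `D` allows the bound to be
applied to the average of F' without a bound on F'. -/
theorem exists_deriv_gaussAvg_bound {ψ : ℝ → ℝ} (hψ : ContDiff ℝ ∞ ψ)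
    (hψc : HasCompactSupport ψ) (hψ1 : ∀ z, |ψ z| ≤ 1) :
    ∃ c : ℝ, 0 ≤ c ∧ ∀ (F D : ℝ → ℝ) (M t : ℝ), Continuous F → (∀ y, |F y| ≤ M) →
      t ∈ Ioc (0 : ℝ) 1 → (∀ x, HasDerivAt (fun x => gaussAvg ψ F x t) (D x) x) →
      (∀ x, |D x| * Real.sqrt t ≤ c * M) ∧ ∀ x x', t * |D x - D x'| ≤ c * M * |x - x'| := by
  have d1 : ContDiff ℝ ∞ (deriv ψ) := (contDiff_infty_iff_deriv.1 hψ).2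
  have d2 : ContDiff ℝ ∞ (deriv (deriv ψ)) := (contDiff_infty_iff_deriv.1 d1).2
  obtain ⟨C1, hC1⟩ := d1.continuous.bounded_above_of_compact_support hψc.deriv
  obtain ⟨C2, hC2⟩ := d2.continuous.bounded_above_of_compact_support hψc.deriv.deriv
  have hC1' : 0 ≤ C1 := (norm_nonneg _).trans (hC1 0)
  have hC2' : 0 ≤ C2 := (norm_nonneg _).trans (hC2 0)
  -- The two estimates require C1√t + 3/4 and 1 + C2·t + (3/2)C1√t, with t ≤ 1.
  refine ⟨1 + 3 * C1 + C2, by positivity, fun F D M t hF hM ht hD => ?_⟩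
  have hM0 : 0 ≤ M := (abs_nonneg _).trans (hM 0)
  have ht0 : 0 < t := ht.1
  have hst : 0 < Real.sqrt t := Real.sqrt_pos.2 ht0
  have hst1 : Real.sqrt t ≤ 1 := Real.sqrt_le_one.2 ht.2
  have hss : Real.sqrt t * Real.sqrt t = t := Real.mul_self_sqrt ht0.le
  let k : ℝ → ℝ := fun z => heatKernel z t * ψ z
  let k1 : ℝ → ℝ := fun z => -(z / (2 * t)) * heatKernel z t * ψ z + heatKernel z t * deriv ψ z
  let k2 : ℝ → ℝ := fun z => ((z ^ 2 / (4 * t ^ 2) - 1 / (2 * t)) * heatKernel z t) * ψ z +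
    (-(z / (2 * t)) * heatKernel z t) * deriv ψ z +
    ((-(z / (2 * t)) * heatKernel z t) * deriv ψ z + heatKernel z t * deriv (deriv ψ) z)
  have hψd : ∀ z, HasDerivAt ψ (deriv ψ z) z := fun z =>
    (hψ.differentiable (by simp) z).hasDerivAt
  have hψd2 : ∀ z, HasDerivAt (deriv ψ) (deriv (deriv ψ) z) z := fun z =>
    (d1.differentiable (by simp) z).hasDerivAt
  have hk1 : deriv k = k1 := funext fun z =>
    ((hasDerivAt_heatKernel_space z ht0).mul (hψd z)).deriv
  have hk2 : deriv k1 = k2 := funext fun z =>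
    (((hasDerivAt_heatKernel_space_two z ht0).mul (hψd z)).add
      ((hasDerivAt_heatKernel_space z ht0).mul (hψd2 z))).deriv
  have hK : ContDiff ℝ ∞ fun z => heatKernel z t := contDiff_iff_contDiffAt.2 fun z =>
    contDiffAt_heatKernel_comp contDiffAt_id contDiffAt_const (Or.inr ht0.ne')
  have hkc : ContDiff ℝ ∞ k := hK.mul hψ
  have hks : HasCompactSupport k := hψc.mul_left
  have hk1c : ContDiff ℝ ∞ k1 := hk1 ▸ (contDiff_infty_iff_deriv.1 hkc).2
  have hk1s : HasCompactSupport k1 := hk1 ▸ hks.deriv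
  have b0 : ∀ z, 0 ≤ heatKernel z t := fun z => heatKernel_nonneg z t
  have bz : ∀ z : ℝ, |-(z / (2 * t))| = 1 / (2 * t) * |z| := fun z => by
    rw [abs_neg, abs_div, abs_of_pos (by positivity : 0 < 2 * t)]; ring
  have bk1 : ∀ z, |k1 z| ≤ heatKernel z t * (C1 + 1 / (2 * t) * |z| + 0 * z ^ 2) := by
    intro z
    refine (abs_add_le _ _).trans ?_
    rw [abs_mul, abs_mul, abs_mul, bz, abs_of_nonneg (b0 z)]
    have h1 : 1 / (2 * t) * |z| * heatKernel z t * |ψ z| ≤ 1 / (2 * t) * |z| * heatKernel z t * 1 :=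
      mul_le_mul_of_nonneg_left (hψ1 z) (by have := b0 z; positivity)
    have h2 : heatKernel z t * |deriv ψ z| ≤ heatKernel z t * C1 :=
      mul_le_mul_of_nonneg_left (hC1 z) (b0 z)
    linarith
  have bk2 : ∀ z, |k2 z| ≤ heatKernel z t *
      ((1 / (2 * t) + C2) + C1 / t * |z| + 1 / (4 * t ^ 2) * z ^ 2) := by
    intro z
    have g1 : |((z ^ 2 / (4 * t ^ 2) - 1 / (2 * t)) * heatKernel z t) * ψ z| ≤
        (1 / (4 * t ^ 2) * z ^ 2 + 1 / (2 * t)) * heatKernel z t := by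
      rw [abs_mul, abs_mul, abs_of_nonneg (b0 z)]
      have : |z ^ 2 / (4 * t ^ 2) - 1 / (2 * t)| ≤ 1 / (4 * t ^ 2) * z ^ 2 + 1 / (2 * t) := by
        refine (abs_sub _ _).trans (le_of_eq ?_)
        rw [abs_of_nonneg (by positivity), abs_of_nonneg (by positivity)]
        ring
      calc _ ≤ (1 / (4 * t ^ 2) * z ^ 2 + 1 / (2 * t)) * heatKernel z t * 1 :=
            mul_le_mul (mul_le_mul_of_nonneg_right this (b0 z)) (hψ1 z) (abs_nonneg _)
              (mul_nonneg (by positivity) (b0 z))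
        _ = _ := mul_one _
    have g2 : |(-(z / (2 * t)) * heatKernel z t) * deriv ψ z| ≤
        1 / (2 * t) * |z| * heatKernel z t * C1 := by
      rw [abs_mul, abs_mul, bz, abs_of_nonneg (b0 z)]
      exact mul_le_mul_of_nonneg_left (hC1 z) (by have := b0 z; positivity)
    have g3 : |heatKernel z t * deriv (deriv ψ) z| ≤ heatKernel z t * C2 := by
      rw [abs_mul, abs_of_nonneg (b0 z)]
      exact mul_le_mul_of_nonneg_left (hC2 z) (b0 z)
    have g4 := abs_add_le (((z ^ 2 / (4 * t ^ 2) - 1 / (2 * t)) * heatKernel z t) * ψ z +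
      (-(z / (2 * t)) * heatKernel z t) * deriv ψ z)
      ((-(z / (2 * t)) * heatKernel z t) * deriv ψ z + heatKernel z t * deriv (deriv ψ) z)
    have g5 := abs_add_le (((z ^ 2 / (4 * t ^ 2) - 1 / (2 * t)) * heatKernel z t) * ψ z)
      ((-(z / (2 * t)) * heatKernel z t) * deriv ψ z)
    have g6 := abs_add_le ((-(z / (2 * t)) * heatKernel z t) * deriv ψ z)
      (heatKernel z t * deriv (deriv ψ) z)
    have e : heatKernel z t *
      ((1 / (2 * t) + C2) + C1 / t * |z| + 1 / (4 * t ^ 2) * z ^ 2) =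
      (1 / (4 * t ^ 2) * z ^ 2 + 1 / (2 * t)) * heatKernel z t +
      2 * (1 / (2 * t) * |z| * heatKernel z t * C1) + heatKernel z t * C2 := by
      field_simp; ring
    rw [e]
    change |(_ + _) + (_ + _)| ≤ _
    linarith
  have hA : ∀ x, gaussAvg ψ F x t = ∫ y, F y * k (x - y) := fun x => by
    rw [gaussAvg_eq_integral ht0]
    simp only [k, mul_comm]
  have hA1 : ∀ x, D x = ∫ y, F y * k1 (x - y) := fun x => by
    have h1 := hasDerivAt_integral_mul_comp_sub hF (hkc.of_le (by simp)) hks x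
    rw [hk1] at h1
    have h2 := hD x
    simp only [hA] at h2
    exact h2.unique h1
  constructor
  · intro x
    have h1 := abs_integral_mul_le ht0 (by positivity) hM bk1 x
    rw [← hA1] at h1
    have h2 : M * (C1 + 1 / (2 * t) * (Real.sqrt t * (3 / 2)) + 0 * (2 * t)) * Real.sqrt t =
        M * (C1 * Real.sqrt t + 3 / 4) := by
      have : 1 / (2 * t) * (Real.sqrt t * (3 / 2)) * Real.sqrt t = 3 / 4 := by
        calc _ = 1 / (2 * t) * (3 / 2) * (Real.sqrt t * Real.sqrt t) := by ring
          _ = 3 / 4 := by rw [hss]; field_simp; norm_num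
      linear_combination M * this
    have h3 := mul_le_mul_of_nonneg_right h1 hst.le
    rw [h2] at h3
    refine h3.trans ?_
    rw [mul_comm]
    refine mul_le_mul_of_nonneg_right ?_ hM0
    nlinarith
  · intro x x'
    have h0 : ∀ x, HasDerivAt D (∫ y, F y * k2 (x - y)) x := fun x => by
      have h1 := hasDerivAt_integral_mul_comp_sub hF (hk1c.of_le (by simp)) hk1s x
      rw [hk2] at h1
      have : D = fun x => ∫ y, F y * k1 (x - y) := funext hA1
      rw [this]
      exact h1
    have h1 : ∀ x, |∫ y, F y * k2 (x - y)| ≤ M * ((1 / (2 * t) + C2) +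
        C1 / t * (Real.sqrt t * (3 / 2)) + 1 / (4 * t ^ 2) * (2 * t)) := fun x =>
      abs_integral_mul_le ht0 (by positivity) hM bk2 x
    have h2 := abs_sub_le_of_hasDerivAt h0 h1 x x'
    have h3 := mul_le_mul_of_nonneg_left h2 ht0.le
    refine h3.trans ?_
    rw [← mul_assoc]
    refine mul_le_mul_of_nonneg_right ?_ (abs_nonneg _)
    have h4 : t * (M * ((1 / (2 * t) + C2) +
        C1 / t * (Real.sqrt t * (3 / 2)) + 1 / (4 * t ^ 2) * (2 * t))) =
        M * (1 + C2 * t + 3 / 2 * C1 * Real.sqrt t) := by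
      field_simp
      ring
    rw [h4, mul_comm]
    refine mul_le_mul_of_nonneg_right ?_ hM0
    nlinarith [ht.2]

end KernelDerivative

/-! ### Consequences of admissibility and localization of the data -/

section InitialData

variable {a₀ M : ℝ} {fI : ℝ → ℝ} {pI : ℝ}

/-- Otherwise the end point 1 would be within a₀ of p_I, and the strict steepness there contradicts
f_I'(1) = 0. -/
theorem InitialData.add_le (h : InitialData a₀ fI pI) : pI + a₀ ≤ 1 := by
  by_contra hc
  have h1 := h.steep 1 ⟨by norm_num, le_rfl⟩ (by
    rw [abs_lt]; constructor <;> linarith [h.mem.2])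
  rw [h.neumann_right] at h1
  linarith [h.flux_pos]

theorem InitialData.le_sub (h : InitialData a₀ fI pI) : -1 ≤ pI - a₀ := by
  by_contra hc
  have h1 := h.steep (-1) ⟨le_rfl, by norm_num⟩ (by
    rw [abs_lt]; constructor <;> linarith [h.mem.1])
  rw [h.neumann_left] at h1
  linarith [h.flux_pos]

theorem InitialData.hasDerivAt (h : InitialData a₀ fI pI) {x : ℝ} (hx : x ∈ Ioo (-1 : ℝ) 1) :
    HasDerivAt fI (derivWithin fI (Icc (-1) 1) x) x :=
  ((h.contDiffOn.differentiableOn (by simp) x ⟨hx.1.le, hx.2.le⟩).hasDerivWithinAt).hasDerivAt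
    (Icc_mem_nhds hx.1 hx.2)

theorem InitialData.le_of_right (h : InitialData a₀ fI pI) {x : ℝ} (h1 : pI ≤ x)
    (h2 : x < pI + a₀) : fI x ≤ -(initialFlux fI pI / 2) * (x - pI) := by
  have h3 := h.add_le
  have h4 := h.mem
  have := (convex_Icc pI x).image_sub_le_mul_sub_of_deriv_le (f := fI)
    (C := -(initialFlux fI pI / 2))
    (h.contDiffOn.continuousOn.mono (Icc_subset_Icc h4.1 (by linarith))) (fun z hz => by
      rw [interior_Icc] at hz
      exact (h.hasDerivAt ⟨by linarith [hz.1, h4.1], by linarith [hz.2]⟩).differentiableAt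
        |>.differentiableWithinAt)
    (fun z hz => by
      rw [interior_Icc] at hz
      rw [(h.hasDerivAt ⟨by linarith [hz.1, h4.1], by linarith [hz.2]⟩).deriv]
      have := h.steep z ⟨by linarith [hz.1, h4.1], by linarith [hz.2]⟩
        (by rw [abs_lt]; constructor <;> linarith [hz.1, hz.2])
      linarith) pI (left_mem_Icc.2 h1) x (right_mem_Icc.2 h1) h1
  rw [h.zero] at this
  linarith

theorem InitialData.le_of_left (h : InitialData a₀ fI pI) {x : ℝ} (h1 : x ≤ pI)
    (h2 : pI - a₀ < x) : initialFlux fI pI / 2 * (pI - x) ≤ fI x := by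
  have h3 := h.le_sub
  have h4 := h.mem
  have := (convex_Icc x pI).image_sub_le_mul_sub_of_deriv_le (f := fI)
    (C := -(initialFlux fI pI / 2))
    (h.contDiffOn.continuousOn.mono (Icc_subset_Icc (by linarith) h4.2)) (fun z hz => by
      rw [interior_Icc] at hz
      exact (h.hasDerivAt ⟨by linarith [hz.1], by linarith [hz.2, h4.2]⟩).differentiableAt
        |>.differentiableWithinAt)
    (fun z hz => by
      rw [interior_Icc] at hz
      rw [(h.hasDerivAt ⟨by linarith [hz.1], by linarith [hz.2, h4.2]⟩).deriv]
      have := h.steep z ⟨by linarith [hz.1], by linarith [hz.2, h4.2]⟩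
        (by rw [abs_lt]; constructor <;> linarith [hz.1, hz.2])
      linarith) x (left_mem_Icc.2 h1) pI (right_mem_Icc.2 h1) h1
  rw [h.zero] at this
  linarith

/-- The support lies within 7δ < a₀ of p_I, hence inside (-1,1), where f_I is twice continuously
differentiable. The sup bound survives the cutoff. -/
theorem InitialData.exists_localization (h : InitialData a₀ fI pI) {δ : ℝ} (hδ : 0 < δ)
    (hδa : 8 * δ = a₀) (hM : ∀ x ∈ Icc (-1 : ℝ) 1, |fI x| ≤ M) :
    ∃ F : ℝ → ℝ, ContDiff ℝ 2 F ∧ HasCompactSupport F ∧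
      EqOn F fI (Icc (pI - 6 * δ) (pI + 6 * δ)) ∧ ∀ x, |F x| ≤ M := by
  have h1 := h.add_le
  have h2 := h.le_sub
  obtain ⟨F, hF, hc, he, hb, hz⟩ := exists_contDiff_hasCompactSupport_eqOn (n := 2) (g := fI)
    (isCompact_Icc (a := pI - 6 * δ) (b := pI + 6 * δ))
    (isOpen_Ioo (a := pI - 7 * δ) (b := pI + 7 * δ))
    (Icc_subset_Ioo (by linarith) (by linarith)) (fun x hx => by
      have := h.contDiffOn.contDiffAt (x := x)
        (Icc_mem_nhds (by linarith [hx.1]) (by linarith [hx.2]))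
      exact_mod_cast this)
  refine ⟨F, by exact_mod_cast hF, hc, he, fun x => ?_⟩
  have hM0 : 0 ≤ M := (abs_nonneg _).trans (hM pI h.mem)
  by_cases hx : x ∈ Ioo (pI - 7 * δ) (pI + 7 * δ)
  · exact (hb x).trans (hM x ⟨by linarith [hx.1], by linarith [hx.2]⟩)
  · rw [hz x hx, abs_zero]; exact hM0

end InitialData

/-! ### Initial data seen through the regular kernel -/

section RegularPart

/-- The contribution of the initial data through the regular kernel `N`. -/
noncomputable def regularPart (N : ℝ × ℝ × ℝ → ℝ) (g : ℝ → ℝ) (x t : ℝ) : ℝ :=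
  ∫ y in (-1 : ℝ)..1, N (x, y, t) * g y

variable {N : ℝ × ℝ × ℝ → ℝ} {g : ℝ → ℝ} {M C : ℝ}

theorem continuous_regularPart (hN : Continuous N) (hg : Continuous g) :
    Continuous fun q : ℝ × ℝ => regularPart N g q.1 q.2 := by
  unfold regularPart
  refine intervalIntegral.continuous_parametric_intervalIntegral_of_continuous'
    (f := fun (q : ℝ × ℝ) y => N (q.1, y, q.2) * g y) ?_ (-1) 1
  exact (hN.comp (by fun_prop : Continuous fun z : (ℝ × ℝ) × ℝ => (z.1.1, z.2, z.1.2))).mul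
    (hg.comp continuous_snd)

theorem abs_integral_mul_le_const {j : ℝ → ℝ} {A : ℝ} (hA : 0 ≤ A) (hj : ∀ y, |j y| ≤ A)
    (hM : ∀ y, |g y| ≤ M) : |∫ y in (-1 : ℝ)..1, j y * g y| ≤ 2 * A * M := by
  have := intervalIntegral.norm_integral_le_of_norm_le_const (a := -1) (b := 1)
    (f := fun y => j y * g y) (C := A * M) (fun y _ => by
      rw [norm_mul]; exact mul_le_mul (hj y) (hM y) (norm_nonneg _) hA)
  refine this.trans (le_of_eq ?_)
  norm_num
  ring

theorem abs_regularPart_le (hb : ∀ x y t, 0 ≤ t → |N (x, y, t)| ≤ C * t) (hC : 0 ≤ C)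
    (hM : ∀ y, |g y| ≤ M) (x : ℝ) {t : ℝ} (ht : 0 ≤ t) :
    |regularPart N g x t| ≤ 2 * (C * t) * M :=
  abs_integral_mul_le_const (mul_nonneg hC ht) (fun y => hb x y t ht) hM

theorem abs_regularPart_sub_le (hN : Continuous N) (hg : Continuous g)
    (hb : ∀ x z y t, 0 ≤ t → |N (x, y, t) - N (z, y, t)| ≤ C * t * |x - z|) (hC : 0 ≤ C)
    (hM : ∀ y, |g y| ≤ M) (x z : ℝ) {t : ℝ} (ht : 0 ≤ t) :
    |regularPart N g x t - regularPart N g z t| ≤ 2 * (C * t * |x - z|) * M := by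
  have hi : ∀ x, IntervalIntegrable (fun y => N (x, y, t) * g y) volume (-1) 1 := fun x =>
    Continuous.intervalIntegrable (by fun_prop) _ _
  unfold regularPart
  rw [← intervalIntegral.integral_sub (hi x) (hi z)]
  simp only [← sub_mul]
  exact abs_integral_mul_le_const (by positivity) (fun y => hb x z y t ht) hM

theorem hasDerivAt_regularPart (hN : IsCausalKernel N) (hg : Continuous g) {C : ℝ}
    (hb : ∀ x y t, 0 ≤ t → |fderiv ℝ N (x, y, t) (1, 0, 0)| ≤ C * t) (x : ℝ) {t : ℝ}
    (ht : 0 ≤ t) :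
    HasDerivAt (fun x => regularPart N g x t)
      (regularPart (fun q => fderiv ℝ N q (1, 0, 0)) g x t) x := by
  have c1 := hN.contDiff.continuous
  have c2 := hN.fderiv_fst.contDiff.continuous
  unfold regularPart
  refine (intervalIntegral.hasDerivAt_integral_of_dominated_loc_of_deriv_le (𝕜 := ℝ)
    (F := fun x y => N (x, y, t) * g y) (F' := fun x y => fderiv ℝ N (x, y, t) (1, 0, 0) * g y)
    (s := univ) (bound := fun y => C * t * |g y|) univ_mem ?_ ?_ ?_ ?_ ?_ ?_).2
  · exact Eventually.of_forall fun y => Continuous.aestronglyMeasurable (by fun_prop)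
  · exact Continuous.intervalIntegrable (by fun_prop) _ _
  · refine Continuous.aestronglyMeasurable ?_
    exact (c2.comp (by fun_prop : Continuous fun y : ℝ => (x, y, t))).mul hg
  · refine ae_of_all _ fun y _ z _ => ?_
    rw [norm_mul]
    exact mul_le_mul_of_nonneg_right (hb z y t ht) (norm_nonneg _)
  · exact (continuous_const.mul hg.abs).intervalIntegrable _ _
  · exact ae_of_all _ fun y _ z _ => (hN.hasDerivAt_fst z y t).mul_const _

end RegularPart

/-! ### The dipole of source and sink as a small kernel -/

section SourceKernel

theorem abs_sourceDist_sub_le (a p q : ℝ) : |sourceDist a p - sourceDist a q| ≤ |p - q| := by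
  unfold sourceDist
  have h1 : ∀ c : ℝ, |(|p - c| - |q - c|)| ≤ |p - q| := fun c => by
    have := abs_abs_sub_abs_le_abs_sub (p - c) (q - c)
    simpa using this
  have h2 := h1 1
  have h3 := h1 (-1)
  rw [sub_neg_eq_add, sub_neg_eq_add] at h3
  have h4 := abs_min_sub_min_le_max |p - 1| |p + 1| |q - 1| |q + 1|
  have h5 := abs_min_sub_min_le_max a (min |p - 1| |p + 1|) a (min |q - 1| |q + 1|)
  refine h5.trans (max_le ?_ (h4.trans (max_le h2 h3)))
  simp

theorem continuous_sourceDist (a : ℝ) : Continuous (sourceDist a) := by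
  unfold sourceDist; fun_prop

/-- The kernel of the source term: the source at `q - d(q)` minus the sink at `q + d(q)`. -/
noncomputable def dipoleKernel (a : ℝ) (N : ℝ × ℝ × ℝ → ℝ) (x q τ : ℝ) : ℝ :=
  N (x, q - sourceDist a q, τ) - N (x, q + sourceDist a q, τ)

/-- The distance function is 1-Lipschitz, so both positions q ± d(q) are 2-Lipschitz in q; two terms
with factor 2 give 4C. -/
theorem isSmallKernel_dipoleKernel {N : ℝ × ℝ × ℝ → ℝ} (hN : IsCausalKernel N) (a : ℝ)
    {C : ℝ} (hC : 0 ≤ C)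
    (hb : ∀ x y t, 0 ≤ t → |N (x, y, t)| ≤ C * t)
    (hl : ∀ x y z t, 0 ≤ t → |N (x, y, t) - N (x, z, t)| ≤ C * t * |y - z|) :
    IsSmallKernel (dipoleKernel a N) (4 * C) where
  nonneg := by positivity
  continuous := by
    have c1 := hN.contDiff.continuous
    have c2 := continuous_sourceDist a
    unfold dipoleKernel
    fun_prop
  zero := fun x p τ h => by simp [dipoleKernel, hN.zero _ _ _ h]
  bound := fun x p τ h => by
    refine (abs_sub _ _).trans ?_
    have h1 := hb x (p - sourceDist a p) τ h
    have h2 := hb x (p + sourceDist a p) τ h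
    have := mul_nonneg hC h
    linarith
  lipschitz := fun x p q τ h => by
    unfold dipoleKernel
    have h0 := abs_le.1 (abs_sourceDist_sub_le a p q)
    have h1 := hl x (p - sourceDist a p) (q - sourceDist a q) τ h
    have h2 := hl x (p + sourceDist a p) (q + sourceDist a q) τ h
    have h3 : |p - sourceDist a p - (q - sourceDist a q)| ≤ 2 * |p - q| := by
      rw [abs_le]
      constructor <;> linarith [neg_abs_le (p - q), le_abs_self (p - q)]
    have h4 : |p + sourceDist a p - (q + sourceDist a q)| ≤ 2 * |p - q| := by
      rw [abs_le]
      constructor <;> linarith [neg_abs_le (p - q), le_abs_self (p - q)]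
    have hCt := mul_nonneg hC h
    have h5 := mul_le_mul_of_nonneg_left h3 hCt
    have h6 := mul_le_mul_of_nonneg_left h4 hCt
    have e : N (x, p - sourceDist a p, τ) - N (x, p + sourceDist a p, τ) -
        (N (x, q - sourceDist a q, τ) - N (x, q + sourceDist a q, τ)) =
        (N (x, p - sourceDist a p, τ) - N (x, q - sourceDist a q, τ)) -
        (N (x, p + sourceDist a p, τ) - N (x, q + sourceDist a q, τ)) := by ring
    rw [e]
    refine (abs_sub _ _).trans ?_
    linarith

theorem dipoleKernel_lipschitz_fst {N : ℝ × ℝ × ℝ → ℝ} (a : ℝ) {C : ℝ} (hC : 0 ≤ C)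
    (hl : ∀ x z y t, 0 ≤ t → |N (x, y, t) - N (z, y, t)| ≤ C * t * |x - z|)
    (x z q : ℝ) {τ : ℝ} (h : 0 ≤ τ) :
    |dipoleKernel a N x q τ - dipoleKernel a N z q τ| ≤ 4 * C * τ * |x - z| := by
  unfold dipoleKernel
  have h1 := hl x z (q - sourceDist a q) τ h
  have h2 := hl x z (q + sourceDist a q) τ h
  have e : N (x, q - sourceDist a q, τ) - N (x, q + sourceDist a q, τ) -
      (N (z, q - sourceDist a q, τ) - N (z, q + sourceDist a q, τ)) =
      (N (x, q - sourceDist a q, τ) - N (z, q - sourceDist a q, τ)) -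
      (N (x, q + sourceDist a q, τ) - N (z, q + sourceDist a q, τ)) := by ring
  rw [e]
  refine (abs_sub _ _).trans ?_
  have := mul_nonneg (mul_nonneg hC h) (abs_nonneg (x - z))
  linarith

theorem hasDerivAt_dipoleKernel {N : ℝ × ℝ × ℝ → ℝ} (hN : IsCausalKernel N) (a x q τ : ℝ) :
    HasDerivAt (fun x => dipoleKernel a N x q τ)
      (dipoleKernel a (fun q => fderiv ℝ N q (1, 0, 0)) x q τ) x :=
  (hN.hasDerivAt_fst _ _ _).sub (hN.hasDerivAt_fst _ _ _)

end SourceKernel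

/-! ### Choice of the time and bounds on the sourceless solution -/

section LocalSolution

/-- At T = 0 the four inequalities hold strictly, and both sides are continuous in T. These are
precisely the requirements of `FixedPointData`, with κ = λ/4 and B = cM + 1, so T depends on δ, λ, M
and kernel constants only. -/
theorem exists_small_time {δ lam M C c : ℝ} (hδ : 0 < δ) (hlam : 0 < lam) :
    ∃ T : ℝ, 0 < T ∧ T ≤ 1 ∧
      -(lam / 2) + lam / δ ^ 2 * T + 2 * (C * T) * M
        ≤ -(lam / 4 + 4 * C * T * (c * M + 1) * (2 * Real.sqrt T)) ∧
      -(lam * δ / 4) + 2 * ((M + lam * δ / 4) * (4 / δ ^ 2)) * T + 2 * (C * T) * M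
        ≤ -(4 * C * T * (c * M + 1) * (2 * Real.sqrt T) + lam * δ / 16) ∧
      2 * (C * T) * M * Real.sqrt T + 4 * C * T * (c * M + 1) * (2 * Real.sqrt T) * Real.sqrt T
        ≤ 1 ∧
      4 * C * (T + 2 * (c * M + 1) * Real.sqrt T) *
        (T + ((c * M + 2 * C * M) + T * (4 * C * T * (c * M + 1) * (2 * Real.sqrt T))) / (lam / 4)
          + T / (lam / 4)) ≤ 1 / 2 := by
  have key : ∀ {f g : ℝ → ℝ}, Continuous f → Continuous g → f 0 < g 0 →
      ∀ᶠ T in 𝓝[>] (0 : ℝ), f T ≤ g T := fun hf hg h0 =>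
    ((hf.continuousAt.eventually_lt hg.continuousAt h0).filter_mono nhdsWithin_le_nhds).mono
      fun _ h => h.le
  have hlδ := mul_pos hlam hδ
  have h1 : ∀ᶠ T in 𝓝[>] (0 : ℝ), T ≤ 1 := key continuous_id continuous_const (by norm_num)
  have h2 : ∀ᶠ T in 𝓝[>] (0 : ℝ), -(lam / 2) + lam / δ ^ 2 * T + 2 * (C * T) * M
        ≤ -(lam / 4 + 4 * C * T * (c * M + 1) * (2 * Real.sqrt T)) :=
    key (by fun_prop) (by fun_prop) (by simp; linarith)
  have h3 : ∀ᶠ T in 𝓝[>] (0 : ℝ),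
      -(lam * δ / 4) + 2 * ((M + lam * δ / 4) * (4 / δ ^ 2)) * T + 2 * (C * T) * M
        ≤ -(4 * C * T * (c * M + 1) * (2 * Real.sqrt T) + lam * δ / 16) :=
    key (by fun_prop) (by fun_prop) (by simp; linarith)
  have h4 : ∀ᶠ T in 𝓝[>] (0 : ℝ), 2 * (C * T) * M * Real.sqrt T +
      4 * C * T * (c * M + 1) * (2 * Real.sqrt T) * Real.sqrt T ≤ 1 :=
    key (by fun_prop) (by fun_prop) (by simp)
  have h5 : ∀ᶠ T in 𝓝[>] (0 : ℝ), 4 * C * (T + 2 * (c * M + 1) * Real.sqrt T) *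
        (T + ((c * M + 2 * C * M) + T * (4 * C * T * (c * M + 1) * (2 * Real.sqrt T))) / (lam / 4)
          + T / (lam / 4)) ≤ 1 / 2 :=
    key (by fun_prop) (by fun_prop) (by simp)
  obtain ⟨T, a1, a2, a3, a4, a5, a6⟩ :=
    (h1.and (h2.and (h3.and (h4.and (h5.and self_mem_nhdsWithin))))).exists
  exact ⟨T, a6, a1, a2, a3, a4, a5⟩

/-- The evolution of the initial data by the Neumann heat semigroup. -/
noncomputable def initialPart (fI : ℝ → ℝ) (x t : ℝ) : ℝ :=
  ∫ y in (-1 : ℝ)..1, neumannKernel x y t * fI y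

/-- The solution generated by a source at `q(s)` of strength `l(s)`, `0 ≤ s ≤ T`. -/
noncomputable def sourcePart (T : ℝ) (q l : ℝ → ℝ) (x t : ℝ) : ℝ :=
  ∫ s in (0 : ℝ)..T, neumannKernel x (q s) (t - s) * l s

/-- The right hand side of Duhamel's formula. -/
noncomputable def duhamelSum (a T : ℝ) (fI : ℝ → ℝ) (p l : ℝ → ℝ) (x t : ℝ) : ℝ :=
  initialPart fI x t + (sourcePart T (fun s => p s - sourceDist a (p s)) l x t
    - sourcePart T (fun s => p s + sourceDist a (p s)) l x t)

/-- A free boundary and its flux solving the free boundary problem near the initial free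
boundary. -/
structure LocalSolution (a T δ lam : ℝ) (fI : ℝ → ℝ) (pI : ℝ) (p l : ℝ → ℝ) : Prop where
  continuous_p : Continuous p
  continuous_l : Continuous l
  mem : ∀ t ∈ Icc 0 T, p t ∈ Icc (pI - δ) (pI + δ)
  flux_ge : ∀ t ∈ Icc 0 T, lam / 4 ≤ l t
  p_zero : p 0 = pI
  l_zero : l 0 = lam
  zero : ∀ t ∈ Ioc 0 T, duhamelSum a T fI p l (p t) t = 0
  hasDerivAt : ∀ t ∈ Ioc 0 T, HasDerivAt (fun x => duhamelSum a T fI p l x t) (-(l t)) (p t)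
  decreasing : ∀ t ∈ Ioc 0 T, ∀ x ∈ Icc (pI - δ) (pI + δ), ∀ y ∈ Icc (pI - δ) (pI + δ), x ≤ y →
    lam / 4 * (y - x) ≤ duhamelSum a T fI p l x t - duhamelSum a T fI p l y t
  left : ∀ t ∈ Ioc 0 T, lam * δ / 16 ≤ duhamelSum a T fI p l (pI - δ) t
  right : ∀ t ∈ Ioc 0 T, duhamelSum a T fI p l (pI + δ) t ≤ -(lam * δ / 16)
  sqrt_bound : ∃ c, 0 < c ∧ ∀ t ∈ Icc 0 T, |p t - pI| ≤ c * Real.sqrt t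

/-- Both end points are at distance at least a₀ = 8δ from p_I, and p has moved by at most δ. -/
theorem le_sourceDist {a a₀ δ pI p : ℝ} (hδ : 0 < δ) (hδa : 8 * δ = a₀) (ha : a₀ ≤ a)
    (h1 : pI + a₀ ≤ 1) (h2 : -1 ≤ pI - a₀) (hp : p ∈ Icc (pI - δ) (pI + δ)) :
    7 * δ ≤ sourceDist a p := by
  refine le_min (by linarith) (le_min ?_ ?_)
  · rw [abs_sub_comm]
    exact le_trans (by linarith [hp.2]) (le_abs_self _)
  · exact le_trans (by linarith [hp.1]) (le_abs_self _)

theorem source_mem {a p : ℝ} (hp : p ∈ Icc (-1 : ℝ) 1) (ha : 0 < a) :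
    p - sourceDist a p ∈ Icc (-1 : ℝ) 1 ∧ p + sourceDist a p ∈ Icc (-1 : ℝ) 1 := by
  have h0 : 0 ≤ sourceDist a p := le_min ha.le (le_min (abs_nonneg _) (abs_nonneg _))
  have h1 : sourceDist a p ≤ 1 - p := by
    refine (min_le_right _ _).trans ((min_le_left _ _).trans (le_of_eq ?_))
    rw [abs_sub_comm, abs_of_nonneg (by linarith [hp.2])]
  have h2 : sourceDist a p ≤ p + 1 := by
    refine (min_le_right _ _).trans ((min_le_right _ _).trans (le_of_eq ?_))
    rw [abs_of_nonneg (by linarith [hp.1])]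
  exact ⟨⟨by linarith, by linarith [hp.2]⟩, ⟨by linarith [hp.1], by linarith⟩⟩

variable {a₀ M δ : ℝ} {fI : ℝ → ℝ} {pI : ℝ}

/-- Properties of the localized initial data `F` needed for the estimates near the free
boundary. -/
structure Localization (a₀ M δ : ℝ) (fI : ℝ → ℝ) (pI : ℝ) (F : ℝ → ℝ) : Prop where
  data : InitialData a₀ fI pI
  δ_pos : 0 < δ
  eight : 8 * δ = a₀
  contDiff : ContDiff ℝ 2 F
  compact : HasCompactSupport F
  eqOn : EqOn F fI (Icc (pI - 6 * δ) (pI + 6 * δ))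
  bound' : ∀ x, |F x| ≤ M

theorem abs_cutoff_le (hδ : 0 < δ) (z : ℝ) : |cutoff δ hδ z| ≤ 1 := by
  rw [abs_of_nonneg (cutoff δ hδ).nonneg]; exact (cutoff δ hδ).le_one

theorem cutoff_eq_one (hδ : 0 < δ) {z : ℝ} (hz : |z| ≤ δ) : cutoff δ hδ z = 1 :=
  (cutoff δ hδ).one_of_mem_closedBall (by simpa [cutoff, Real.dist_eq] using hz)

theorem cutoff_eq_zero (hδ : 0 < δ) {z : ℝ} (hz : 2 * δ ≤ |z|) : cutoff δ hδ z = 0 :=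
  (cutoff δ hδ).zero_of_le_dist (by simpa [cutoff, Real.dist_eq] using hz)

variable {F : ℝ → ℝ}

theorem Localization.hasDerivAt (h : Localization a₀ M δ fI pI F) (x : ℝ) :
    HasDerivAt F (deriv F x) x := (h.contDiff.differentiable (by simp) x).hasDerivAt

theorem Localization.deriv_eq (h : Localization a₀ M δ fI pI F) {x : ℝ}
    (hx : |x - pI| < 6 * δ) : deriv F x = derivWithin fI (Icc (-1) 1) x := by
  have h1 := h.data.add_le
  have h2 := h.data.le_sub
  have h3 := abs_lt.1 hx
  have := h.eight
  have := h.δ_pos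
  have e : F =ᶠ[𝓝 x] fI := by
    filter_upwards [Ioo_mem_nhds (a := pI - 6 * δ) (b := pI + 6 * δ) (by linarith) (by linarith)]
      with y hy
    exact h.eqOn ⟨hy.1.le, hy.2.le⟩
  rw [e.deriv_eq]
  exact (h.data.hasDerivAt ⟨by linarith, by linarith⟩).deriv

theorem Localization.continuous_deriv (h : Localization a₀ M δ fI pI F) :
    Continuous (deriv F) := h.contDiff.continuous_deriv (by norm_num)

theorem Localization.exists_deriv_bound (h : Localization a₀ M δ fI pI F) :
    ∃ L, ∀ x, |deriv F x| ≤ L :=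
  h.continuous_deriv.bounded_above_of_compact_support h.compact.deriv

/-- On the support of the cutoff, x - z is within 3δ of p_I, where F' ≤ -λ/2; with ψ(z) ≥ 1 - (z/δ)²
this gives the majorant -λ/2 + (λ/2)(z/δ)² for ψ(z)F'(x-z), whatever the size of F'. -/
theorem Localization.gaussAvg_deriv_le (h : Localization a₀ M δ fI pI F) {x t : ℝ} (ht : 0 ≤ t)
    (hx : x ∈ Icc (pI - δ) (pI + δ)) :
    gaussAvg (cutoff δ h.δ_pos) (deriv F) x t
      ≤ -(initialFlux fI pI / 2) + initialFlux fI pI / δ ^ 2 * t := by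
  obtain ⟨L, hL⟩ := h.exists_deriv_bound
  have hδ := h.δ_pos
  have hl := h.data.flux_pos
  set lam := initialFlux fI pI with hlam
  refine (gaussAvg_le (a := -(lam / 2)) (b := lam / 2 / δ ^ 2) (cutoff δ h.δ_pos).continuous
    h.continuous_deriv (abs_cutoff_le h.δ_pos) hL ht fun z => ?_).trans (le_of_eq (by ring))
  have hb : lam / 2 / δ ^ 2 * z ^ 2 = lam / 2 * (|z| / δ) ^ 2 := by
    rw [div_pow, sq_abs]; ring
  rw [hb]
  have hu0 : 0 ≤ |z| / δ := by positivity
  rcases lt_or_ge |z| (2 * δ) with hz | hz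
  · have hz' := abs_lt.1 hz
    have h1 : |x - z - pI| < 6 * δ := by
      rw [abs_lt]; constructor <;> linarith [hx.1, hx.2]
    have h2 := h.data.steep (x - z) ⟨by
        have := h.data.le_sub; have := h.eight; linarith [hx.1], by
        have := h.data.add_le; have := h.eight; linarith [hx.2]⟩
      (by have := h.eight; linarith)
    rw [h.deriv_eq h1]
    have h3 : derivWithin fI (Icc (-1) 1) (x - z) ≤ -(lam / 2) := by linarith
    have h4 : 1 - (|z| / δ) ^ 2 ≤ cutoff δ h.δ_pos z := by
      rcases le_or_gt |z| δ with h5 | h5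
      · rw [cutoff_eq_one h.δ_pos h5]
        nlinarith
      · have : 1 ≤ |z| / δ := (one_le_div hδ).2 h5.le
        nlinarith [(cutoff δ h.δ_pos).nonneg (x := z)]
    have h5 := (cutoff δ h.δ_pos).nonneg (x := z)
    nlinarith
  · rw [cutoff_eq_zero h.δ_pos hz, zero_mul]
    have h1 : 1 ≤ |z| / δ := by rw [le_div_iff₀ hδ]; linarith
    have := mul_le_mul_of_nonneg_left (one_le_pow₀ h1 (n := 2)) (show 0 ≤ lam / 2 by positivity)
    linarith

/-- For |z| ≤ δ/2 the point p_I + δ - z is at least δ/2 to the right of p_I, where the slope bound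
gives f_I ≤ -λδ/4. For larger z the crude bound M is absorbed by (M + λδ/4)(2z/δ)². -/
theorem Localization.gaussAvg_right_le (h : Localization a₀ M δ fI pI F) {t : ℝ} (ht : 0 ≤ t) :
    gaussAvg (cutoff δ h.δ_pos) F (pI + δ) t
      ≤ -(initialFlux fI pI * δ / 4) +
        2 * ((M + initialFlux fI pI * δ / 4) * (4 / δ ^ 2)) * t := by
  have hδ := h.δ_pos
  have hl := h.data.flux_pos
  have hM0 : 0 ≤ M := (abs_nonneg _).trans (h.bound' 0)
  set lam := initialFlux fI pI with hlam
  refine gaussAvg_le (cutoff δ h.δ_pos).continuous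
    h.contDiff.continuous (abs_cutoff_le h.δ_pos) h.bound' ht fun z => ?_
  have hb : (M + lam * δ / 4) * (4 / δ ^ 2) * z ^ 2 = (M + lam * δ / 4) * (2 * |z| / δ) ^ 2 := by
    rw [div_pow, mul_pow, sq_abs]; ring
  rw [hb]
  have hld := mul_pos hl hδ
  have hu0 : 0 ≤ 2 * |z| / δ := by positivity
  rcases le_or_gt |z| (δ / 2) with hz | hz
  · have hz' := abs_le.1 hz
    have h1 : F (pI + δ - z) = fI (pI + δ - z) := h.eqOn ⟨by linarith, by linarith⟩
    have h2 := h.data.le_of_right (x := pI + δ - z) (by linarith)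
      (by have := h.eight; linarith)
    rw [cutoff_eq_one h.δ_pos (by linarith), one_mul, h1]
    have h3 : fI (pI + δ - z) ≤ -(lam * δ / 4) := by nlinarith
    have : 0 ≤ (M + lam * δ / 4) * (2 * |z| / δ) ^ 2 := by positivity
    linarith
  · have h1 : 1 ≤ 2 * |z| / δ := by rw [one_le_div hδ]; linarith
    have h2 : cutoff δ h.δ_pos z * F (pI + δ - z) ≤ M := by
      refine (le_abs_self _).trans ?_
      rw [abs_mul]
      calc _ ≤ 1 * M := mul_le_mul (abs_cutoff_le _ _) (h.bound' _) (abs_nonneg _) zero_le_one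
        _ = M := one_mul M
    have := mul_le_mul_of_nonneg_left (one_le_pow₀ h1 (n := 2))
      (show 0 ≤ M + lam * δ / 4 by positivity)
    linarith

theorem Localization.le_gaussAvg_left (h : Localization a₀ M δ fI pI F) {t : ℝ} (ht : 0 ≤ t) :
    -gaussAvg (cutoff δ h.δ_pos) F (pI - δ) t
      ≤ -(initialFlux fI pI * δ / 4) +
        2 * ((M + initialFlux fI pI * δ / 4) * (4 / δ ^ 2)) * t := by
  have hδ := h.δ_pos
  have hl := h.data.flux_pos
  have hM0 : 0 ≤ M := (abs_nonneg _).trans (h.bound' 0)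
  set lam := initialFlux fI pI with hlam
  rw [← gaussAvg_neg]
  refine gaussAvg_le (cutoff δ h.δ_pos).continuous
    h.contDiff.continuous.neg (abs_cutoff_le h.δ_pos)
    (fun x => (abs_neg (F x)).le.trans (h.bound' x)) ht fun z => ?_
  have hb : (M + lam * δ / 4) * (4 / δ ^ 2) * z ^ 2 = (M + lam * δ / 4) * (2 * |z| / δ) ^ 2 := by
    rw [div_pow, mul_pow, sq_abs]; ring
  rw [hb]
  have hld := mul_pos hl hδ
  have hu0 : 0 ≤ 2 * |z| / δ := by positivity
  rcases le_or_gt |z| (δ / 2) with hz | hz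
  · have hz' := abs_le.1 hz
    have h1 : F (pI - δ - z) = fI (pI - δ - z) := h.eqOn ⟨by linarith, by linarith⟩
    have h2 := h.data.le_of_left (x := pI - δ - z) (by linarith)
      (by have := h.eight; linarith)
    rw [cutoff_eq_one h.δ_pos (by linarith), one_mul, h1]
    have h3 : lam * δ / 4 ≤ fI (pI - δ - z) := by nlinarith
    have : 0 ≤ (M + lam * δ / 4) * (2 * |z| / δ) ^ 2 := by positivity
    linarith
  · have h1 : 1 ≤ 2 * |z| / δ := by rw [one_le_div hδ]; linarith
    have h2 : cutoff δ h.δ_pos z * -F (pI - δ - z) ≤ M := by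
      refine (le_abs_self _).trans ?_
      rw [abs_mul, abs_neg]
      calc _ ≤ 1 * M := mul_le_mul (abs_cutoff_le _ _) (h.bound' _) (abs_nonneg _) zero_le_one
        _ = M := one_mul M
    have := mul_le_mul_of_nonneg_left (one_le_pow₀ h1 (n := 2))
      (show 0 ≤ M + lam * δ / 4 by positivity)
    linarith

end LocalSolution

/-! ### Existence of the local free boundary -/

section LocalSolution

variable {a a₀ M δ T : ℝ} {fI : ℝ → ℝ} {pI : ℝ} {F : ℝ → ℝ}

/-- The representation of the Neumann kernel by the localized heat kernel and a regular kernel. -/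
structure KernelSplitting (δ : ℝ) (hδ : 0 < δ) (N : ℝ × ℝ × ℝ → ℝ) (C : ℝ) : Prop where
  causal : IsCausalKernel N
  split : ∀ x y t, |x| ≤ 1 - 5 * δ → |y| ≤ 1 → t ≤ 1 →
    neumannKernel x y t = heatKernel (x - y) t * cutoff δ hδ (x - y) + N (x, y, t)
  nonneg : 0 ≤ C
  bound : ∀ x y t, 0 ≤ t → |N (x, y, t)| ≤ C * t
  bound_deriv : ∀ x y t, 0 ≤ t → |fderiv ℝ N (x, y, t) (1, 0, 0)| ≤ C * t
  lipschitz : ∀ x y z t, 0 ≤ t → |N (x, y, t) - N (x, z, t)| ≤ C * t * |y - z|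
  lipschitz_deriv : ∀ x y z t, 0 ≤ t →
    |fderiv ℝ N (x, y, t) (1, 0, 0) - fderiv ℝ N (x, z, t) (1, 0, 0)| ≤ C * t * |y - z|
  lipschitz_deriv_fst : ∀ x z y t, 0 ≤ t →
    |fderiv ℝ N (x, y, t) (1, 0, 0) - fderiv ℝ N (z, y, t) (1, 0, 0)| ≤ C * t * |x - z|

theorem exists_kernelSplitting {δ : ℝ} (hδ : 0 < δ) (hδ' : δ < 1 / 32) :
    ∃ N C, KernelSplitting δ hδ N C := by
  obtain ⟨N, h1, h2, h3, h4⟩ := exists_regularKernel hδ hδ'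
  have hN : IsCausalKernel N := ⟨h1, h2, h3⟩
  obtain ⟨C1, hC1, b1⟩ := hN.exists_bound
  obtain ⟨C2, hC2, b2⟩ := hN.fderiv_fst.exists_bound
  obtain ⟨C3, hC3, b3⟩ := hN.exists_lipschitz_snd
  obtain ⟨C4, hC4, b4⟩ := hN.fderiv_fst.exists_lipschitz_snd
  obtain ⟨C5, hC5, b5⟩ := hN.fderiv_fst.exists_lipschitz_fst
  refine ⟨N, C1 + C2 + C3 + C4 + C5, hN, h4, by positivity, fun x y t ht => (b1 x y t ht).trans ?_,
    fun x y t ht => (b2 x y t ht).trans ?_, fun x y z t ht => (b3 x y z t ht).trans ?_,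
    fun x y z t ht => (b4 x y z t ht).trans ?_, fun x z y t ht => (b5 x z y t ht).trans ?_⟩
  all_goals gcongr; linarith

/-- For x within 3δ of p_I the cutoff only sees points within 5δ, where f_I agrees with F. -/
theorem initialPart_eq {hδ : 0 < δ} {N : ℝ × ℝ × ℝ → ℝ} {C : ℝ} (hN : KernelSplitting δ hδ N C)
    (h : Localization a₀ M δ fI pI F) {g : ℝ → ℝ} (hg : Continuous g)
    (hgf : ∀ y ∈ Icc (-1 : ℝ) 1, g y = fI y) {x t : ℝ} (hx : x ∈ Icc (pI - 3 * δ) (pI + 3 * δ))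
    (ht : t ∈ Ioc (0 : ℝ) 1) :
    initialPart fI x t = gaussAvg (cutoff δ hδ) F x t + regularPart N g x t := by
  have h1 := h.data.add_le
  have h2 := h.data.le_sub
  have h8 := h.eight
  have hc : Continuous fun y => heatKernel (x - y) t * cutoff δ hδ (x - y) * F y := by
    have hK : Continuous fun z => heatKernel z t := continuous_iff_continuousAt.2 fun z =>
      (contDiffAt_heatKernel_comp contDiffAt_id contDiffAt_const (Or.inr ht.1.ne')).continuousAt
    have := (cutoff δ hδ).continuous
    have := h.contDiff.continuous
    fun_prop
  have hcN : Continuous fun y => N (x, y, t) * g y :=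
    (hN.causal.contDiff.continuous.comp (by fun_prop : Continuous fun y : ℝ => (x, y, t))).mul hg
  have e1 : ∀ y, y ∉ Ioc (-1 : ℝ) 1 → heatKernel (x - y) t * cutoff δ hδ (x - y) * F y = 0 := by
    intro y hy
    rw [cutoff_eq_zero, mul_zero, zero_mul]
    by_contra hlt
    have := abs_lt.1 (not_le.1 hlt)
    exact hy ⟨by linarith [hx.1, hx.2], by linarith [hx.1, hx.2]⟩
  rw [gaussAvg_eq_integral ht.1, initialPart, regularPart]
  have e2 : ∫ y, heatKernel (x - y) t * cutoff δ hδ (x - y) * F y =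
      ∫ y in (-1 : ℝ)..1, heatKernel (x - y) t * cutoff δ hδ (x - y) * F y := by
    rw [intervalIntegral.integral_of_le (by norm_num),
      setIntegral_eq_integral_of_forall_compl_eq_zero e1]
  rw [e2, ← intervalIntegral.integral_add (hc.intervalIntegrable _ _) (hcN.intervalIntegrable _ _)]
  refine intervalIntegral.integral_congr fun y hy => ?_
  rw [uIcc_of_le (by norm_num)] at hy
  rw [hN.split x y t (abs_le.2 ⟨by linarith [hx.1], by linarith [hx.2]⟩) (abs_le.2 hy) ht.2,
    hgf y hy]
  have : cutoff δ hδ (x - y) * F y = cutoff δ hδ (x - y) * fI y := by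
    rcases lt_or_ge |x - y| (2 * δ) with hz | hz
    · have := abs_lt.1 hz
      rw [h.eqOn ⟨by linarith [hx.1], by linarith [hx.2]⟩]
    · rw [cutoff_eq_zero hδ hz, zero_mul, zero_mul]
  linear_combination -heatKernel (x - y) t * this

/-- Source and sink are at least 6δ from p_I, hence at least 3δ from x, where the cutoff vanishes.
Only the regular kernel remains. -/
theorem sourcePart_sub_eq {hδ : 0 < δ} {N : ℝ × ℝ × ℝ → ℝ} {C : ℝ}
    (hN : KernelSplitting δ hδ N C) (hd : InitialData a₀ fI pI) (h8 : 8 * δ = a₀) (ha : a₀ ≤ a)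
    (hT : 0 < T) {p l : ℝ → ℝ} (hp : Continuous p)
    (hl : Continuous l) (hmem : ∀ t ∈ Icc 0 T, p t ∈ Icc (pI - δ) (pI + δ)) {x t : ℝ}
    (hx : x ∈ Icc (pI - 3 * δ) (pI + 3 * δ)) (ht : t ≤ 1) :
    sourcePart T (fun s => p s - sourceDist a (p s)) l x t
      - sourcePart T (fun s => p s + sourceDist a (p s)) l x t =
      sourceTerm (dipoleKernel a N) T p l x t := by
  have h1 := hd.add_le
  have h2 := hd.le_sub
  have cN := hN.causal.contDiff.continuous
  have cd := continuous_sourceDist a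
  have key : ∀ s ∈ Icc 0 T, ∀ y ∈ Icc (-1 : ℝ) 1, 2 * δ ≤ |x - y| →
      neumannKernel x y (t - s) = N (x, y, t - s) := by
    intro s hs y hy hxy
    rw [hN.split x y (t - s) (abs_le.2 ⟨by linarith [hx.1], by linarith [hx.2]⟩) (abs_le.2 hy)
      (by linarith [hs.1]), cutoff_eq_zero hδ hxy]
    ring
  have hm : ∀ s ∈ Icc 0 T, p s ∈ Icc (-1 : ℝ) 1 := fun s hs => by
    have := hmem s hs
    exact ⟨by linarith [this.1], by linarith [this.2]⟩
  have e1 : sourcePart T (fun s => p s - sourceDist a (p s)) l x t =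
      ∫ s in (0 : ℝ)..T, N (x, p s - sourceDist a (p s), t - s) * l s := by
    refine intervalIntegral.integral_congr fun s hs => ?_
    rw [uIcc_of_le hT.le] at hs
    simp only
    rw [key s hs _ (source_mem (hm s hs) (by linarith)).1]
    have := le_sourceDist hδ h8 ha h1 h2 (hmem s hs)
    have := hmem s hs
    exact le_trans (by linarith [hx.1, this.2]) (le_abs_self _)
  have e2 : sourcePart T (fun s => p s + sourceDist a (p s)) l x t =
      ∫ s in (0 : ℝ)..T, N (x, p s + sourceDist a (p s), t - s) * l s := by
    refine intervalIntegral.integral_congr fun s hs => ?_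
    rw [uIcc_of_le hT.le] at hs
    simp only
    rw [key s hs _ (source_mem (hm s hs) (by linarith)).2]
    have := le_sourceDist hδ h8 ha h1 h2 (hmem s hs)
    have := hmem s hs
    rw [abs_sub_comm]
    exact le_trans (by linarith [hx.2, this.1]) (le_abs_self _)
  rw [e1, e2, ← intervalIntegral.integral_sub
    (Continuous.intervalIntegrable (by fun_prop) _ _)
    (Continuous.intervalIntegrable (by fun_prop) _ _), sourceTerm]
  simp only [← sub_mul, dipoleKernel]

/-- Local existence of the free boundary and its flux, on a time interval depending only on the bound
`M` of the initial data and the initial flux `lam`. -/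
theorem exists_localSolution {a₀ δ : ℝ} (hδ : 0 < δ) (hδ' : δ < 1 / 32) (h8 : 8 * δ = a₀)
    {lam : ℝ} (hlam : 0 < lam) (M : ℝ) :
    ∃ T : ℝ, 0 < T ∧ T ≤ 1 ∧ ∀ (a : ℝ) (fI : ℝ → ℝ) (pI : ℝ), a₀ ≤ a → InitialData a₀ fI pI →
      (∀ x ∈ Icc (-1 : ℝ) 1, |fI x| ≤ M) → initialFlux fI pI = lam →
      ∃ p l : ℝ → ℝ, LocalSolution a T δ lam fI pI p l := by
  obtain ⟨N, C, hN⟩ := exists_kernelSplitting hδ hδ'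
  obtain ⟨c, hc, hcb⟩ := exists_deriv_gaussAvg_bound (ψ := cutoff δ hδ) (cutoff δ hδ).contDiff
    (cutoff δ hδ).hasCompactSupport (abs_cutoff_le hδ)
  obtain ⟨T, hT, hT1, k1, k2, k3, k4⟩ := exists_small_time (M := M) (C := C) (c := c) hδ hlam
  refine ⟨T, hT, hT1, fun a fI pI ha hd hM hfl => ?_⟩
  obtain ⟨F, f1, f2, f3, f4⟩ := hd.exists_localization hδ h8 hM
  have hF : Localization a₀ M δ fI pI F := ⟨hd, hδ, h8, f1, f2, f3, f4⟩
  obtain ⟨L, hL⟩ := hF.exists_deriv_bound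
  have hM0 : 0 ≤ M := (abs_nonneg _).trans (f4 0)
  have hL0 : 0 ≤ L := (abs_nonneg _).trans (hL 0)
  have hC := hN.nonneg
  have cF := f1.continuous
  have cF' := hF.continuous_deriv
  have cψ := (cutoff δ hδ).continuous
  let g : ℝ → ℝ := IccExtend (by norm_num : (-1 : ℝ) ≤ 1) (fun y : Icc (-1 : ℝ) 1 => fI y)
  have hgc : Continuous g :=
    (continuousOn_iff_continuous_domRestrict.1 hd.contDiffOn.continuousOn).Icc_extend'
  have hgM : ∀ y, |g y| ≤ M := fun y => hM _ (projIcc (-1 : ℝ) 1 (by norm_num) y).2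
  have hgf : ∀ y ∈ Icc (-1 : ℝ) 1, g y = fI y := fun y hy => IccExtend_of_mem _ _ hy
  set Nx : ℝ × ℝ × ℝ → ℝ := fun q => fderiv ℝ N q (1, 0, 0) with hNx
  have hNxc : IsCausalKernel Nx := hN.causal.fderiv_fst
  let w : ℝ → ℝ → ℝ := fun x t => gaussAvg (cutoff δ hδ) F x t + regularPart N g x t
  let wx : ℝ → ℝ → ℝ := fun x t => gaussAvg (cutoff δ hδ) (deriv F) x t + regularPart Nx g x t
  have hdg : ∀ x t, HasDerivAt (fun x => gaussAvg (cutoff δ hδ) F x t)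
      (gaussAvg (cutoff δ hδ) (deriv F) x t) x := fun x t =>
    hasDerivAt_gaussAvg cψ cF cF' hF.hasDerivAt (abs_cutoff_le hδ) f4 hL x t
  have hV : ∀ x t, 0 ≤ t → t ≤ T → |regularPart N g x t| ≤ 2 * (C * T) * M := fun x t h0 h1 =>
    (abs_regularPart_le hN.bound hC hgM x h0).trans (by gcongr)
  have hVx : ∀ x t, 0 ≤ t → t ≤ T → |regularPart Nx g x t| ≤ 2 * (C * T) * M := fun x t h0 h1 =>
    (abs_regularPart_le hN.bound_deriv hC hgM x h0).trans (by gcongr)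
  have hsmall : IsSmallKernel (dipoleKernel a N) (4 * C) :=
    isSmallKernel_dipoleKernel hN.causal a hC hN.bound hN.lipschitz
  have hsmallx : IsSmallKernel (dipoleKernel a Nx) (4 * C) :=
    isSmallKernel_dipoleKernel hNxc a hC hN.bound_deriv hN.lipschitz_deriv
  have hE0 : 0 ≤ 4 * C * T * (c * M + 1) * (2 * Real.sqrt T) := by positivity
  have slopeF : ∀ t ∈ Icc 0 T, ∀ x ∈ Icc (pI - δ) (pI + δ),
      gaussAvg (cutoff δ hδ) (deriv F) x t ≤ -(lam / 2) + lam / δ ^ 2 * T := by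
    intro t ht x hx
    have := hF.gaussAvg_deriv_le ht.1 hx
    rw [hfl] at this
    refine this.trans ?_
    have := ht.2
    gcongr
  have hb0 : 0 ≤ (M + lam * δ / 4) * (4 / δ ^ 2) := by positivity
  have hright : ∀ t ∈ Icc 0 T, w (pI + δ) t ≤
      -(4 * C * T * (c * M + 1) * (2 * Real.sqrt T) + lam * δ / 16) := by
    intro t ht
    have h1 := hF.gaussAvg_right_le ht.1
    rw [hfl] at h1
    have h2 := (abs_le.1 (hV (pI + δ) t ht.1 ht.2)).2
    have h3 := mul_le_mul_of_nonneg_left ht.2 hb0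
    simp only [w]
    linarith
  have hleft : ∀ t ∈ Icc 0 T, 4 * C * T * (c * M + 1) * (2 * Real.sqrt T) + lam * δ / 16 ≤
      w (pI - δ) t := by
    intro t ht
    have h1 := hF.le_gaussAvg_left ht.1
    rw [hfl] at h1
    have h2 := (abs_le.1 (hV (pI - δ) t ht.1 ht.2)).1
    have h3 := mul_le_mul_of_nonneg_left ht.2 hb0
    simp only [w]
    linarith
  -- The flux bound cM + 1 consists of cM from the smoothing estimate and 1 for the regular part and
  -- the source term. In the Lipschitz constant, cM comes from the Gaussian part and 2CM from the
  -- regular part.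
  have hfp : FixedPointData T δ pI (lam / 4) (c * M + 1) (4 * C) (c * M + 2 * C * M) w wx
      (dipoleKernel a N) (dipoleKernel a Nx) :=
    { T_pos := hT
      δ_pos := hδ
      κ_pos := by positivity
      B_nonneg := by positivity
      H_nonneg := by positivity
      continuous_w := ((continuous_gaussAvg cψ cF (abs_cutoff_le hδ) f4).add
        (continuous_regularPart hN.causal.contDiff.continuous hgc)).continuousOn
      continuous_wx := ((continuous_gaussAvg cψ cF' (abs_cutoff_le hδ) hL).add
        (continuous_regularPart hNxc.contDiff.continuous hgc)).continuousOn
      hasDerivAt_w := fun t ht x => (hdg x t).add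
        (hasDerivAt_regularPart hN.causal hgc hN.bound_deriv x ht.1)
      small_k := hsmall
      small_kx := hsmallx
      hasDerivAt_k := fun x q τ => hasDerivAt_dipoleKernel hN.causal a x q τ
      lipschitz_kx := fun x x' q τ h => dipoleKernel_lipschitz_fst a hC hN.lipschitz_deriv_fst
        x x' q h
      slope := fun t ht x hx => by
        have h1 := slopeF t ht x hx
        have h2 := (abs_le.1 (hVx x t ht.1 ht.2)).2
        simp only [wx]
        linarith
      right := fun t ht => (hright t ht).trans (by nlinarith)
      left := fun t ht => le_trans (by nlinarith) (hleft t ht)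
      flux := fun t ht x hx => by
        have h2 := hVx x t ht.1 ht.2
        have h3 : |wx x t| ≤ |gaussAvg (cutoff δ hδ) (deriv F) x t| + 2 * (C * T) * M :=
          (abs_add_le _ _).trans (add_le_add_right h2 _)
        have h4 : |gaussAvg (cutoff δ hδ) (deriv F) x t| * Real.sqrt t ≤ c * M := by
          rcases ht.1.eq_or_lt with h0 | h0
          · rw [← h0, Real.sqrt_zero, mul_zero]; positivity
          · exact (hcb F (fun x => gaussAvg (cutoff δ hδ) (deriv F) x t) M t cF f4
              ⟨h0, ht.2.trans hT1⟩ (fun x => hdg x t)).1 x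
        have h5 := mul_le_mul_of_nonneg_right h3 (Real.sqrt_nonneg t)
        have h6 : 2 * (C * T) * M * Real.sqrt t ≤ 2 * (C * T) * M * Real.sqrt T :=
          mul_le_mul_of_nonneg_left (Real.sqrt_le_sqrt ht.2) (by positivity)
        linarith
      lipschitz_wx := fun t ht x _ y _ => by
        have h2 := abs_regularPart_sub_le hNxc.contDiff.continuous hgc hN.lipschitz_deriv_fst hC
          hgM x y ht.1
        have h4 : t * |gaussAvg (cutoff δ hδ) (deriv F) x t -
            gaussAvg (cutoff δ hδ) (deriv F) y t| ≤ c * M * |x - y| := by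
          rcases ht.1.eq_or_lt with h0 | h0
          · rw [← h0, zero_mul]; positivity
          · exact (hcb F (fun x => gaussAvg (cutoff δ hδ) (deriv F) x t) M t cF f4
              ⟨h0, ht.2.trans hT1⟩ (fun x => hdg x t)).2 x y
        have h3 : |wx x t - wx y t| ≤ |gaussAvg (cutoff δ hδ) (deriv F) x t -
            gaussAvg (cutoff δ hδ) (deriv F) y t| + 2 * (C * t * |x - y|) * M := by
          have e : wx x t - wx y t = (gaussAvg (cutoff δ hδ) (deriv F) x t -
            gaussAvg (cutoff δ hδ) (deriv F) y t) +
            (regularPart Nx g x t - regularPart Nx g y t) := by simp only [wx]; ring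
          rw [e]
          exact (abs_add_le _ _).trans (add_le_add_right h2 _)
        have h5 := mul_le_mul_of_nonneg_left h3 ht.1
        have ht1 : t * t ≤ 1 := by nlinarith [ht.1, ht.2]
        have h6 : t * t * (2 * C * M * |x - y|) ≤ 1 * (2 * C * M * |x - y|) :=
          mul_le_mul_of_nonneg_right ht1 (by positivity)
        linarith
      contraction := k4 }
  obtain ⟨p, l, hpl, hz, hl⟩ := hfp.exists_fixedPoint
  have hW : ∀ t ∈ Ioc 0 T, ∀ x ∈ Icc (pI - 3 * δ) (pI + 3 * δ),
      duhamelSum a T fI p l x t = w x t + sourceTerm (dipoleKernel a N) T p l x t := by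
    intro t ht x hx
    rw [duhamelSum, initialPart_eq hN hF hgc hgf hx ⟨ht.1, ht.2.trans hT1⟩,
      sourcePart_sub_eq hN hd h8 ha hT hpl.continuous_p hpl.continuous_l hpl.mem hx
        (ht.2.trans hT1)]
  have hJ : Icc (pI - δ) (pI + δ) ⊆ Icc (pI - 3 * δ) (pI + 3 * δ) :=
    Icc_subset_Icc (by linarith) (by linarith)
  have h0T : (0 : ℝ) ∈ Icc 0 T := ⟨le_rfl, hT.le⟩
  have hw0 : ∀ x, w x 0 = F x := fun x => by
    simp [w, gaussAvg_zero, cutoff_eq_one, hδ.le, regularPart, hN.causal.zero _ _ _ le_rfl]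
  have hwx0 : ∀ x, wx x 0 = deriv F x := fun x => by
    simp [wx, gaussAvg_zero, cutoff_eq_one, hδ.le, regularPart, hNxc.zero _ _ _ le_rfl]
  have hS0 : ∀ x, sourceTerm (dipoleKernel a N) T p l x 0 = 0 := fun x => by
    have := hsmall.abs_sourceTerm_le (p := p) hT hpl.bound x le_rfl
    simpa using this
  have hSx0 : ∀ x, sourceTerm (dipoleKernel a Nx) T p l x 0 = 0 := fun x => by
    have := hsmallx.abs_sourceTerm_le (p := p) hT hpl.bound x le_rfl
    simpa using this
  have hp0 : p 0 = pI := by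
    have h1 := hz 0 h0T
    have h2 := hpl.mem 0 h0T
    rw [hw0, hS0, add_zero, f3 ⟨by linarith [h2.1], by linarith [h2.2]⟩] at h1
    have h3 := hd.add_le
    have h4 := hd.le_sub
    have h5 : p 0 ∈ Icc (-1 : ℝ) 1 := ⟨by linarith [h2.1], by linarith [h2.2]⟩
    rcases lt_trichotomy (p 0) pI with h | h | h
    · exact absurd h1 (hd.pos _ h5 h).ne'
    · exact h
    · exact absurd h1 (hd.neg _ h5 h).ne
  have hpIJ : pI ∈ Icc (pI - δ) (pI + δ) := ⟨by linarith, by linarith⟩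
  refine ⟨p, l, hpl.continuous_p, hpl.continuous_l, hpl.mem, ?_, hp0, ?_, ?_, ?_, ?_, ?_, ?_, ?_⟩
  · intro t ht
    rw [hl t ht]
    have := hfp.slope_add hpl ht (hpl.mem t ht)
    linarith
  · rw [hl 0 h0T, hp0, hwx0, hSx0, add_zero, hF.deriv_eq (by simpa using hδ), ← hfl, initialFlux]
  · intro t ht
    rw [hW t ht _ (hJ (hpl.mem t ⟨ht.1.le, ht.2⟩))]
    exact hz t ⟨ht.1.le, ht.2⟩
  · intro t ht
    have ht' : t ∈ Icc 0 T := ⟨ht.1.le, ht.2⟩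
    have h1 := hfp.hasDerivAt_add hpl ht' (p t)
    rw [hl t ht', neg_neg]
    refine h1.congr_of_eventuallyEq ?_
    -- The representation holds within 3δ of p_I, hence on a full neighbourhood of p(t), so the
    -- derivative carries over.
    have h2 := hpl.mem t ht'
    filter_upwards [Icc_mem_nhds (show pI - 3 * δ < p t by linarith [h2.1])
      (show p t < pI + 3 * δ by linarith [h2.2])] with x hx
    exact hW t ht x hx
  · intro t ht x hx y hy hxy
    have ht' : t ∈ Icc 0 T := ⟨ht.1.le, ht.2⟩
    rw [hW t ht x (hJ hx), hW t ht y (hJ hy)]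
    exact mul_abs_sub_le_of_hasDerivAt (convex_Icc _ _) (hfp.hasDerivAt_add hpl ht')
      (fun z hz => hfp.slope_add hpl ht' hz) hx hy hxy
  · intro t ht
    have ht' : t ∈ Icc 0 T := ⟨ht.1.le, ht.2⟩
    rw [hW t ht _ (hJ ⟨le_rfl, by linarith⟩)]
    have h1 := (abs_le.1 (hfp.abs_sourceTerm_le hsmall hpl (pI - δ) ht')).1
    linarith [hleft t ht']
  · intro t ht
    have ht' : t ∈ Icc 0 T := ⟨ht.1.le, ht.2⟩
    rw [hW t ht _ (hJ ⟨by linarith, le_rfl⟩)]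
    have h1 := (abs_le.1 (hfp.abs_sourceTerm_le hsmall hpl (pI + δ) ht')).2
    linarith [hright t ht']
  -- At p_I every part of f is O(√t): the Gaussian part because F vanishes at p_I and is
  -- L-Lipschitz, the others because they are O(t). Steepness then bounds |p(t) - p_I|. Unlike T,
  -- this constant may depend on sup|F'|.
  · set c₀ := 3 / 2 * 1 * L + 2 * C * M + 4 * C * (c * M + 1) * (2 * Real.sqrt T) with hc₀
    have hc₀0 : 0 ≤ c₀ := by positivity
    refine ⟨4 / lam * c₀ + 1, by positivity, fun t ht => ?_⟩
    have hts : t ≤ Real.sqrt t := by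
      have h1 : Real.sqrt t ≤ 1 := Real.sqrt_le_one.2 (ht.2.trans hT1)
      nlinarith [Real.mul_self_sqrt ht.1, Real.sqrt_nonneg t]
    have h1 := mul_abs_sub_le (convex_Icc _ _) (hfp.hasDerivAt_add hpl ht)
      (fun z hz => hfp.slope_add hpl ht hz) (hpl.mem t ht) hpIJ
    rw [hz t ht, zero_sub, abs_neg] at h1
    have h2 : |gaussAvg (cutoff δ hδ) F pI t| ≤ 3 / 2 * 1 * L * Real.sqrt t := by
      refine abs_gaussAvg_le (abs_cutoff_le hδ) fun z => ?_
      have h3 := abs_sub_le_of_hasDerivAt hF.hasDerivAt hL (pI - z) pI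
      rw [f3 (⟨by linarith, by linarith⟩ : pI ∈ Icc (pI - 6 * δ) (pI + 6 * δ)), hd.zero,
        sub_zero] at h3
      simpa using h3
    have h3 : |regularPart N g pI t| ≤ 2 * C * M * Real.sqrt t := by
      refine (abs_regularPart_le hN.bound hC hgM pI ht.1).trans ?_
      calc 2 * (C * t) * M = 2 * C * M * t := by ring
        _ ≤ _ := by gcongr
    have h4 : |sourceTerm (dipoleKernel a N) T p l pI t| ≤
        4 * C * (c * M + 1) * (2 * Real.sqrt T) * Real.sqrt t := by
      refine (hsmall.abs_sourceTerm_le hT hpl.bound pI ht.1).trans ?_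
      calc 4 * C * t * (c * M + 1) * (2 * Real.sqrt T)
          = 4 * C * (c * M + 1) * (2 * Real.sqrt T) * t := by ring
        _ ≤ _ := by gcongr
    have h5 := abs_add_three (gaussAvg (cutoff δ hδ) F pI t) (regularPart N g pI t)
      (sourceTerm (dipoleKernel a N) T p l pI t)
    have h6 : lam / 4 * |p t - pI| ≤ c₀ * Real.sqrt t := by
      rw [hc₀]
      simp only [w] at h1
      linarith
    have h7 : |p t - pI| ≤ 4 / lam * c₀ * Real.sqrt t := by
      have : 4 / lam * (lam / 4 * |p t - pI|) ≤ 4 / lam * (c₀ * Real.sqrt t) :=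
        mul_le_mul_of_nonneg_left h6 (by positivity)
      have e : 4 / lam * (lam / 4 * |p t - pI|) = |p t - pI| := by field_simp
      rw [e] at this
      linarith
    linarith [Real.sqrt_nonneg t]

end LocalSolution

/-! ### Interior smoothness and the reflection symmetry of Duhamel's formula -/

section Regularity

theorem contDiffAt_intervalIntegral {P : Type} [NormedAddCommGroup P] [NormedSpace ℝ P]
    [MeasurableSpace P] [BorelSpace P] [SecondCountableTopology P] {H : (ℝ × ℝ) × P → ℝ}
    {X₀ : ℝ × ℝ} {α β : ℝ} (hαβ : α ≤ β) {π : ℝ → P} (hπ : ContinuousOn π (Icc α β)) {w : ℝ → ℝ}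
    (hw : ContinuousOn w (Icc α β)) (hH : ∀ s ∈ Icc α β, ContDiffAt ℝ ∞ H (X₀, π s)) :
    ContDiffAt ℝ ∞ (fun X => ∫ s in α..β, H (X, π s) * w s) X₀ ∧
      heatOp (fun X => ∫ s in α..β, H (X, π s) * w s) X₀ =
        ∫ s in α..β, heatOp (fun X => H (X, π s)) X₀ * w s := by
  let ρ : ℝ → P := IccExtend hαβ (fun s : Icc α β => π s)
  have hρ : Continuous ρ := (continuousOn_iff_continuous_domRestrict.1 hπ).Icc_extend'
  have hρe : ∀ s ∈ Icc α β, ρ s = π s := fun s hs => IccExtend_of_mem _ _ hs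
  have hρm : ∀ s, ρ s ∈ π '' Icc α β := fun s => ⟨projIcc α β hαβ s, (projIcc α β hαβ s).2, rfl⟩
  have hC : IsCompact (π '' Icc α β) := isCompact_Icc.image_of_continuousOn hπ
  have hHC : ∀ c ∈ π '' Icc α β, ContDiffAt ℝ ∞ H (X₀, c) := by
    rintro _ ⟨s, hs, rfl⟩; exact hH s hs
  have hwi : Integrable w (volume.restrict (Ioc α β)) :=
    (hw.integrableOn_Icc).mono_set Ioc_subset_Icc_self
  have e1 : (fun X => ∫ s in α..β, H (X, π s) * w s) =
      fun X => ∫ s in Ioc α β, w s • H (X, ρ s) := by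
    ext X
    rw [intervalIntegral.integral_of_le hαβ]
    refine setIntegral_congr_fun measurableSet_Ioc fun s hs => ?_
    simp only [hρe s (Ioc_subset_Icc_self hs), smul_eq_mul, mul_comm]
  have e2 : ∫ s in α..β, heatOp (fun X => H (X, π s)) X₀ * w s =
      ∫ s in Ioc α β, w s • heatOp (fun X => H (X, ρ s)) X₀ := by
    rw [intervalIntegral.integral_of_le hαβ]
    refine setIntegral_congr_fun measurableSet_Ioc fun s hs => ?_
    simp only [hρe s (Ioc_subset_Icc_self hs), smul_eq_mul, mul_comm]
  rw [e1, e2]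
  exact ⟨contDiffAt_integral hC hHC hwi hρ.measurable hρm,
    heatOp_integral hC hHC hwi hρ.measurable hρm⟩

theorem contDiffAt_initialPart {fI : ℝ → ℝ} (hf : ContinuousOn fI (Icc (-1) 1)) {x t : ℝ}
    (hx : |x| < 3 / 2) (ht : 0 < t) :
    ContDiffAt ℝ ∞ (fun q : ℝ × ℝ => initialPart fI q.1 q.2) (x, t) ∧
      heatOp (fun q : ℝ × ℝ => initialPart fI q.1 q.2) (x, t) = 0 := by
  have hy : ∀ y ∈ Icc (-1 : ℝ) 1, |y| < 3 / 2 := fun y hy =>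
    lt_of_le_of_lt (abs_le.2 hy) (by norm_num)
  obtain ⟨h1, h2⟩ := contDiffAt_intervalIntegral (P := ℝ) (X₀ := (x, t))
    (H := fun q => neumannKernel q.1.1 q.2 q.1.2) (π := fun y => y) (α := -1) (β := 1)
    (by norm_num) continuousOn_id hf (fun y hyI =>
      ContDiffAt.comp (f := fun q : (ℝ × ℝ) × ℝ => (q.1.1, q.2, q.1.2)) ((x, t), y)
        (contDiffAt_neumannKernel (X := (x, y, t)) hx (hy y hyI) (Or.inr ht.ne')) (by fun_prop))
  refine ⟨h1, h2.trans ?_⟩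
  rw [intervalIntegral.integral_congr (g := fun _ => 0), intervalIntegral.integral_zero]
  intro y hyI
  rw [uIcc_of_le (by norm_num)] at hyI
  have := heatOp_neumannKernel (s := 0) hx (hy y hyI) ht.ne'
  simp only [sub_zero] at this
  simp only [this, zero_mul]

/-- A kernel `G(x,y,τ)` applied to a moving source `q` with strength `l`. -/
theorem contDiffAt_movingSource {G : ℝ → ℝ → ℝ → ℝ} {T : ℝ} (hT : 0 ≤ T) {q l : ℝ → ℝ}
    (hq : ContinuousOn q (Icc 0 T)) (hl : ContinuousOn l (Icc 0 T)) {x t : ℝ}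
    (hG : ∀ s ∈ Icc 0 T,
      ContDiffAt ℝ ∞ (fun X : ℝ × ℝ × ℝ => G X.1 X.2.1 X.2.2) (x, q s, t - s)) :
    ContDiffAt ℝ ∞ (fun r : ℝ × ℝ => ∫ s in (0 : ℝ)..T, G r.1 (q s) (r.2 - s) * l s) (x, t) ∧
      heatOp (fun r : ℝ × ℝ => ∫ s in (0 : ℝ)..T, G r.1 (q s) (r.2 - s) * l s) (x, t) =
        ∫ s in (0 : ℝ)..T, heatOp (fun r : ℝ × ℝ => G r.1 (q s) (r.2 - s)) (x, t) * l s :=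
  contDiffAt_intervalIntegral (P := ℝ × ℝ) (X₀ := (x, t))
    (H := fun z => G z.1.1 z.2.1 (z.1.2 - z.2.2)) (π := fun s => (q s, s))
    hT (hq.prodMk continuousOn_id) hl (fun s hs =>
      ContDiffAt.comp (f := fun z : (ℝ × ℝ) × (ℝ × ℝ) => (z.1.1, z.2.1, z.1.2 - z.2.2))
        ((x, t), (q s, s)) (hG s hs) (by fun_prop))

/-- For s ≠ t the kernel is smooth, being zero when s > t. At s = t it is smooth unless x is the
source or one of its two nearest images, which is excluded. -/
theorem contDiffAt_sourcePart {T : ℝ} (hT : 0 ≤ T) {q l : ℝ → ℝ}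
    (hq : ContinuousOn q (Icc 0 T)) (hl : ContinuousOn l (Icc 0 T))
    (hqm : ∀ s ∈ Icc 0 T, q s ∈ Icc (-1 : ℝ) 1) {x t : ℝ} (hx : |x| < 3 / 2)
    (h : ∀ s ∈ Icc 0 T, s = t → x - q t ≠ 0 ∧ x - (2 - q t) ≠ 0 ∧ x - (-2 - q t) ≠ 0) :
    ContDiffAt ℝ ∞ (fun r : ℝ × ℝ => sourcePart T q l r.1 r.2) (x, t) ∧
      heatOp (fun r : ℝ × ℝ => sourcePart T q l r.1 r.2) (x, t) = 0 := by
  have hy : ∀ y ∈ Icc (-1 : ℝ) 1, |y| < 3 / 2 := fun y hy =>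
    lt_of_le_of_lt (abs_le.2 hy) (by norm_num)
  obtain ⟨h1, h2⟩ := contDiffAt_movingSource (G := neumannKernel) hT hq hl (x := x) (t := t)
    (fun s hs => contDiffAt_neumannKernel hx (hy _ (hqm s hs)) (by
      by_cases hst : s = t
      · left
        rw [hst]
        exact h s hs hst
      · right
        exact sub_ne_zero.2 (Ne.symm hst)))
  refine ⟨h1, h2.trans ?_⟩
  -- The heat equation for the kernel is available only for s ≠ t; the instant s = t is a null set.
  rw [intervalIntegral.integral_congr_ae (g := fun _ => 0), intervalIntegral.integral_zero]
  have : ∀ᵐ s : ℝ, s ≠ t := by simp [ae_iff]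
  filter_upwards [this] with s hst hs
  rw [uIoc_of_le hT] at hs
  rw [heatOp_neumannKernel hx (hy _ (hqm s (Ioc_subset_Icc_self hs))) (Ne.symm hst), zero_mul]

theorem duhamelSum_reflect_right (a T : ℝ) (fI p l : ℝ → ℝ) (x t : ℝ) :
    duhamelSum a T fI p l (2 - x) t = duhamelSum a T fI p l x t := by
  simp [duhamelSum, initialPart, sourcePart, neumannKernel_reflect_right]

theorem duhamelSum_reflect_left (a T : ℝ) (fI p l : ℝ → ℝ) (x t : ℝ) :
    duhamelSum a T fI p l (-2 - x) t = duhamelSum a T fI p l x t := by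
  simp [duhamelSum, initialPart, sourcePart, neumannKernel_reflect_left]

theorem hasDerivAt_zero_of_reflect {f : ℝ → ℝ} {c : ℝ} (hf : DifferentiableAt ℝ f c)
    (h : ∀ x, f (2 * c - x) = f x) : HasDerivAt f 0 c := by
  have h1 := hf.hasDerivAt
  have h2 : HasDerivAt (fun x => f (2 * c - x)) (-deriv f c) c := by
    have h3 : HasDerivAt f (deriv f c) (2 * c - c) := by
      have : 2 * c - c = c := by ring
      rw [this]; exact h1
    exact h3.comp_const_sub (2 * c) c
  simp only [h] at h2
  have := h1.unique h2
  have h0 : deriv f c = 0 := by linarith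
  rwa [h0] at h1

end Regularity

/-! ### Continuity of source potentials up to the source -/

section Continuity

variable {T : ℝ} {q l : ℝ → ℝ}

/-- The source integrand in the variable `r = t - s`, extended by zero. -/
noncomputable def lagIntegrand (T : ℝ) (q l : ℝ → ℝ) (x t r : ℝ) : ℝ :=
  neumannKernel x (q (t - r)) r * (Ioc 0 T).indicator l (t - r)

/-- In the variable t - s the time singularity sits at r = 0 for every t, so r^(-1/2) is a common
dominating function. -/
theorem sourcePart_eq_integral_lag (hT : 0 ≤ T) (x t : ℝ) :
    sourcePart T q l x t = ∫ r, lagIntegrand T q l x t r := by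
  have h := integral_sub_left_eq_self
    (fun s => neumannKernel x (q s) (t - s) * (Ioc 0 T).indicator l s) volume t
  simp only [sub_sub_cancel] at h
  simp only [lagIntegrand]
  rw [h, sourcePart, intervalIntegral.integral_of_le hT, ← integral_indicator measurableSet_Ioc]
  refine integral_congr_ae (ae_of_all _ fun s => ?_)
  by_cases hs : s ∈ Ioc 0 T <;> simp [hs]

theorem abs_neumannKernel_le_mul_indicator {C : ℝ}
    (hC : ∀ x ∈ Icc (-1 : ℝ) 1, ∀ y ∈ Icc (-1 : ℝ) 1,
      ∀ t ∈ Ioc (0 : ℝ) 1, neumannKernel x y t ≤ C * (Real.sqrt t)⁻¹)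
    (hq : ∀ s, q s ∈ Icc (-1 : ℝ) 1) {Λ : ℝ} (hΛ : ∀ s ∈ Icc 0 T, |l s| ≤ Λ) (hΛ0 : 0 ≤ Λ)
    (hT : T ≤ 1) {x t : ℝ} (hx : x ∈ Icc (-1 : ℝ) 1) (ht : t ≤ T) (r : ℝ) :
    |lagIntegrand T q l x t r| ≤ (Ioc (0 : ℝ) 1).indicator
      (fun r => C * Λ * r ^ (-(1 / 2) : ℝ)) r := by
  unfold lagIntegrand
  by_cases hr : 0 < r
  · by_cases hs : t - r ∈ Ioc 0 T
    · have hr1 : r ≤ 1 := by linarith [hs.1]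
      rw [indicator_of_mem hs, indicator_of_mem (show r ∈ Ioc (0 : ℝ) 1 from ⟨hr, hr1⟩), abs_mul,
        abs_of_nonneg (neumannKernel_nonneg _ _ _), Real.rpow_neg hr.le, ← Real.sqrt_eq_rpow]
      have h1 := hC x hx _ (hq (t - r)) r ⟨hr, hr1⟩
      have h2 := hΛ (t - r) ⟨hs.1.le, hs.2⟩
      calc _ ≤ C * (Real.sqrt r)⁻¹ * Λ :=
            mul_le_mul h1 h2 (abs_nonneg _) ((neumannKernel_nonneg _ _ _).trans h1)
        _ = _ := by ring
    · rw [indicator_of_notMem hs, mul_zero, abs_zero]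
      refine indicator_nonneg (fun r hr => ?_) r
      have h1 := hC x hx _ (hq 0) 1 ⟨one_pos, le_rfl⟩
      have hC0 : 0 ≤ C := by
        have := (neumannKernel_nonneg x (q 0) 1).trans h1
        simpa using this
      exact mul_nonneg (mul_nonneg hC0 hΛ0) (Real.rpow_nonneg hr.1.le _)
  · rw [neumannKernel_of_nonpos _ _ (not_lt.1 hr), zero_mul, abs_zero,
      indicator_of_notMem (fun h => hr h.1)]

theorem integrable_lag_bound (C : ℝ) :
    Integrable ((Ioc (0 : ℝ) 1).indicator fun r : ℝ => C * r ^ (-(1 / 2) : ℝ)) := by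
  rw [integrable_indicator_iff measurableSet_Ioc, ← intervalIntegrable_iff_integrableOn_Ioc_of_le
    zero_le_one]
  exact (intervalIntegral.intervalIntegrable_rpow' (by norm_num)).const_mul C

theorem aestronglyMeasurable_lagIntegrand (hq : Continuous q) (hqm : ∀ s, q s ∈ Icc (-1 : ℝ) 1)
    (hl : Continuous l) {x : ℝ} (hx : x ∈ Icc (-1 : ℝ) 1) (t : ℝ) :
    AEStronglyMeasurable (lagIntegrand T q l x t) := by
  have habs : ∀ z ∈ Icc (-1 : ℝ) 1, |z| < 3 / 2 := fun y hy =>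
    lt_of_le_of_lt (abs_le.2 hy) (by norm_num)
  have h1 : ContinuousOn (fun r => neumannKernel x (q (t - r)) r) (Ioi 0) := by
    intro r hr
    refine ContinuousAt.continuousWithinAt ?_
    exact ContinuousAt.comp (f := fun r => (x, q (t - r), r))
      (contDiffAt_neumannKernel (X := (x, q (t - r), r)) (habs x hx) (habs _ (hqm _))
        (Or.inr (ne_of_gt hr))).continuousAt (by fun_prop)
  have h2 : (fun r => neumannKernel x (q (t - r)) r) =
      (Ioi 0).indicator fun r => neumannKernel x (q (t - r)) r := by
    ext r
    by_cases hr : r ∈ Ioi (0 : ℝ)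
    · rw [indicator_of_mem hr]
    · rw [indicator_of_notMem hr, neumannKernel_of_nonpos _ _ (not_lt.1 hr)]
  have h3 : AEStronglyMeasurable (fun r => neumannKernel x (q (t - r)) r) := by
    rw [h2]
    exact (aestronglyMeasurable_indicator_iff measurableSet_Ioi).2
      (h1.aestronglyMeasurable measurableSet_Ioi)
  refine h3.mul ?_
  have h4 : Measurable ((Ioc 0 T).indicator l) := hl.measurable.indicator measurableSet_Ioc
  exact (h4.comp (measurable_const.sub measurable_id)).aestronglyMeasurable

theorem integrable_lagIntegrand (hq : Continuous q) (hqm : ∀ s, q s ∈ Icc (-1 : ℝ) 1)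
    (hl : Continuous l) (hT1 : T ≤ 1) {x t : ℝ} (hx : x ∈ Icc (-1 : ℝ) 1)
    (ht : t ≤ T) : Integrable (lagIntegrand T q l x t) := by
  obtain ⟨C, -, hC⟩ := exists_neumannKernel_le
  obtain ⟨Λ, hΛ⟩ := isCompact_Icc.exists_bound_of_continuousOn (s := Icc 0 T) hl.continuousOn
  exact (integrable_lag_bound (C * |Λ|)).mono' (aestronglyMeasurable_lagIntegrand hq hqm hl hx t)
    (ae_of_all _ fun r => abs_neumannKernel_le_mul_indicator hC hqm
      (fun s hs => (hΛ s hs).trans (le_abs_self Λ)) (abs_nonneg _) hT1 hx ht r)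

theorem continuousOn_sourcePart (hq : Continuous q) (hqm : ∀ s, q s ∈ Icc (-1 : ℝ) 1)
    (hl : Continuous l) (hT0 : 0 ≤ T) (hT1 : T ≤ 1) :
    ContinuousOn (fun z : ℝ × ℝ => sourcePart T q l z.1 z.2) (Icc (-1) 1 ×ˢ Icc 0 T) := by
  have habs : ∀ z ∈ Icc (-1 : ℝ) 1, |z| < 3 / 2 := fun y hy =>
    lt_of_le_of_lt (abs_le.2 hy) (by norm_num)
  obtain ⟨C, -, hC⟩ := exists_neumannKernel_le
  obtain ⟨Λ, hΛ⟩ := isCompact_Icc.exists_bound_of_continuousOn (s := Icc 0 T) hl.continuousOn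
  simp only [sourcePart_eq_integral_lag hT0]
  rintro ⟨x, t⟩ ⟨hx, ht⟩
  refine continuousWithinAt_of_dominated
    (bound := (Ioc (0 : ℝ) 1).indicator fun r => C * |Λ| * r ^ (-(1 / 2) : ℝ)) ?_ ?_
    (integrable_lag_bound _) ?_
  · filter_upwards [self_mem_nhdsWithin] with z hz
    exact aestronglyMeasurable_lagIntegrand hq hqm hl hz.1 _
  · filter_upwards [self_mem_nhdsWithin] with z hz
    exact ae_of_all _ fun r => abs_neumannKernel_le_mul_indicator hC hqm
      (fun s hs => (hΛ s hs).trans (le_abs_self Λ)) (abs_nonneg _) hT1 hz.1 hz.2.2 r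
  -- The lags t and t - T are where the indicator of the emission interval may jump.
  · have h1 : ∀ᵐ r : ℝ, r ≠ t := by simp [ae_iff]
    have h2 : ∀ᵐ r : ℝ, r ≠ t - T := by simp [ae_iff]
    filter_upwards [h1, h2] with r hr1 hr2
    refine ContinuousAt.continuousWithinAt ?_
    unfold lagIntegrand
    rcases le_or_gt r 0 with hr | hr
    · simp only [neumannKernel_of_nonpos _ _ hr, zero_mul]
      exact continuousAt_const
    · have c1 : ContinuousAt (fun z : ℝ × ℝ => neumannKernel z.1 (q (z.2 - r)) r) (x, t) :=
        ContinuousAt.comp (f := fun z : ℝ × ℝ => (z.1, q (z.2 - r), r)) (x := ((x, t) : ℝ × ℝ))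
          (g := fun X : ℝ × ℝ × ℝ => neumannKernel X.1 X.2.1 X.2.2)
          (contDiffAt_neumannKernel (X := (x, q (t - r), r)) (habs x hx) (habs _ (hqm _))
            (Or.inr hr.ne')).continuousAt (by fun_prop)
      refine c1.mul ?_
      have c2 : ContinuousAt (fun z : ℝ × ℝ => z.2 - r) (x, t) := by fun_prop
      have c3 : ContinuousAt ((Ioc 0 T).indicator l) (t - r) := by
        have hfr : t - r ∉ frontier (Ioc 0 T) := by
          intro h
          have hsub : frontier (Ioc 0 T) ⊆ {0, T} := by
            rcases hT0.eq_or_lt with h0 | h0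
            · rw [← h0]; simp
            · rw [frontier_Ioc h0]
          rcases hsub h with h | h
          · exact hr1 (by linarith)
          · exact hr2 (by rw [mem_singleton_iff] at h; linarith)
        by_cases hm : t - r ∈ interior (Ioc 0 T)
        · refine hl.continuousAt.congr ?_
          filter_upwards [isOpen_interior.mem_nhds hm] with s hs
          rw [indicator_of_mem (interior_subset hs)]
        · have hm' : t - r ∈ (closure (Ioc 0 T))ᶜ := fun hc => hfr ⟨hc, hm⟩
          refine (continuousAt_const (y := (0 : ℝ))).congr ?_
          filter_upwards [isClosed_closure.isOpen_compl.mem_nhds hm'] with s hs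
          rw [indicator_of_notMem (fun h => hs (subset_closure h))]
      exact ContinuousAt.comp (f := fun z : ℝ × ℝ => z.2 - r) (x := (x, t)) c3 c2

theorem intervalIntegrable_sourcePart (hq : Continuous q) (hqm : ∀ s, q s ∈ Icc (-1 : ℝ) 1)
    (hl : Continuous l) (hT0 : 0 ≤ T) (hT1 : T ≤ 1) {x t : ℝ} (hx : x ∈ Icc (-1 : ℝ) 1)
    (ht : t ≤ T) :
    IntervalIntegrable (fun s => neumannKernel x (q s) (t - s) * l s) volume 0 T := by
  have h := (integrable_lagIntegrand hq hqm hl hT1 hx ht).comp_sub_left t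
  simp only [lagIntegrand, sub_sub_cancel] at h
  rw [intervalIntegrable_iff_integrableOn_Ioc_of_le hT0]
  refine (h.integrableOn (s := Ioc 0 T)).congr_fun (fun s hs => ?_) measurableSet_Ioc
  simp only [indicator_of_mem hs]

end Continuity

/-! ### Attainment of the initial data, up to the end points -/

section InitialTrace

variable {fI : ℝ → ℝ}

/-- The even reflection of `fI` about the end points of `[-1,1]`, cut off outside `(-3,3)`. -/
noncomputable def evenExtension (fI : ℝ → ℝ) (y : ℝ) : ℝ :=
  (Ioc (-1 : ℝ) 1).indicator fI y + (Ioo (-1 : ℝ) 1).indicator fI (2 - y)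
    + (Ico (-1 : ℝ) 1).indicator fI (-2 - y)

/-- The types of the three intervals are chosen so that every point of (-3,3) is counted exactly
once, also at ±1. The folding map on the right shows continuity. -/
theorem evenExtension_eq {y : ℝ} (hy : y ∈ Ioo (-3 : ℝ) 3) :
    evenExtension fI y = fI (max (min y (2 - y)) (-2 - y)) := by
  obtain ⟨h1, h2⟩ := hy
  unfold evenExtension
  rcases le_or_gt y (-1) with h | h
  · rw [indicator_of_notMem (fun k => absurd k.1 (not_lt.2 h)),
      indicator_of_notMem (fun k => absurd k.2 (not_lt.2 (by linarith))),
      indicator_of_mem (s := Ico (-1 : ℝ) 1) ⟨by linarith, by linarith⟩, min_eq_left (by linarith),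
      max_eq_right (by linarith)]
    ring
  · rw [indicator_of_notMem (s := Ico (-1 : ℝ) 1) (fun k => absurd k.1 (not_le.2 (by linarith)))]
    rcases le_or_gt y 1 with h' | h'
    · rw [indicator_of_mem (s := Ioc (-1 : ℝ) 1) ⟨h, h'⟩,
        indicator_of_notMem (fun k => absurd k.2 (not_lt.2 (by linarith))),
        min_eq_left (by linarith), max_eq_left (by linarith)]
      ring
    · rw [indicator_of_notMem (fun k => absurd k.2 (not_le.2 h')),
        indicator_of_mem (s := Ioo (-1 : ℝ) 1) ⟨by linarith, by linarith⟩,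
        min_eq_right (by linarith), max_eq_left (by linarith)]
      ring

theorem evenExtension_of_mem {x : ℝ} (hx : x ∈ Icc (-1 : ℝ) 1) : evenExtension fI x = fI x := by
  rw [evenExtension_eq ⟨by linarith [hx.1], by linarith [hx.2]⟩, min_eq_left (by linarith [hx.2]),
    max_eq_left (by linarith [hx.1])]

theorem continuousAt_evenExtension (hf : ContinuousOn fI (Icc (-1) 1)) {x : ℝ}
    (hx : x ∈ Icc (-1 : ℝ) 1) : ContinuousAt (evenExtension fI) x := by
  have h1 : ContinuousOn (fun y : ℝ => fI (max (min y (2 - y)) (-2 - y))) (Ioo (-3) 3) := by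
    refine hf.comp (by fun_prop) fun y hy => ⟨?_, ?_⟩
    · rcases le_total y (-1) with h | h
      · exact le_max_of_le_right (by linarith)
      · exact le_max_of_le_left (le_min h (by linarith [hy.2]))
    · refine max_le ?_ (by linarith [hy.1])
      rcases le_total y 1 with h | h
      · exact min_le_of_left_le h
      · exact min_le_of_right_le (by linarith)
  have hn : Ioo (-3 : ℝ) 3 ∈ 𝓝 x := Ioo_mem_nhds (by linarith [hx.1]) (by linarith [hx.2])
  refine (h1.continuousAt hn).congr ?_
  filter_upwards [hn] with y hy
  exact (evenExtension_eq hy).symm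

theorem measurable_indicator_of_continuousOn (hf : ContinuousOn fI (Icc (-1) 1)) {s : Set ℝ}
    (hs : MeasurableSet s) (hsub : s ⊆ Icc (-1) 1) : Measurable (s.indicator fI) := by
  have h1 : Measurable (IccExtend (by norm_num : (-1 : ℝ) ≤ 1) (fun y : Icc (-1 : ℝ) 1 => fI y)) :=
    ((continuousOn_iff_continuous_domRestrict.1 hf).Icc_extend').measurable
  have h2 : s.indicator fI = s.indicator
      (IccExtend (by norm_num : (-1 : ℝ) ≤ 1) (fun y : Icc (-1 : ℝ) 1 => fI y)) :=
    indicator_congr fun y hy =>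
      (IccExtend_of_mem _ (fun y : Icc (-1 : ℝ) 1 => fI y) (hsub hy)).symm
  rw [h2]
  exact h1.indicator hs

theorem measurable_evenExtension (hf : ContinuousOn fI (Icc (-1) 1)) :
    Measurable (evenExtension fI) := by
  have h1 := measurable_indicator_of_continuousOn hf measurableSet_Ioc Ioc_subset_Icc_self
  have h2 := measurable_indicator_of_continuousOn hf measurableSet_Ioo Ioo_subset_Icc_self
  have h3 := measurable_indicator_of_continuousOn hf measurableSet_Ico Ico_subset_Icc_self
  exact (h1.add (h2.comp (measurable_const.sub measurable_id))).add
    (h3.comp (measurable_const.sub measurable_id))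

theorem abs_indicator_le {M : ℝ} (hM : ∀ x ∈ Icc (-1 : ℝ) 1, |fI x| ≤ M) {s : Set ℝ}
    (hsub : s ⊆ Icc (-1) 1) (y : ℝ) : |s.indicator fI y| ≤ M := by
  by_cases h : y ∈ s
  · rw [indicator_of_mem h]; exact hM y (hsub h)
  · rw [indicator_of_notMem h, abs_zero]
    exact (abs_nonneg _).trans (hM 0 ⟨by norm_num, by norm_num⟩)

theorem continuous_heatKernel_fst (t : ℝ) : Continuous fun x => heatKernel x t := by
  unfold heatKernel; fun_prop

/-- Changing variables in the images k = ±1 moves the reflection from the kernel to the data. At t =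
0 the Gaussian average is a point evaluation and the tail vanishes. -/
theorem initialPart_eq_gaussian (hf : ContinuousOn fI (Icc (-1) 1)) {M : ℝ}
    (hM : ∀ x ∈ Icc (-1 : ℝ) 1, |fI x| ≤ M) {x t : ℝ} (hx : |x| < 3 / 2) (ht : 0 < t) :
    initialPart fI x t = (∫ z, evenExtension fI (x - Real.sqrt t * z) ∂stdMeasure)
      + ∫ y in (-1 : ℝ)..1, tailKernel x y t * fI y := by
  have hm1 := measurable_indicator_of_continuousOn hf measurableSet_Ioc Ioc_subset_Icc_self
  have hm2 := measurable_indicator_of_continuousOn hf measurableSet_Ioo Ioo_subset_Icc_self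
  have hm3 := measurable_indicator_of_continuousOn hf measurableSet_Ico Ico_subset_Icc_self
  have hy : ∀ y ∈ Icc (-1 : ℝ) 1, |y| < 3 / 2 := fun y hy =>
    lt_of_le_of_lt (abs_le.2 hy) (by norm_num)
  have hu : uIcc (-1 : ℝ) 1 = Icc (-1) 1 := uIcc_of_le (by norm_num)
  have c (u : ℝ → ℝ) (hu' : Continuous u) :
      IntervalIntegrable (fun y => heatKernel (u y) t * fI y) volume (-1) 1 := by
    refine ContinuousOn.intervalIntegrable ?_
    rw [hu]
    exact ((continuous_heatKernel_fst t).comp hu').continuousOn.mul hf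
  have ct : IntervalIntegrable (fun y => tailKernel x y t * fI y) volume (-1) 1 := by
    refine ContinuousOn.intervalIntegrable ?_
    rw [hu]
    refine ContinuousOn.mul (fun y hyI => ContinuousAt.continuousWithinAt ?_) hf
    exact ContinuousAt.comp (f := fun y : ℝ => (x, y, t)) (x := y)
      (g := fun X : ℝ × ℝ × ℝ => tailKernel X.1 X.2.1 X.2.2)
      (contDiffAt_tailKernel (X := (x, y, t)) hx (hy y hyI)).continuousAt (by fun_prop)
  have e1 : ∀ F : ℝ → ℝ, ∫ z, F (x - Real.sqrt t * z) ∂stdMeasure = ∫ y, heatKernel (x - y) t * F y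
      := fun F => by
    have := gaussAvg_eq_integral (φ := fun _ => 1) (F := F) ht x
    simpa [gaussAvg] using this
  have e2 : ∀ {s : Set ℝ}, MeasurableSet s → s =ᵐ[volume] Ioc (-1 : ℝ) 1 → ∀ k : ℝ → ℝ,
      ∫ y, k y * s.indicator fI y = ∫ y in (-1 : ℝ)..1, k y * fI y := by
    intro s hs hae k
    rw [intervalIntegral.integral_of_le (by norm_num), ← setIntegral_congr_set hae,
      ← integral_indicator hs]
    refine integral_congr_ae (ae_of_all _ fun y => ?_)
    by_cases h : y ∈ s <;> simp [h]
  have i1 : Integrable (fun z => (Ioc (-1 : ℝ) 1).indicator fI (x - Real.sqrt t * z)) stdMeasure :=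
    integrable_of_abs_le (hm1.comp (by fun_prop)).aestronglyMeasurable
      fun z => abs_indicator_le hM Ioc_subset_Icc_self _
  have i2 : Integrable (fun z => (Ioo (-1 : ℝ) 1).indicator fI (2 - (x - Real.sqrt t * z)))
      stdMeasure :=
    integrable_of_abs_le (hm2.comp (by fun_prop)).aestronglyMeasurable
      fun z => abs_indicator_le hM Ioo_subset_Icc_self _
  have i3 : Integrable (fun z => (Ico (-1 : ℝ) 1).indicator fI (-2 - (x - Real.sqrt t * z)))
      stdMeasure :=
    integrable_of_abs_le (hm3.comp (by fun_prop)).aestronglyMeasurable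
      fun z => abs_indicator_le hM Ico_subset_Icc_self _
  have hrefl : ∀ (c : ℝ) (F : ℝ → ℝ), ∫ y, heatKernel (x - y) t * F (c - y) =
      ∫ y, heatKernel (x - (c - y)) t * F y := fun c F => by
    rw [← integral_sub_left_eq_self _ volume c]
    simp only [sub_sub_cancel]
  have j1 := c (fun y => x - y) (by fun_prop)
  have j2 := c (fun y => x - (2 - y)) (by fun_prop)
  have j3 := c (fun y => x - (-2 - y)) (by fun_prop)
  have e3 : ∫ z, evenExtension fI (x - Real.sqrt t * z) ∂stdMeasure =
      (∫ y in (-1 : ℝ)..1, heatKernel (x - y) t * fI y)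
        + (∫ y in (-1 : ℝ)..1, heatKernel (x - (2 - y)) t * fI y)
        + ∫ y in (-1 : ℝ)..1, heatKernel (x - (-2 - y)) t * fI y := by
    refine (integral_add (i1.add i2) i3).trans ?_
    refine (congrArg (· + _) (integral_add i1 i2)).trans ?_
    rw [e1, e1 (fun y => (Ioo (-1 : ℝ) 1).indicator fI (2 - y)),
      e1 (fun y => (Ico (-1 : ℝ) 1).indicator fI (-2 - y)), hrefl, hrefl,
      e2 measurableSet_Ioc (ae_eq_refl _), e2 measurableSet_Ioo Ioo_ae_eq_Ioc,
      e2 measurableSet_Ico Ico_ae_eq_Ioc]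
  rw [e3, ← intervalIntegral.integral_add j1 j2,
    ← intervalIntegral.integral_add (j1.add j2) j3,
    ← intervalIntegral.integral_add ((j1.add j2).add j3) ct]
  refine intervalIntegral.integral_congr fun y hyI => ?_
  rw [hu] at hyI
  simp only [neumannKernel_eq hx (hy y hyI)]
  ring

/-- The evolution of the initial data, with its value `fI` at time `0`. -/
theorem continuousOn_initialPart (hf : ContinuousOn fI (Icc (-1) 1)) :
    ContinuousOn (fun z : ℝ × ℝ => if z.2 ≤ 0 then fI z.1 else initialPart fI z.1 z.2)
      (Icc (-1) 1 ×ˢ Ici 0) := by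
  obtain ⟨M, hM⟩ := isCompact_Icc.exists_bound_of_continuousOn hf
  simp only [Real.norm_eq_abs] at hM
  have hy : ∀ y ∈ Icc (-1 : ℝ) 1, |y| < 3 / 2 := fun y hy =>
    lt_of_le_of_lt (abs_le.2 hy) (by norm_num)
  rintro ⟨x, t⟩ ⟨hx, ht⟩
  simp only [mem_Ici] at hx ht
  rcases ht.eq_or_lt with rfl | ht
  · have c1 : ContinuousAt (fun z : ℝ × ℝ => ∫ w, evenExtension fI (z.1 - Real.sqrt z.2 * w)
        ∂stdMeasure) (x, 0) := by
      refine continuousAt_of_dominated (bound := fun _ => M + M + M) (Eventually.of_forall fun z =>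
        ((measurable_evenExtension hf).comp (by fun_prop)).aestronglyMeasurable)
        (Eventually.of_forall fun z => ae_of_all _ fun w => ?_) (integrable_const _)
        (ae_of_all _ fun w => ?_)
      · exact (abs_add_le _ _).trans (add_le_add ((abs_add_le _ _).trans (add_le_add
          (abs_indicator_le hM Ioc_subset_Icc_self _) (abs_indicator_le hM Ioo_subset_Icc_self _)))
          (abs_indicator_le hM Ico_subset_Icc_self _))
      · refine ContinuousAt.comp (f := fun z : ℝ × ℝ => z.1 - Real.sqrt z.2 * w) (x := (x, 0))
          (g := evenExtension fI) ?_
          (by fun_prop)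
        simpa using continuousAt_evenExtension hf hx
    have c2 : ContinuousAt (fun z : ℝ × ℝ => ∫ y in (-1 : ℝ)..1, tailKernel z.1 y z.2 * fI y)
        (x, 0) :=
      (contDiffAt_intervalIntegral (P := ℝ) (X₀ := (x, (0 : ℝ)))
        (H := fun q => tailKernel q.1.1 q.2 q.1.2) (π := fun y => y) (α := -1) (β := 1)
        (by norm_num) continuousOn_id hf (fun y hyI =>
          ContDiffAt.comp (f := fun q : (ℝ × ℝ) × ℝ => (q.1.1, q.2, q.1.2)) ((x, 0), y)
            (contDiffAt_tailKernel (X := (x, y, 0)) (hy x hx) (hy y hyI))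
            (by fun_prop))).1.continuousAt
    refine (c1.add c2).continuousWithinAt.congr (fun z hz => ?_) ?_
    · rcases (show (0 : ℝ) ≤ z.2 from hz.2).eq_or_lt with h | h
      · rw [if_pos h.ge]
        simp [← h, tailKernel_of_nonpos, evenExtension_of_mem hz.1]
      · rw [if_neg (not_le.2 h), initialPart_eq_gaussian hf hM (hy _ hz.1) h, Pi.add_apply]
    · simp [tailKernel_of_nonpos, evenExtension_of_mem hx]
  · refine ContinuousAt.continuousWithinAt ?_
    refine (contDiffAt_initialPart hf (hy x hx) ht).1.continuousAt.congr ?_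
    have c : ContinuousAt (fun z : ℝ × ℝ => z.2) (x, t) := by fun_prop
    filter_upwards [c.eventually (lt_mem_nhds ht)] with z hz
    rw [if_neg (not_le.2 hz)]

end InitialTrace

/-! ### The global candidate defined by Duhamel's formula -/

section Solution

variable {a a₀ T δ lam : ℝ} {fI p l : ℝ → ℝ} {pI : ℝ}

theorem sourcePart_congr {q q' l' : ℝ → ℝ} (hT : 0 ≤ T) (hq : EqOn q q' (Icc 0 T))
    (hl : EqOn l l' (Icc 0 T)) : sourcePart T q l = sourcePart T q' l' := by
  ext x t
  refine intervalIntegral.integral_congr fun s hs => ?_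
  rw [uIcc_of_le hT] at hs
  simp only [hq hs, hl hs]

theorem sourcePart_zero (q l : ℝ → ℝ) (hT : 0 ≤ T) (x : ℝ) : sourcePart T q l x 0 = 0 := by
  rw [sourcePart, intervalIntegral.integral_congr (g := fun _ => 0),
    intervalIntegral.integral_zero]
  intro s hs
  rw [uIcc_of_le hT] at hs
  simp only [neumannKernel_of_nonpos x (q s) (show 0 - s ≤ 0 by linarith [hs.1]), zero_mul]

/-- The right hand side of Duhamel's formula, with its value `fI` at time `0`. -/
noncomputable def duhamelSolution (a T : ℝ) (fI p l : ℝ → ℝ) (x t : ℝ) : ℝ :=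
  if t ≤ 0 then fI x else duhamelSum a T fI p l x t

theorem duhamelSolution_zero (x : ℝ) : duhamelSolution a T fI p l x 0 = fI x := if_pos le_rfl

theorem duhamelSolution_of_pos {t : ℝ} (ht : 0 < t) (x : ℝ) :
    duhamelSolution a T fI p l x t = duhamelSum a T fI p l x t := if_neg (not_le.2 ht)

theorem continuousOn_duhamelSolution (hf : ContinuousOn fI (Icc (-1) 1)) (ha : 0 < a)
    (hp : Continuous p) (hl : Continuous l) (hpm : ∀ s, p s ∈ Icc (-1 : ℝ) 1) (hT0 : 0 ≤ T)
    (hT1 : T ≤ 1) :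
    ContinuousOn (fun z : ℝ × ℝ => duhamelSolution a T fI p l z.1 z.2)
      (Icc (-1) 1 ×ˢ Icc 0 T) := by
  have hd : Continuous fun s => sourceDist a (p s) := (continuous_sourceDist a).comp hp
  have h1 := (continuousOn_initialPart hf).mono
    (prod_mono_right Icc_subset_Ici_self : Icc (-1 : ℝ) 1 ×ˢ Icc 0 T ⊆ Icc (-1) 1 ×ˢ Ici 0)
  have h2 := continuousOn_sourcePart (q := fun s => p s - sourceDist a (p s)) (hp.sub hd)
    (fun s => (source_mem (hpm s) ha).1) hl hT0 hT1
  have h3 := continuousOn_sourcePart (q := fun s => p s + sourceDist a (p s)) (hp.add hd)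
    (fun s => (source_mem (hpm s) ha).2) hl hT0 hT1
  refine (h1.add (h2.sub h3)).congr fun z hz => ?_
  rcases hz.2.1.eq_or_lt with h | h
  · simp [duhamelSolution, ← h, sourcePart_zero _ _ hT0]
  · simp [duhamelSolution, not_le.2 h, duhamelSum]

/-- A local solution can be taken constant outside `[0,T]`. -/
theorem LocalSolution.exists_extension (hT : 0 ≤ T) (h : LocalSolution a T δ lam fI pI p l) :
    ∃ p' l' : ℝ → ℝ, LocalSolution a T δ lam fI pI p' l' ∧
      (∀ s, p' s ∈ Icc (pI - δ) (pI + δ)) ∧ ∀ s, lam / 4 ≤ l' s := by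
  have hc : Continuous fun s => (projIcc 0 T hT s : ℝ) :=
    continuous_subtype_val.comp continuous_projIcc
  have he : ∀ s ∈ Icc 0 T, (projIcc 0 T hT s : ℝ) = s := fun s hs => by rw [projIcc_of_mem hT hs]
  have e : duhamelSum a T fI (fun s => p (projIcc 0 T hT s)) (fun s => l (projIcc 0 T hT s)) =
      duhamelSum a T fI p l := by
    ext x t
    unfold duhamelSum
    rw [sourcePart_congr (l' := l) hT (q := fun s => p (projIcc 0 T hT s) -
        sourceDist a (p (projIcc 0 T hT s))) (q' := fun s => p s - sourceDist a (p s))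
        (fun s hs => by simp only [he s hs]) (fun s hs => by simp only [he s hs]),
      sourcePart_congr (l' := l) hT (q := fun s => p (projIcc 0 T hT s) +
        sourceDist a (p (projIcc 0 T hT s))) (q' := fun s => p s + sourceDist a (p s))
        (fun s hs => by simp only [he s hs]) (fun s hs => by simp only [he s hs])]
  have h0 := he 0 (left_mem_Icc.2 hT)
  refine ⟨fun s => p (projIcc 0 T hT s), fun s => l (projIcc 0 T hT s), ?_,
    fun s => h.mem _ (projIcc 0 T hT s).2, fun s => h.flux_ge _ (projIcc 0 T hT s).2⟩
  refine ⟨h.continuous_p.comp hc, h.continuous_l.comp hc, fun t _ => h.mem _ (projIcc 0 T hT t).2,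
    fun t _ => h.flux_ge _ (projIcc 0 T hT t).2, by rw [h0, h.p_zero], by rw [h0, h.l_zero],
    fun t ht => ?_, fun t ht => ?_, ?_, ?_, ?_, ?_⟩
  · rw [e, he t (Ioc_subset_Icc_self ht)]; exact h.zero t ht
  · rw [e, he t (Ioc_subset_Icc_self ht)]; exact h.hasDerivAt t ht
  · rw [e]; exact h.decreasing
  · rw [e]; exact h.left
  · rw [e]; exact h.right
  · obtain ⟨c, hc0, hc1⟩ := h.sqrt_bound
    exact ⟨c, hc0, fun t ht => by rw [he t ht]; exact hc1 t ht⟩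

end Solution

/-! ### The minimum principle with a reflecting end point -/

section MaximumPrinciple

/-- A negative second derivative would make the point a local maximum as well, so the function would
be locally constant. -/
theorem iteratedDeriv_two_nonneg_of_isLocalMin {f : ℝ → ℝ} {x : ℝ} (h : IsLocalMin f x)
    (hc : ContinuousAt f x) : 0 ≤ iteratedDeriv 2 f x := by
  rw [iteratedDeriv_succ, iteratedDeriv_one]
  by_contra! hneg
  have h1 := isLocalMax_of_deriv_deriv_neg hneg h.deriv_eq_zero hc
  have h2 : f =ᶠ[𝓝 x] fun _ => f x := by
    filter_upwards [h, h1] with y hy hy' using le_antisymm hy' hy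
  have h3 : deriv f =ᶠ[𝓝 x] fun _ => 0 :=
    h2.eventuallyEq_nhds.mono fun y hy => by rw [hy.deriv_eq, deriv_const]
  rw [h3.deriv_eq, deriv_const] at hneg
  exact lt_irrefl _ hneg

/-- Only earlier times are compared, so the lemma applies to a minimum attained at the final time.
-/
theorem deriv_nonpos_of_left {f : ℝ → ℝ} {f' t : ℝ} (hd : HasDerivAt f f' t)
    (h : ∀ᶠ s in 𝓝[<] t, f t ≤ f s) : f' ≤ 0 := by
  refine le_of_tendsto (hasDerivAt_iff_tendsto_slope_left_right.1 hd).1 ?_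
  filter_upwards [h, self_mem_nhdsWithin] with s hs hst
  rw [slope_def_field]
  exact div_nonpos_of_nonneg_of_nonpos (sub_nonneg.2 hs) (sub_nonpos.2 (le_of_lt hst))

/-- Weak minimum principle for supersolutions on `[-1,b] × [0,T]` that are even about `x = -1`. -/
theorem le_of_heatOp_nonneg {u : ℝ × ℝ → ℝ} {b T m : ℝ} (hb : -1 < b)
    (hc : ContinuousOn u (Icc (-1) b ×ˢ Icc 0 T))
    (hs : ∀ x ∈ Ico (-1) b, ∀ t ∈ Ioc 0 T, ContDiffAt ℝ ∞ u (x, t))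
    (hh : ∀ x ∈ Ico (-1) b, ∀ t ∈ Ioc 0 T, 0 ≤ heatOp u (x, t))
    (he : ∀ x t, 0 < t → u (-2 - x, t) = u (x, t))
    (h0 : ∀ x ∈ Icc (-1) b, m ≤ u (x, 0)) (h1 : ∀ t ∈ Icc 0 T, m ≤ u (b, t)) :
    ∀ x ∈ Icc (-1) b, ∀ t ∈ Icc 0 T, m ≤ u (x, t) := by
  intro x₀ hx₀ t₀ ht₀
  by_contra! hlt
  have hT : 0 ≤ T := ht₀.1.trans ht₀.2
  -- Adding κt makes the supersolution strict: at a minimum of u + κt one has u_t ≤ -κ and u_xx ≥ 0,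
  -- against u_t ≥ u_xx.
  obtain ⟨κ, hκ, hκ'⟩ : ∃ κ : ℝ, 0 < κ ∧ u (x₀, t₀) + κ * t₀ < m := by
    refine ⟨(m - u (x₀, t₀)) / (2 * (t₀ + 1)), div_pos (by linarith) (by linarith [ht₀.1]), ?_⟩
    have e : (m - u (x₀, t₀)) / (2 * (t₀ + 1)) * t₀ =
        (m - u (x₀, t₀)) / 2 * (t₀ / (t₀ + 1)) := by
      have : t₀ + 1 ≠ 0 := by linarith [ht₀.1]
      field_simp
    have e2 : t₀ / (t₀ + 1) ≤ 1 := (div_le_one (by linarith [ht₀.1])).2 (by linarith)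
    rw [e]
    nlinarith
  obtain ⟨⟨x₁, t₁⟩, ⟨hx₁, ht₁⟩, hmin⟩ := (isCompact_Icc.prod isCompact_Icc).exists_isMinOn
    (s := Icc (-1) b ×ˢ Icc 0 T) ⟨(x₀, t₀), hx₀, ht₀⟩
    (f := fun z : ℝ × ℝ => u z + κ * z.2) (hc.add (by fun_prop))
  simp only at hx₁ ht₁
  rw [isMinOn_iff] at hmin
  have hle := hmin (x₀, t₀) ⟨hx₀, ht₀⟩
  simp only at hle
  have hκt := mul_nonneg hκ.le ht₁.1
  have ht₁' : 0 < t₁ := by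
    refine ht₁.1.lt_of_ne ?_
    rintro rfl
    linarith [h0 x₁ hx₁]
  have hx₁' : x₁ < b := by
    refine hx₁.2.lt_of_ne ?_
    rintro rfl
    linarith [h1 t₁ ht₁]
  have hsm := hs x₁ ⟨hx₁.1, hx₁'⟩ t₁ ⟨ht₁', ht₁.2⟩
  have hH := hh x₁ ⟨hx₁.1, hx₁'⟩ t₁ ⟨ht₁', ht₁.2⟩
  rw [heatOp_eq_deriv hsm] at hH
  -- Evenness about -1 extends the comparison to points left of -1, so a minimum at -1 is an
  -- interior one.
  have hlm : IsLocalMin (fun y => u (y, t₁)) x₁ := by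
    filter_upwards [Ioo_mem_nhds (show -2 - b < x₁ by linarith [hx₁.1]) hx₁'] with y hy
    rcases le_total (-1) y with h | h
    · have := hmin (y, t₁) ⟨⟨h, hy.2.le⟩, ht₁⟩
      simp only at this; linarith
    · have := hmin (-2 - y, t₁) ⟨⟨by linarith, by linarith [hy.1]⟩, ht₁⟩
      simp only [he y t₁ ht₁'] at this; linarith
  have hxx := iteratedDeriv_two_nonneg_of_isLocalMin hlm
    (ContinuousAt.comp (f := fun y : ℝ => (y, t₁)) (x := x₁) (g := u) hsm.continuousAt
      (by fun_prop))
  have hdt : DifferentiableAt ℝ (fun s => u (x₁, s)) t₁ :=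
    DifferentiableAt.comp (f := fun s : ℝ => (x₁, s)) t₁ (hsm.differentiableAt (by simp))
      (by fun_prop)
  have hd := deriv_nonpos_of_left (hdt.hasDerivAt.add ((hasDerivAt_id t₁).const_mul κ)) (by
    filter_upwards [Ioo_mem_nhdsLT ht₁'] with s hs'
    have := hmin (x₁, s) ⟨hx₁, hs'.1.le, hs'.2.le.trans ht₁.2⟩
    simpa using this)
  linarith

end MaximumPrinciple

/-! ### Smooth approximation of the source from below -/

section DelayedSource

/-- A smooth function of time that vanishes for `τ ≤ ε` and equals one for `τ ≥ 2ε`. -/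
noncomputable def delay (ε τ : ℝ) : ℝ := Real.smoothTransition (τ / ε - 1)

theorem contDiff_delay (ε : ℝ) : ContDiff ℝ ∞ (delay ε) :=
  Real.smoothTransition.contDiff.comp (by fun_prop)

theorem delay_eq_zero {ε τ : ℝ} (hε : 0 < ε) (h : τ ≤ ε) : delay ε τ = 0 :=
  Real.smoothTransition.zero_of_nonpos (by linarith [(div_le_one hε).2 h])

theorem delay_eq_one {ε τ : ℝ} (hε : 0 < ε) (h : 2 * ε ≤ τ) : delay ε τ = 1 :=
  Real.smoothTransition.one_of_one_le (by linarith [(le_div_iff₀ hε).2 h])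

theorem delay_nonneg (ε τ : ℝ) : 0 ≤ delay ε τ := Real.smoothTransition.nonneg _

theorem delay_le_one (ε τ : ℝ) : delay ε τ ≤ 1 := Real.smoothTransition.le_one _

theorem deriv_delay_nonneg {ε : ℝ} (hε : 0 < ε) (τ : ℝ) : 0 ≤ deriv (delay ε) τ := by
  refine Monotone.deriv_nonneg fun s t hst => Real.smoothTransition.monotone ?_
  have := div_le_div_of_nonneg_right hst hε.le
  linarith

/-- The Neumann heat kernel, switched on after time `ε`. -/
noncomputable def delayedKernel (ε x y τ : ℝ) : ℝ := delay ε τ * neumannKernel x y τ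

variable {ε : ℝ}

theorem delayedKernel_eventuallyEq_zero (hε : 0 < ε) {X : ℝ × ℝ × ℝ} (h : X.2.2 < ε) :
    (fun X : ℝ × ℝ × ℝ => delayedKernel ε X.1 X.2.1 X.2.2) =ᶠ[𝓝 X] fun _ => 0 := by
  have c : ContinuousAt (fun X : ℝ × ℝ × ℝ => X.2.2) X := by fun_prop
  filter_upwards [c.eventually (gt_mem_nhds h)] with Y hY
  rw [delayedKernel, delay_eq_zero hε hY.le, zero_mul]

theorem contDiffAt_delayedKernel (hε : 0 < ε) {X : ℝ × ℝ × ℝ} (hx : |X.1| < 3 / 2)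
    (hy : |X.2.1| < 3 / 2) :
    ContDiffAt ℝ ∞ (fun X : ℝ × ℝ × ℝ => delayedKernel ε X.1 X.2.1 X.2.2) X := by
  rcases lt_or_ge X.2.2 ε with h | h
  · exact contDiffAt_const.congr_of_eventuallyEq (delayedKernel_eventuallyEq_zero hε h)
  · exact ((contDiff_delay ε).contDiffAt.comp X (by fun_prop)).mul
      (contDiffAt_neumannKernel hx hy (Or.inr (by linarith)))

/-- With η the switch, the heat operator of ηΓ is η'Γ plus η times that of Γ, that is η'Γ ≥ 0. The
delayed source is thus a smooth supersolution even on the path of the source. -/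
theorem heatOp_delayedKernel_nonneg (hε : 0 < ε) {x y t s : ℝ} (hx : |x| < 3 / 2)
    (hy : |y| < 3 / 2) : 0 ≤ heatOp (fun r => delayedKernel ε r.1 y (r.2 - s)) (x, t) := by
  have hs : ContDiffAt ℝ ∞ (fun r : ℝ × ℝ => delayedKernel ε r.1 y (r.2 - s)) (x, t) :=
    ContDiffAt.comp (f := fun r : ℝ × ℝ => (r.1, y, r.2 - s)) (x, t)
      (contDiffAt_delayedKernel (X := (x, y, t - s)) hε hx hy) (by fun_prop)
  rcases lt_or_ge (t - s) ε with h | h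
  · have c : ContinuousAt (fun r : ℝ × ℝ => r.2 - s) (x, t) := by fun_prop
    have e : (fun r : ℝ × ℝ => delayedKernel ε r.1 y (r.2 - s)) =ᶠ[𝓝 (x, t)] fun _ => 0 := by
      filter_upwards [c.eventually (gt_mem_nhds h)] with r hr
      rw [delayedKernel, delay_eq_zero hε hr.le, zero_mul]
    rw [heatOp_congr e]
    simp [heatOp]
  · have hts : t ≠ s := by rintro rfl; linarith [sub_self t]
    have hk : ContDiffAt ℝ ∞ (fun r : ℝ × ℝ => neumannKernel r.1 y (r.2 - s)) (x, t) :=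
      ContDiffAt.comp (f := fun r : ℝ × ℝ => (r.1, y, r.2 - s)) (x, t)
        (contDiffAt_neumannKernel (X := (x, y, t - s)) hx hy (Or.inr (by linarith)))
        (by fun_prop)
    have hz := heatOp_neumannKernel hx hy hts
    rw [heatOp_eq_deriv hk] at hz
    rw [heatOp_eq_deriv hs]
    have hkt : DifferentiableAt ℝ (fun r => neumannKernel x y (r - s)) t :=
      DifferentiableAt.comp (f := fun r : ℝ => (x, r)) t (hk.differentiableAt (by simp))
        (by fun_prop)
    have hη : HasDerivAt (fun r => delay ε (r - s)) (deriv (delay ε) (t - s)) t :=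
      (((contDiff_delay ε).differentiable (by simp) (t - s)).hasDerivAt).comp_sub_const t s
    have e1 := (hη.mul hkt.hasDerivAt).deriv
    have hkx : ContDiffAt ℝ 2 (fun z => neumannKernel z y (t - s)) x :=
      ContDiffAt.comp (f := fun r : ℝ => (r, t)) x
        (hk.of_le ENat.LEInfty.out) (by fun_prop)
    have e2 := iteratedDeriv_const_mul (n := 2) (delay ε (t - s)) hkx
    simp only [delayedKernel]
    have e1' : deriv (fun r => delay ε (r - s) * neumannKernel x y (r - s)) t = _ := e1
    rw [e1', e2]
    have h1 := mul_nonneg (deriv_delay_nonneg hε (t - s)) (neumannKernel_nonneg x y (t - s))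
    have h2 : delay ε (t - s) * (deriv (fun r => neumannKernel x y (r - s)) t -
      iteratedDeriv 2 (fun z => neumannKernel z y (t - s)) x) = 0 := by
      rw [hz, mul_zero]
    linarith

/-- The contribution of a moving source with the kernel `delayedKernel ε`. -/
noncomputable def delayedSource (ε T : ℝ) (q l : ℝ → ℝ) (x t : ℝ) : ℝ :=
  ∫ s in (0 : ℝ)..T, delayedKernel ε x (q s) (t - s) * l s

variable {T : ℝ} {q l : ℝ → ℝ}

theorem contDiffAt_delayedSource (hε : 0 < ε) (hT : 0 ≤ T) (hq : Continuous q)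
    (hqm : ∀ s, q s ∈ Icc (-1 : ℝ) 1) (hl : Continuous l) (hl0 : ∀ s, 0 ≤ l s) {x : ℝ}
    (hx : |x| < 3 / 2) (t : ℝ) :
    ContDiffAt ℝ ∞ (fun r : ℝ × ℝ => delayedSource ε T q l r.1 r.2) (x, t) ∧
      0 ≤ heatOp (fun r : ℝ × ℝ => delayedSource ε T q l r.1 r.2) (x, t) := by
  have hy : ∀ s, |q s| < 3 / 2 := fun s => lt_of_le_of_lt (abs_le.2 (hqm s)) (by norm_num)
  obtain ⟨h1, h2⟩ := contDiffAt_movingSource (G := delayedKernel ε) hT hq.continuousOn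
    hl.continuousOn (x := x) (t := t)
    (fun s _ => contDiffAt_delayedKernel (X := (x, q s, t - s)) hε hx (hy s))
  refine ⟨h1, h2.symm ▸ intervalIntegral.integral_nonneg hT fun s _ => ?_⟩
  exact mul_nonneg (heatOp_delayedKernel_nonneg hε hx (hy s)) (hl0 s)

theorem delayedSource_zero (hε : 0 < ε) (hT : 0 ≤ T) (x : ℝ) :
    delayedSource ε T q l x 0 = 0 := by
  rw [delayedSource, intervalIntegral.integral_congr (g := fun _ => 0),
    intervalIntegral.integral_zero]
  intro s hs
  rw [uIcc_of_le hT] at hs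
  simp only [delayedKernel, delay_eq_zero hε (show 0 - s ≤ ε by linarith [hs.1]), zero_mul]

theorem intervalIntegrable_delayedSource (hε : 0 < ε) (hq : Continuous q)
    (hqm : ∀ s, q s ∈ Icc (-1 : ℝ) 1) (hl : Continuous l) {x : ℝ} (hx : |x| < 3 / 2) (t : ℝ) :
    IntervalIntegrable (fun s => delayedKernel ε x (q s) (t - s) * l s) volume 0 T := by
  have hy : ∀ s, |q s| < 3 / 2 := fun s => lt_of_le_of_lt (abs_le.2 (hqm s)) (by norm_num)
  refine Continuous.intervalIntegrable (Continuous.mul ?_ hl) 0 T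
  refine continuous_iff_continuousAt.2 fun s => ?_
  exact ContinuousAt.comp (f := fun s => (x, q s, t - s)) (x := s)
    (g := fun X : ℝ × ℝ × ℝ => delayedKernel ε X.1 X.2.1 X.2.2)
    (contDiffAt_delayedKernel (X := (x, q s, t - s)) hε hx (hy s)).continuousAt (by fun_prop)

theorem delayedSource_le_sourcePart (hε : 0 < ε) (hT0 : 0 ≤ T) (hT1 : T ≤ 1) (hq : Continuous q)
    (hqm : ∀ s, q s ∈ Icc (-1 : ℝ) 1) (hl : Continuous l) (hl0 : ∀ s, 0 ≤ l s) {x t : ℝ}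
    (hx : x ∈ Icc (-1 : ℝ) 1) (ht : t ≤ T) : delayedSource ε T q l x t ≤ sourcePart T q l x t := by
  refine intervalIntegral.integral_mono_on hT0 (intervalIntegrable_delayedSource hε hq hqm hl
    (lt_of_le_of_lt (abs_le.2 hx) (by norm_num)) t)
    (intervalIntegrable_sourcePart hq hqm hl hT0 hT1 hx ht) fun s _ => ?_
  refine mul_le_mul_of_nonneg_right ?_ (hl0 s)
  exact mul_le_of_le_one_left (neumannKernel_nonneg _ _ _) (delay_le_one _ _)

/-- The two integrands differ only for lags between 0 and 2ε, where the difference is at most B. -/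
theorem sourcePart_le_delayedSource_add (hε : 0 < ε) (hT0 : 0 ≤ T) (hT1 : T ≤ 1)
    (hq : Continuous q) (hqm : ∀ s, q s ∈ Icc (-1 : ℝ) 1) (hl : Continuous l) {x t B : ℝ}
    (hx : x ∈ Icc (-1 : ℝ) 1) (ht : t ≤ T) (hB : 0 ≤ B)
    (hb : ∀ s ∈ Icc 0 T, neumannKernel x (q s) (t - s) * l s ≤ B) (hl0 : ∀ s, 0 ≤ l s) :
    sourcePart T q l x t ≤ delayedSource ε T q l x t + 2 * ε * B := by
  have i1 := intervalIntegrable_sourcePart hq hqm hl hT0 hT1 hx ht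
  have i2 := intervalIntegrable_delayedSource (T := T) hε hq hqm hl
    (lt_of_le_of_lt (abs_le.2 hx) (by norm_num)) t
  rw [← sub_le_iff_le_add', sourcePart, delayedSource, ← intervalIntegral.integral_sub i1 i2,
    intervalIntegral.integral_of_le hT0]
  have hI : Integrable ((Ioc (t - 2 * ε) t).indicator fun _ => B) :=
    (integrable_indicator_iff measurableSet_Ioc).2 (integrableOn_const measure_Ioc_lt_top.ne)
  have hI0 : ∀ s, 0 ≤ (Ioc (t - 2 * ε) t).indicator (fun _ => B) s :=
    indicator_nonneg fun _ _ => hB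
  calc _ ≤ ∫ s in Ioc 0 T, (Ioc (t - 2 * ε) t).indicator (fun _ => B) s := by
        refine setIntegral_mono_on (i1.sub i2).1 hI.integrableOn measurableSet_Ioc fun s hs => ?_
        have hn := neumannKernel_nonneg x (q s) (t - s)
        by_cases hm : s ∈ Ioc (t - 2 * ε) t
        · rw [indicator_of_mem hm]
          refine le_trans ?_ (hb s (Ioc_subset_Icc_self hs))
          exact sub_le_self _ (mul_nonneg (mul_nonneg (delay_nonneg _ _) hn) (hl0 s))
        · rw [indicator_of_notMem hm]
          rcases le_or_gt s (t - 2 * ε) with h | h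
          · rw [delayedKernel, delay_eq_one hε (by linarith), one_mul, sub_self]
          · have h' : t < s := by
              by_contra! hle; exact hm ⟨h, hle⟩
            rw [delayedKernel, neumannKernel_of_nonpos x (q s) (by linarith)]
            simp
    _ ≤ ∫ s, (Ioc (t - 2 * ε) t).indicator (fun _ => B) s :=
        setIntegral_le_integral hI (ae_of_all _ hI0)
    _ = 2 * ε * B := by
        rw [integral_indicator measurableSet_Ioc, setIntegral_const]
        simp [Measure.real, hε.le]

end DelayedSource

/-! ### Sign of the solution on either side of the free boundary -/

section Sign

variable {T b c m : ℝ} {fI q q' l : ℝ → ℝ}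

/-- Seen from x = b, sources at y ≤ c < b never come close, so the kernel is continuous on a compact
set including t = 0. -/
theorem exists_neumannKernel_le_of_lt (hb : b < 1) (hcb : c < b) :
    ∃ A, 0 ≤ A ∧ ∀ y ∈ Icc (-1) c, ∀ t, t ≤ 1 → neumannKernel b y t ≤ A := by
  rcases lt_or_ge c (-1) with h | h
  · exact ⟨0, le_rfl, fun y hy => absurd (hy.1.trans hy.2) (not_le.2 h)⟩
  have hK : IsCompact (Icc (-1) c ×ˢ Icc (0 : ℝ) 1) := isCompact_Icc.prod isCompact_Icc
  have hc : ContinuousOn (fun z : ℝ × ℝ => neumannKernel b z.1 z.2) (Icc (-1) c ×ˢ Icc 0 1) := by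
    rintro ⟨y, t⟩ ⟨hy, -⟩
    refine ContinuousAt.continuousWithinAt ?_
    have hy1 := hy.1
    have hy2 := hy.2
    simp only at hy1 hy2
    exact ContinuousAt.comp (f := fun z : ℝ × ℝ => (b, z.1, z.2)) (x := (y, t))
      (g := fun X : ℝ × ℝ × ℝ => neumannKernel X.1 X.2.1 X.2.2)
      (contDiffAt_neumannKernel (X := (b, y, t)) (abs_lt.2 ⟨by linarith, by linarith⟩)
        (abs_lt.2 ⟨by linarith, by linarith⟩) (Or.inl ⟨by simp only; linarith,
          by simp only; linarith, by simp only; linarith⟩)).continuousAt (by fun_prop)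
  obtain ⟨A, hA⟩ := hK.exists_bound_of_continuousOn hc
  refine ⟨|A|, abs_nonneg _, fun y hy t ht => ?_⟩
  rcases le_or_gt t 0 with h0 | h0
  · rw [neumannKernel_of_nonpos _ _ h0]; exact abs_nonneg _
  · exact (le_abs_self _).trans ((hA (y, t) ⟨hy, h0.le, ht⟩).trans (le_abs_self _))

/-- If the solution with a source at `q ≤ c < b` and a sink at `q' > b` is bounded below by `m > 0`
on `x = b`, and is initially positive on `[-1,b]`, then it stays positive there. -/
theorem pos_left_of_free_boundary (hf : ContinuousOn fI (Icc (-1) 1)) (hT0 : 0 ≤ T) (hT1 : T ≤ 1)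
    (hb : -1 < b) (hb1 : b < 1) (hcb : c < b) (hq : Continuous q) (hqm : ∀ s, q s ∈ Icc (-1) c)
    (hq' : Continuous q') (hqm' : ∀ s, q' s ∈ Ioc b 1) (hl : Continuous l)
    (hl0 : ∀ s, 0 ≤ l s) (hpos : ∀ x ∈ Icc (-1) b, 0 < fI x) (hm : 0 < m)
    (hbd : ∀ t ∈ Ioc 0 T, m ≤ initialPart fI b t + (sourcePart T q l b t - sourcePart T q' l b t)) :
    ∀ t ∈ Ioc 0 T, ∀ x ∈ Icc (-1) b,
      0 < initialPart fI x t + (sourcePart T q l x t - sourcePart T q' l x t) := by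
  have hqm1 : ∀ s, q s ∈ Icc (-1 : ℝ) 1 := fun s => ⟨(hqm s).1, by linarith [(hqm s).2]⟩
  have hqm1' : ∀ s, q' s ∈ Icc (-1 : ℝ) 1 := fun s => ⟨by linarith [(hqm' s).1], (hqm' s).2⟩
  have hbI : b ∈ Icc (-1 : ℝ) 1 := ⟨hb.le, hb1.le⟩
  obtain ⟨A, hA0, hA⟩ := exists_neumannKernel_le_of_lt hb1 hcb
  obtain ⟨Λ, hΛ⟩ := isCompact_Icc.exists_bound_of_continuousOn (s := Icc 0 T) hl.continuousOn
  obtain ⟨z, hz, hzmin⟩ := isCompact_Icc.exists_isMinOn (s := Icc (-1) b) ⟨b, hb.le, le_rfl⟩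
    (hf.mono (Icc_subset_Icc le_rfl hb1.le))
  rw [isMinOn_iff] at hzmin
  set B := A * |Λ| with hB
  have hB0 : 0 ≤ B := mul_nonneg hA0 (abs_nonneg _)
  -- Delaying the source costs at most half of the lower bound m at x = b.
  obtain ⟨ε, hε, hεB⟩ : ∃ ε : ℝ, 0 < ε ∧ 2 * ε * B ≤ m / 2 := by
    refine ⟨m / (4 * (B + 1)), by positivity, ?_⟩
    have e : 2 * (m / (4 * (B + 1))) * B = m / 2 * (B / (B + 1)) := by field_simp; ring
    have e2 : B / (B + 1) ≤ 1 := (div_le_one (by linarith)).2 (by linarith)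
    rw [e]
    nlinarith
  set m' := min (m / 2) (fI z) with hm'
  have hm0 : 0 < m' := lt_min (by linarith) (hpos z hz)
  have habs : ∀ {x}, x ∈ Icc (-1) b → |x| < 3 / 2 := fun hx =>
    abs_lt.2 ⟨by linarith [hx.1], by linarith [hx.2]⟩
  -- Only the source is delayed: the sink stays to the right of b and is already smooth on [-1,b).
  -- By positivity of l, the true solution dominates u.
  let u : ℝ × ℝ → ℝ := fun r => (if r.2 ≤ 0 then fI r.1 else initialPart fI r.1 r.2)
    + (delayedSource ε T q l r.1 r.2 - sourcePart T q' l r.1 r.2)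
  have hmain : ∀ x ∈ Icc (-1) b, ∀ t ∈ Icc 0 T, m' ≤ u (x, t) := by
    have key : ∀ x ∈ Ico (-1) b, ∀ t ∈ Ioc 0 T, ContDiffAt ℝ ∞ u (x, t) ∧
        0 ≤ heatOp u (x, t) := by
      intro x hx t ht
      have hx' : x ∈ Icc (-1) b := Ico_subset_Icc_self hx
      obtain ⟨s1, s2⟩ := contDiffAt_initialPart hf (habs hx') ht.1
      obtain ⟨s3, s4⟩ := contDiffAt_delayedSource hε hT0 hq hqm1 hl hl0 (habs hx') t
      obtain ⟨s5, s6⟩ := contDiffAt_sourcePart hT0 hq'.continuousOn hl.continuousOn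
        (fun s _ => hqm1' s) (habs hx') (t := t) (fun s _ _ => by
          have h1 := (hqm' t).1
          have h2 := (hqm' t).2
          have h3 := hx.1
          have h4 := hx.2
          exact ⟨by linarith, by linarith, by linarith⟩)
      have e : u =ᶠ[𝓝 (x, t)] fun r => initialPart fI r.1 r.2 +
          (delayedSource ε T q l r.1 r.2 - sourcePart T q' l r.1 r.2) := by
        have c : ContinuousAt (fun r : ℝ × ℝ => r.2) (x, t) := by fun_prop
        filter_upwards [c.eventually (lt_mem_nhds ht.1)] with r hr
        simp only [u, if_neg (not_le.2 hr)]
      refine ⟨(s1.add (s3.sub s5)).congr_of_eventuallyEq e, ?_⟩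
      rw [heatOp_congr e, heatOp_add s1 (s3.sub s5), heatOp_sub s3 s5, s2, s6]
      linarith
    refine le_of_heatOp_nonneg hb ?_ (fun x hx t ht => (key x hx t ht).1)
      (fun x hx t ht => (key x hx t ht).2) ?_ ?_ ?_
    · refine ((continuousOn_initialPart hf).mono
        (prod_mono (Icc_subset_Icc le_rfl hb1.le) Icc_subset_Ici_self)).add (ContinuousOn.sub ?_
        ((continuousOn_sourcePart hq' hqm1' hl hT0 hT1).mono
          (prod_mono (Icc_subset_Icc le_rfl hb1.le) subset_rfl)))
      exact fun r hr => (contDiffAt_delayedSource hε hT0 hq hqm1 hl hl0 (habs hr.1)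
        r.2).1.continuousAt.continuousWithinAt
    · intro x t ht
      simp [u, not_le.2 ht, initialPart, delayedSource, delayedKernel, sourcePart,
        neumannKernel_reflect_left]
    · intro x hx
      simp only [u, le_refl, if_true, delayedSource_zero hε hT0, sourcePart_zero _ _ hT0]
      linarith [hzmin x hx, min_le_right (m / 2) (fI z)]
    · intro t ht
      rcases ht.1.eq_or_lt with h | h
      · simp only [u, ← h, le_refl, if_true, delayedSource_zero hε hT0, sourcePart_zero _ _ hT0]
        linarith [hzmin b ⟨hb.le, le_rfl⟩, min_le_right (m / 2) (fI z)]
      · simp only [u, if_neg (not_le.2 h)]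
        have h1 := sourcePart_le_delayedSource_add hε hT0 hT1 hq hqm1 hl hbI ht.2 hB0
          (fun s hs => mul_le_mul (hA _ (hqm s) _ (by linarith [hs.1, ht.2]))
            ((le_abs_self _).trans ((hΛ s hs).trans (le_abs_self Λ))) (hl0 s) hA0) hl0
        linarith [hbd t ⟨h, ht.2⟩, min_le_left (m / 2) (fI z)]
  intro t ht x hx
  have h1 := hmain x hx t (Ioc_subset_Icc_self ht)
  simp only [u, if_neg (not_le.2 ht.1)] at h1
  have h2 := delayedSource_le_sourcePart hε hT0 hT1 hq hqm1 hl hl0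
    (show x ∈ Icc (-1 : ℝ) 1 from ⟨hx.1, hx.2.trans hb1.le⟩) ht.2
  linarith

theorem initialPart_neg (x t : ℝ) :
    initialPart (fun y => -fI (-y)) x t = -initialPart fI (-x) t := by
  have h := intervalIntegral.integral_comp_neg (a := -1) (b := 1)
    (fun y => neumannKernel (-x) y t * fI y)
  rw [neg_neg] at h
  rw [initialPart, initialPart, ← h, ← intervalIntegral.integral_neg]
  refine intervalIntegral.integral_congr fun y _ => ?_
  simp only [neumannKernel_neg_neg]
  ring

theorem sourcePart_neg (x t : ℝ) :
    sourcePart T (fun s => -q s) l x t = sourcePart T q l (-x) t := by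
  refine intervalIntegral.integral_congr fun s _ => ?_
  simp only
  rw [← neumannKernel_neg_neg (-x), neg_neg]

/-- The map f(x) ↦ -f(-x) exchanges source and sink and both sides of the boundary. -/
theorem neg_right_of_free_boundary (hf : ContinuousOn fI (Icc (-1) 1)) (hT0 : 0 ≤ T) (hT1 : T ≤ 1)
    (hb : -1 < b) (hb1 : b < 1) (hcb : b < c) (hq : Continuous q) (hqm : ∀ s, q s ∈ Ico (-1) b)
    (hq' : Continuous q') (hqm' : ∀ s, q' s ∈ Icc c 1) (hl : Continuous l)
    (hl0 : ∀ s, 0 ≤ l s) (hneg : ∀ x ∈ Icc b 1, fI x < 0) (hm : 0 < m)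
    (hbd : ∀ t ∈ Ioc 0 T,
      initialPart fI b t + (sourcePart T q l b t - sourcePart T q' l b t) ≤ -m) :
    ∀ t ∈ Ioc 0 T, ∀ x ∈ Icc b 1,
      initialPart fI x t + (sourcePart T q l x t - sourcePart T q' l x t) < 0 := by
  have h := pos_left_of_free_boundary (fI := fun y => -fI (-y)) (q := fun s => -q' s)
    (q' := fun s => -q s) (b := -b) (c := -c) (m := m) (l := l)
    ((hf.comp (by fun_prop) fun y hy => ⟨by linarith [hy.2], by linarith [hy.1]⟩).neg) hT0 hT1
    (by linarith) (by linarith) (by linarith) hq'.neg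
    (fun s => ⟨by linarith [(hqm' s).2], by linarith [(hqm' s).1]⟩) hq.neg
    (fun s => ⟨by linarith [(hqm s).2], by linarith [(hqm s).1]⟩) hl hl0
    (fun x hx => neg_pos.2 (hneg (-x) ⟨by linarith [hx.2], by linarith [hx.1]⟩)) hm
    (fun t ht => by
      have := hbd t ht
      simp only [initialPart_neg, sourcePart_neg, neg_neg]
      linarith)
  intro t ht x hx
  have h1 := h t ht (-x) ⟨by linarith [hx.2], by linarith [hx.1]⟩
  simp only [initialPart_neg, sourcePart_neg, neg_neg] at h1
  linarith

end Sign

/-! ### Verification of the solution properties -/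

section GlobalSolution

variable {a a₀ T δ lam : ℝ} {fI p l : ℝ → ℝ} {pI : ℝ}

theorem sourcePart_eq_integral_le {q : ℝ → ℝ} {x t : ℝ} (ht0 : 0 ≤ t) (ht : t ≤ T)
    (hi : IntervalIntegrable (fun s => neumannKernel x (q s) (t - s) * l s) volume 0 T) :
    sourcePart T q l x t = ∫ s in (0 : ℝ)..t, neumannKernel x (q s) (t - s) * l s := by
  have h0 : ∫ s in t..T, neumannKernel x (q s) (t - s) * l s = 0 := by
    rw [intervalIntegral.integral_congr (g := fun _ => 0), intervalIntegral.integral_zero]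
    intro s hs
    rw [uIcc_of_le ht] at hs
    simp only [neumannKernel_of_nonpos x (q s) (show t - s ≤ 0 by linarith [hs.1]), zero_mul]
  have h1 := hi.mono_set (uIcc_subset_uIcc_left (show t ∈ uIcc 0 T from
    uIcc_of_le (ht0.trans ht) ▸ ⟨ht0, ht⟩))
  have h2 := hi.mono_set (uIcc_subset_uIcc_right (show t ∈ uIcc 0 T from
    uIcc_of_le (ht0.trans ht) ▸ ⟨ht0, ht⟩))
  rw [sourcePart, ← intervalIntegral.integral_add_adjacent_intervals h1 h2, h0, add_zero]

theorem contDiffAt_duhamelSolution (ha : 0 < a) (hf : ContinuousOn fI (Icc (-1) 1))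
    (hp : Continuous p) (hl : Continuous l) (hpm : ∀ s, p s ∈ Icc (-1 : ℝ) 1) {x t : ℝ}
    (hx : x ∈ Icc (-1 : ℝ) 1) (ht : t ∈ Ioc 0 T) (h1 : x ≠ p t - sourceDist a (p t))
    (h2 : x ≠ p t + sourceDist a (p t)) :
    ContDiffAt ℝ ∞ (fun z : ℝ × ℝ => duhamelSolution a T fI p l z.1 z.2) (x, t) ∧
      heatOp (fun z : ℝ × ℝ => duhamelSolution a T fI p l z.1 z.2) (x, t) = 0 := by
  have hT0 : 0 ≤ T := ht.1.le.trans ht.2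
  have hx' : |x| < 3 / 2 := lt_of_le_of_lt (abs_le.2 hx) (by norm_num)
  have hd : Continuous fun s => sourceDist a (p s) := (continuous_sourceDist a).comp hp
  have hne : ∀ {y : ℝ}, y ∈ Icc (-1 : ℝ) 1 → x ≠ y →
      x - y ≠ 0 ∧ x - (2 - y) ≠ 0 ∧ x - (-2 - y) ≠ 0 := fun hy hxy =>
    ⟨sub_ne_zero.2 hxy, fun h => hxy (by linarith [hx.2, hy.2]),
      fun h => hxy (by linarith [hx.1, hy.1])⟩
  obtain ⟨s1, s2⟩ := contDiffAt_initialPart hf hx' ht.1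
  obtain ⟨s3, s4⟩ := contDiffAt_sourcePart (q := fun s => p s - sourceDist a (p s)) (t := t) hT0
    (hp.sub hd).continuousOn hl.continuousOn (fun s _ => (source_mem (hpm s) ha).1) hx'
    (fun s _ _ => hne (source_mem (hpm t) ha).1 h1)
  obtain ⟨s5, s6⟩ := contDiffAt_sourcePart (q := fun s => p s + sourceDist a (p s)) (t := t) hT0
    (hp.add hd).continuousOn hl.continuousOn (fun s _ => (source_mem (hpm s) ha).2) hx'
    (fun s _ _ => hne (source_mem (hpm t) ha).2 h2)
  have e : (fun z : ℝ × ℝ => duhamelSolution a T fI p l z.1 z.2) =ᶠ[𝓝 (x, t)] fun z =>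
      initialPart fI z.1 z.2 + (sourcePart T (fun s => p s - sourceDist a (p s)) l z.1 z.2
        - sourcePart T (fun s => p s + sourceDist a (p s)) l z.1 z.2) := by
    have c : ContinuousAt (fun r : ℝ × ℝ => r.2) (x, t) := by fun_prop
    filter_upwards [c.eventually (lt_mem_nhds ht.1)] with r hr
    exact duhamelSolution_of_pos hr _
  refine ⟨(s1.add (s3.sub s5)).congr_of_eventuallyEq e, ?_⟩
  rw [heatOp_congr e, heatOp_add s1 (s3.sub s5), heatOp_sub s3 s5, s2, s4, s6]
  ring

theorem LocalSolution.flux_eq (h : LocalSolution a T δ lam fI pI p l)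
    (hd : InitialData a₀ fI pI) (ha₀ : 0 < a₀) (hlam : initialFlux fI pI = lam) :
    ∀ t ∈ Icc 0 T, HasDerivAt (fun x => duhamelSolution a T fI p l x t) (-(l t)) (p t) := by
  intro t ht
  rcases ht.1.eq_or_lt with h0 | h0
  · have h1 := hd.add_le
    have h2 := hd.le_sub
    simp only [← h0, duhamelSolution_zero, h.p_zero, h.l_zero]
    rw [← hlam, initialFlux, neg_neg]
    exact hd.hasDerivAt ⟨by linarith, by linarith⟩
  · simp only [duhamelSolution_of_pos h0]
    exact h.hasDerivAt t ⟨h0, ht.2⟩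

/-- Within δ of p_I, strict decrease leaves one zero. Outside, the sign lemmas apply with edges p_I
∓ δ, because source and sink remain beyond p_I ∓ 6δ and the values on the edges are at least λδ/16
in modulus. -/
theorem LocalSolution.zero_iff (h : LocalSolution a T δ lam fI pI p l) (hd : InitialData a₀ fI pI)
    (hlam : 0 < lam) (hδ : 0 < δ) (h8 : 8 * δ = a₀) (ha : a₀ ≤ a) (hT1 : T ≤ 1)
    (hp : ∀ s, p s ∈ Icc (pI - δ) (pI + δ)) (hl : ∀ s, lam / 4 ≤ l s) :
    ∀ t ∈ Icc 0 T, ∀ x ∈ Icc (-1 : ℝ) 1, duhamelSolution a T fI p l x t = 0 ↔ x = p t := by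
  intro t ht x hx
  have hT0 : 0 ≤ T := ht.1.trans ht.2
  have hf := hd.contDiffOn.continuousOn
  have b1 := hd.add_le
  have b2 := hd.le_sub
  have hpm : ∀ s, p s ∈ Icc (-1 : ℝ) 1 := fun s =>
    ⟨by linarith [(hp s).1], by linarith [(hp s).2]⟩
  have hdc : Continuous fun s => sourceDist a (p s) := (continuous_sourceDist a).comp h.continuous_p
  have h7 : ∀ s, 7 * δ ≤ sourceDist a (p s) := fun s => le_sourceDist hδ h8 ha b1 b2 (hp s)
  have hs := fun s => source_mem (hpm s) (show 0 < a by linarith)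
  have hl0 : ∀ s, 0 ≤ l s := fun s => le_trans (by linarith) (hl s)
  have hm : 0 < lam * δ / 16 := by positivity
  rcases ht.1.eq_or_lt with h0 | h0
  · rw [← h0, duhamelSolution_zero, h.p_zero]
    refine ⟨fun hz => ?_, fun hz => hz ▸ hd.zero⟩
    by_contra hne
    rcases lt_or_gt_of_ne hne with hlt | hgt
    · exact (hd.pos x hx hlt).ne' hz
    · exact (hd.neg x hx hgt).ne hz
  rw [duhamelSolution_of_pos h0]
  have ht' : t ∈ Ioc 0 T := ⟨h0, ht.2⟩
  refine ⟨fun hz => ?_, fun hz => hz ▸ h.zero t ht'⟩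
  rcases le_or_gt x (pI - δ) with hxl | hxl
  · refine absurd hz (ne_of_gt ?_)
    exact pos_left_of_free_boundary (b := pI - δ) (c := pI - 6 * δ)
      (q := fun s => p s - sourceDist a (p s)) (q' := fun s => p s + sourceDist a (p s)) hf hT0 hT1
      (by linarith) (by linarith) (by linarith) (h.continuous_p.sub hdc)
      (fun s => ⟨(hs s).1.1, by linarith [(hp s).2, h7 s]⟩) (h.continuous_p.add hdc)
      (fun s => ⟨by linarith [(hp s).1, h7 s], (hs s).2.2⟩) h.continuous_l hl0
      (fun y hy => hd.pos y ⟨hy.1, by linarith [hy.2]⟩ (by linarith [hy.2])) hm h.left t ht' x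
      ⟨hx.1, hxl⟩
  rcases le_or_gt (pI + δ) x with hxr | hxr
  · refine absurd hz (ne_of_lt ?_)
    exact neg_right_of_free_boundary (b := pI + δ) (c := pI + 6 * δ)
      (q := fun s => p s - sourceDist a (p s)) (q' := fun s => p s + sourceDist a (p s)) hf hT0 hT1
      (by linarith) (by linarith) (by linarith) (h.continuous_p.sub hdc)
      (fun s => ⟨(hs s).1.1, by linarith [(hp s).2, h7 s]⟩) (h.continuous_p.add hdc)
      (fun s => ⟨by linarith [(hp s).1, h7 s], (hs s).2.2⟩) h.continuous_l hl0
      (fun y hy => hd.neg y ⟨by linarith [hy.1], hy.2⟩ (by linarith [hy.1])) hm h.right t ht' x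
      ⟨hxr, hx.2⟩
  have hxI : x ∈ Icc (pI - δ) (pI + δ) := ⟨hxl.le, hxr.le⟩
  have hz' := h.zero t ht'
  rcases le_total x (p t) with hle | hle
  · have := h.decreasing t ht' x hxI (p t) (hp t) hle
    rw [hz, hz', sub_zero] at this
    nlinarith
  · have := h.decreasing t ht' (p t) (hp t) x hxI hle
    rw [hz, hz', sub_zero] at this
    nlinarith

theorem LocalSolution.isSolution (h : LocalSolution a T δ lam fI pI p l)
    (hd : InitialData a₀ fI pI) (hlam : initialFlux fI pI = lam) (hδ : 0 < δ) (h8 : 8 * δ = a₀)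
    (ha : a₀ ≤ a) (hT0 : 0 ≤ T) (hT1 : T ≤ 1) (hp : ∀ s, p s ∈ Icc (pI - δ) (pI + δ))
    (hl : ∀ s, lam / 4 ≤ l s) : IsSolution a T fI (duhamelSolution a T fI p l) p := by
  have hf := hd.contDiffOn.continuousOn
  have b1 := hd.add_le
  have b2 := hd.le_sub
  have ha' : 0 < a := by linarith
  have hpo : ∀ s, p s ∈ Ioo (-1 : ℝ) 1 := fun s =>
    ⟨by linarith [(hp s).1], by linarith [(hp s).2]⟩
  have hpm : ∀ s, p s ∈ Icc (-1 : ℝ) 1 := fun s => Ioo_subset_Icc_self (hpo s)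
  have hdc : Continuous fun s => sourceDist a (p s) := (continuous_sourceDist a).comp h.continuous_p
  have hs := fun s => source_mem (hpm s) ha'
  have hflux := h.flux_eq hd (by linarith) hlam
  have hd0 : ∀ s, 0 ≤ sourceDist a (p s) := fun s =>
    le_trans (by linarith) (le_sourceDist hδ h8 ha b1 b2 (hp s))
  have hsm := fun {x t : ℝ} => contDiffAt_duhamelSolution (T := T) (x := x) (t := t) ha' hf
    h.continuous_p h.continuous_l hpm
  have hi1 : ∀ x ∈ Icc (-1 : ℝ) 1, ∀ t ∈ Ioc 0 T, IntervalIntegrable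
      (fun s => neumannKernel x (p s - sourceDist a (p s)) (t - s) * l s) volume 0 T :=
    fun x hx t ht => intervalIntegrable_sourcePart (q := fun s => p s - sourceDist a (p s))
      (h.continuous_p.sub hdc) (fun s => (hs s).1) h.continuous_l hT0 hT1 hx ht.2
  have hi2 : ∀ x ∈ Icc (-1 : ℝ) 1, ∀ t ∈ Ioc 0 T, IntervalIntegrable
      (fun s => neumannKernel x (p s + sourceDist a (p s)) (t - s) * l s) volume 0 T :=
    fun x hx t ht => intervalIntegrable_sourcePart (q := fun s => p s + sourceDist a (p s))
      (h.continuous_p.add hdc) (fun s => (hs s).2) h.continuous_l hT0 hT1 hx ht.2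
  have hsub : ∀ {t}, t ∈ Ioc 0 T → uIcc 0 t ⊆ uIcc 0 T := fun {t} ht =>
    uIcc_subset_uIcc_left (show t ∈ uIcc 0 T from uIcc_of_le hT0 ▸ ⟨ht.1.le, ht.2⟩)
  have he : ∀ x, ∀ t ∈ Ioc 0 T, EqOn (fun s =>
      neumannKernel x (p s - sourceDist a (p s)) (t - s) * l s
        - neumannKernel x (p s + sourceDist a (p s)) (t - s) * l s)
      (duhamelIntegrand a (duhamelSolution a T fI p l) p x t) (uIcc 0 t) := by
    intro x t ht s hst
    have hsT := hsub ht hst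
    rw [uIcc_of_le hT0] at hsT
    simp only [duhamelIntegrand, flux, (hflux s hsT).deriv, neg_neg]
    ring
  refine ⟨continuousOn_duhamelSolution hf ha' h.continuous_p h.continuous_l hpm hT0 hT1,
    fun x _ => duhamelSolution_zero x, fun t _ => hpo t,
    h.zero_iff hd (hlam ▸ hd.flux_pos) hδ h8 ha hT1 hp hl,
    fun t ht => (hflux t ht).differentiableAt, fun x hx t ht => ?_, fun x hx t ht => ?_,
    fun x hx t ht h1 h2 => ?_, fun t ht hq => ?_, fun t ht hq => ?_⟩
  · exact (((hi1 x hx t ht).mono_set (hsub ht)).sub ((hi2 x hx t ht).mono_set (hsub ht))).congr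
      fun s hst => he x t ht (uIoc_subset_uIcc hst)
  · rw [duhamelSolution_of_pos ht.1, duhamelSum, initialPart,
      sourcePart_eq_integral_le ht.1.le ht.2 (hi1 x hx t ht),
      sourcePart_eq_integral_le ht.1.le ht.2 (hi2 x hx t ht), ← intervalIntegral.integral_sub
      ((hi1 x hx t ht).mono_set (hsub ht)) ((hi2 x hx t ht).mono_set (hsub ht)),
      intervalIntegral.integral_congr (he x t ht)]
  · obtain ⟨s1, s2⟩ := hsm (Ioo_subset_Icc_self hx) (Ioo_subset_Ioc_self ht) h1 h2
    rw [heatOp_eq_deriv s1] at s2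
    exact ⟨s1.of_le ENat.LEInfty.out, sub_eq_zero.1 s2⟩
  -- Away from the source the solution is smooth across x = -1, and it is even about that point.
  · have s1 := (hsm (x := -1) (left_mem_Icc.2 (by norm_num)) ht hq.ne
      (by linarith [hd0 t] : (-1 : ℝ) < _).ne).1.differentiableAt (by simp)
    refine (hasDerivAt_zero_of_reflect (f := fun x => duhamelSolution a T fI p l x t)
      (DifferentiableAt.comp (f := fun x : ℝ => (x, t)) (-1) s1 (by fun_prop))
      fun x => ?_).hasDerivWithinAt
    rw [duhamelSolution_of_pos ht.1, duhamelSolution_of_pos ht.1,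
      show 2 * (-1 : ℝ) - x = -2 - x by ring, duhamelSum_reflect_left]
  · have s1 := (hsm (x := 1) (right_mem_Icc.2 (by norm_num)) ht
      (by linarith [hd0 t] : _ < (1 : ℝ)).ne' hq.ne').1.differentiableAt (by simp)
    refine (hasDerivAt_zero_of_reflect (f := fun x => duhamelSolution a T fI p l x t)
      (DifferentiableAt.comp (f := fun x : ℝ => (x, t)) 1 s1 (by fun_prop))
      fun x => ?_).hasDerivWithinAt
    rw [duhamelSolution_of_pos ht.1, duhamelSolution_of_pos ht.1,
      show 2 * (1 : ℝ) - x = 2 - x by ring, duhamelSum_reflect_right]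

theorem LocalSolution.contDiffOn (h : LocalSolution a T δ lam fI pI p l)
    (hd : InitialData a₀ fI pI) (hδ : 0 < δ) (h8 : 8 * δ = a₀) (ha : a₀ ≤ a)
    (hp : ∀ s, p s ∈ Icc (pI - δ) (pI + δ)) :
    ContDiffOn ℝ ∞ (fun q : ℝ × ℝ => duhamelSolution a T fI p l q.1 q.2)
      {q : ℝ × ℝ | q.2 ∈ Ioc 0 T ∧ |q.1 - p q.2| ≤ δ} := by
  rintro ⟨x, t⟩ ⟨ht, hx⟩
  have b1 := hd.add_le
  have b2 := hd.le_sub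
  have hx' := abs_le.1 hx
  have h7 := le_sourceDist hδ h8 ha b1 b2 (hp t)
  have hpt := hp t
  simp only at ht hx'
  refine (contDiffAt_duhamelSolution (by linarith) hd.contDiffOn.continuousOn h.continuous_p
    h.continuous_l (fun s => ⟨by linarith [(hp s).1], by linarith [(hp s).2]⟩)
    ⟨by linarith [hx'.1, hpt.1], by linarith [hx'.2, hpt.2]⟩ ht (ne_of_gt ?_)
    (ne_of_lt ?_)).1.contDiffWithinAt
  · linarith [hx'.1]
  · linarith [hx'.2]

end GlobalSolution

end PriceFormation

theorem mainTheorem3 (a a₀ M lamI : ℝ) (ha : 0 < a) (ha1 : a < 1)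
    (ha₀ : 0 < a₀) (ha₀' : a₀ < a / 4) :
    ∃ t₀ : ℝ, 0 < t₀ ∧
      ∀ (fI : ℝ → ℝ) (pI : ℝ), PriceFormation.InitialData a₀ fI pI →
        IsLUB ((fun x => |fI x|) '' Icc (-1 : ℝ) 1) M →
        PriceFormation.initialFlux fI pI = lamI →
        ∃ a₁ : ℝ, 0 < a₁ ∧ ∃ (f : ℝ → ℝ → ℝ) (p : ℝ → ℝ),
          PriceFormation.IsSolution a t₀ fI f p ∧
          (∃ r : ℝ, 0 < r ∧ ContDiffOn ℝ ∞ (fun q : ℝ × ℝ => f q.1 q.2)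
            {q : ℝ × ℝ | q.2 ∈ Ioc 0 t₀ ∧ |q.1 - p q.2| ≤ r}) ∧
          (∀ t ∈ Icc 0 t₀, lamI / 4 ≤ PriceFormation.flux f p t) ∧
          0 < lamI / 4 ∧
          (∀ t ∈ Icc 0 t₀, |p t - pI| ≤ a₁ * Real.sqrt t) := by
  rcases le_or_gt lamI 0 with hlam | hlam
  -- For `lamI ≤ 0` there are no admissible data, so any time will do.
  · exact ⟨1, one_pos, fun fI pI hd _ hfl => absurd (hfl ▸ hd.flux_pos) (not_lt.2 hlam)⟩
  -- The scale δ = a₀/8 is below 1/32 because a₀ < a/4 < 1/4.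
  have hδ : 0 < a₀ / 8 := by linarith
  have h8 : 8 * (a₀ / 8) = a₀ := by ring
  have haa : a₀ ≤ a := by linarith
  obtain ⟨T, hT0, hT1, hT⟩ := PriceFormation.exists_localSolution (a₀ := a₀) hδ
    (by linarith) h8 hlam M
  refine ⟨T, hT0, fun fI pI hd hM hfl => ?_⟩
  obtain ⟨p₀, l₀, h₀⟩ := hT a fI pI haa hd (fun x hx => hM.1 (mem_image_of_mem _ hx)) hfl
  obtain ⟨p, l, h, hp, hl⟩ := h₀.exists_extension hT0.le
  obtain ⟨a₁, ha₁, hsq⟩ := h.sqrt_bound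
  refine ⟨a₁, ha₁, PriceFormation.duhamelSolution a T fI p l, p,
    h.isSolution hd hfl hδ h8 haa hT0.le hT1 hp hl,
    ⟨a₀ / 8, hδ, h.contDiffOn hd hδ h8 haa hp⟩, fun t ht => ?_, by linarith, hsq⟩
  rw [PriceFormation.flux, (h.flux_eq hd ha₀ hfl t ht).deriv, neg_neg]
  exact hl t
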